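/- Let $(s_1,s_2,\rho,e,h)$ be one of the fourteen rows $(\frac15,\frac25,4\cdot5^5,\frac{11}3,42)$, $(\frac1{10},\frac3{10},4\cdot 8\cdot10^5,\frac{35}3,290)$, $(\frac12,\frac12,4\cdot2^8,\frac53,10)$, $(\frac13,\frac13,4\cdot3^6,\frac73,18)$, $(\frac12,\frac13,4\cdot2^4 3^3,2,14)$, $(\frac12,\frac14,4\cdot2^{10},\frac83,24)$, $(\frac18,\frac38,4\cdot2^{16},\frac{23}3,150)$, $(\frac16,\frac13,4\cdot2^4 3^6,5,70)$, $(\frac1{12},\frac5{12},4\cdot12^6,\frac{47}3,486)$, $(\frac14,\frac14,4\cdot2^{12},\frac{11}3,38)$, $(\frac14,\frac13,4\cdot12^3,3,28)$, $(\frac16,\frac14,4\cdot2^{10}3^3,\frac{17}3,80)$, $(\frac16,\frac16,4\cdot2^8 3^6,\frac{23}3,122)$, $(\frac12,\frac16,4\cdot2^8 3^3,\frac{14}3,66)$. With $(s)_x=\Gamma(s+x)/\Gamma(s)$ put $$A_x=\rho^x\,\frac{(1/2)_x(s_1)_x(1-s_1)_x(s_2)_x(1-s_2)_x}{\Gamma(x+1)^5},\qquad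 w_0=\sum_{n\ge0}A_nz^n,$$ and let $L_5=\theta^5-\rho z(\theta+\frac12)(\theta+s_1)(\theta+1-s_1)(\theta+s_2)(\theta+1-s_2)$, $\theta=z\frac{d}{dz}$. A *pullback* of $L_5$ is an equation $\theta^4y=c_3\theta^3y+c_2\theta^2y+c_1\theta y+c_0y$ with rational functions $c_i$ of $z$, $c_i(0)=0$, having solutions $$y_0,\quad y_1=y_0\log z+\alpha_1,\quad y_2=\tfrac12y_0\log^2z+\alpha_1\log z+\alpha_2,\quad y_3=\tfrac16y_0\log^3z+\tfrac12\alpha_1\log^2z+\alpha_2\log z+\alpha_3$$ with power series $y_0,\alpha_1,\alpha_2,\alpha_3$ in $z$, $y_0(0)=1$, $\alpha_i(0)=0$, such that $y_0y_3'-y_0'y_3=y_1y_2'-y_1'y_2$, all the functions $z(y_iy_j'-y_i'y_j)$ are annihilated by $L_5$, and $w_0=z(y_0y_1'-y_0'y_1)$. Put $t=y_1/y_0$, $q=e^t=z\exp(\alpha_1/y_0)$ and $\Phi=\frac12\left(\frac{y_1y_2}{y_0^2}-\frac{y_3}{y_0}\right)$. Then: 1. $A_x=1+\frac e2\pi^2x^2-h\zeta(3)x^3+O(x^4)$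 as $x\to0$. 2. A pullback exists. For every pullback, $y_0,\alpha_1,\alpha_2,\alpha_3$ converge for $|z|<1/\rho$, and there are power series $T$ (with $T(0)=0$ and positive radius of convergence) and $K$ in $q$ such that $\Phi=\frac16\log^3q-T(q)$, $K(q)=\frac{d^2}{dt^2}\left(\frac{y_2}{y_0}\right)$ (the Yukawa coupling), and $\left(q\frac{d}{dq}\right)^3T=1-K$. 3. Let $u\in\{1,-1\}$ and $\ell\in\mathbb C$, let $z=ue^{\ell}$ satisfy $|z|<1/\rho$, read $\log z$ as $\ell$ and $z^{n+x}$ as $u^ne^{(n+x)\ell}$ (so for real $z$ one may take $u=\operatorname{sign}z$, $\ell=\log|z|$), and suppose that for some complex numbers $a,b,c,k,j$, as the real variable $x\to0$, $$\sum_{n=0}^\infty A_{n+x}\left(a+b(n+x)+c(n+x)^2\right)z^{n+x}=\frac1{\pi^2}-\frac k2x^2+\frac j{24}\pi^2x^4+O(x^5).$$ If $y_0(z)\neq0$, then, at this $z$, $\Phi-\frac{\pi^2}2(k+e)t-h\zeta(3)=0$. If $y_0$ has no zero on the segment $[0,z]$, then $$\tfrac16t^3-\tfrac{\pi^2}2(k+e)t-h\zeta(3)-T(q)=0,\qquad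 q=u\,e^t,$$ where $T(q)$ is the value at $q=q(z)$ of any function that is the sum of the power series $T$ near $0$ and is analytic at every point of the curve $s\mapsto q(sz)$, $0\le s\le1$ (in particular the sum of the series $T$ if this curve lies in its disc of convergence). -/

import Mathlib

open scoped PowerSeries Topology

noncomputable section

/-- The data of one hypergeometric case: the exponents `s₁, s₂`, the normalisation `ρ`, and the
invariants `e, h`. -/
structure HypergeometricCase where
  s₁ : ℚ
  s₂ : ℚ
  ρ : ℕ
  e : ℚ
  h : ℕ

/-- The fourteen hypergeometric cases, as `(s₁, s₂, ρ, e, h)`. -/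
def hypergeometricTable : List HypergeometricCase :=
  [⟨1 / 5, 2 / 5, 4 * 5 ^ 5, 11 / 3, 42⟩,
   ⟨1 / 10, 3 / 10, 4 * 8 * 10 ^ 5, 35 / 3, 290⟩,
   ⟨1 / 2, 1 / 2, 4 * 2 ^ 8, 5 / 3, 10⟩,
   ⟨1 / 3, 1 / 3, 4 * 3 ^ 6, 7 / 3, 18⟩,
   ⟨1 / 2, 1 / 3, 4 * 2 ^ 4 * 3 ^ 3, 2, 14⟩,
   ⟨1 / 2, 1 / 4, 4 * 2 ^ 10, 8 / 3, 24⟩,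
   ⟨1 / 8, 3 / 8, 4 * 2 ^ 16, 23 / 3, 150⟩,
   ⟨1 / 6, 1 / 3, 4 * 2 ^ 4 * 3 ^ 6, 5, 70⟩,
   ⟨1 / 12, 5 / 12, 4 * 12 ^ 6, 47 / 3, 486⟩,
   ⟨1 / 4, 1 / 4, 4 * 2 ^ 12, 11 / 3, 38⟩,
   ⟨1 / 4, 1 / 3, 4 * 12 ^ 3, 3, 28⟩,
   ⟨1 / 6, 1 / 4, 4 * 2 ^ 10 * 3 ^ 3, 17 / 3, 80⟩,
   ⟨1 / 6, 1 / 6, 4 * 2 ^ 8 * 3 ^ 6, 23 / 3, 122⟩,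
   ⟨1 / 2, 1 / 6, 4 * 2 ^ 8 * 3 ^ 3, 14 / 3, 66⟩]

/-- The Pochhammer symbol `(s)_x = Γ(s + x) / Γ(s)` with real index `x`. -/
def pochhammerReal (s x : ℝ) : ℝ := Real.Gamma (s + x) / Real.Gamma s

namespace HypergeometricCase

/-- `A_x = ρ^x (1/2)_x (s₁)_x (1-s₁)_x (s₂)_x (1-s₂)_x / Γ(x+1)^5`. -/
def A (r : HypergeometricCase) (x : ℝ) : ℝ :=
  (r.ρ : ℝ) ^ x * (pochhammerReal (1 / 2) x * pochhammerReal r.s₁ x * pochhammerReal (1 - r.s₁) x *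
    pochhammerReal r.s₂ x * pochhammerReal (1 - r.s₂) x) / Real.Gamma (x + 1) ^ 5

/-- The power series `w₀ = ∑ Aₙ zⁿ`. -/
def w₀ (r : HypergeometricCase) : ℂ⟦X⟧ := PowerSeries.mk fun n => (r.A n : ℂ)

end HypergeometricCase

/-- Polynomials in a formal logarithm `L = log z` with coefficients in `ℂ⟦z⟧`.  The polynomial
variable is `L`. -/
abbrev LogSeries := Polynomial ℂ⟦X⟧

/-- `z d/dz` on formal power series. -/
def thetaSeries : Derivation ℂ ℂ⟦X⟧ ℂ⟦X⟧ :=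
  (PowerSeries.X : ℂ⟦X⟧) • PowerSeries.derivative ℂ

/-- `θ = z d/dz` on `ℂ⟦z⟧[log z]`: it acts on the coefficients as `z d/dz`, and `θ (log z) = 1`. -/
def theta : Module.End ℂ LogSeries :=
  Polynomial.lsum (fun n =>
    ((Polynomial.monomial n : ℂ⟦X⟧ →ₗ[ℂ⟦X⟧] LogSeries).restrictScalars ℂ) ∘ₗ
      (thetaSeries : ℂ⟦X⟧ →ₗ[ℂ] ℂ⟦X⟧))
  + (Polynomial.derivative : LogSeries →ₗ[ℂ⟦X⟧] LogSeries).restrictScalars ℂ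

theorem theta_monomial (n : ℕ) (f : ℂ⟦X⟧) :
    theta (Polynomial.monomial n f) =
      Polynomial.monomial n (PowerSeries.X * PowerSeries.derivative ℂ f) +
        Polynomial.monomial (n - 1) (f * n) := by
  simp [theta, thetaSeries, Polynomial.lsum_apply, Polynomial.derivative_monomial]

/-- The fifth-order hypergeometric operator
`θ⁵ - ρ z (θ + 1/2)(θ + s₁)(θ + 1 - s₁)(θ + s₂)(θ + 1 - s₂)` on `ℂ⟦z⟧[log z]`. -/
def HypergeometricCase.fifthOrder (r : HypergeometricCase) (w : LogSeries) : LogSeries :=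
  (theta ^ 5) w - Polynomial.C ((r.ρ : ℂ⟦X⟧) * PowerSeries.X) *
    ((theta + (1 / 2 : ℂ) • 1) * (theta + (r.s₁ : ℂ) • 1) * (theta + (1 - r.s₁ : ℂ) • 1) *
      (theta + (r.s₂ : ℂ) • 1) * (theta + (1 - r.s₂ : ℂ) • 1) : Module.End ℂ LogSeries) w

/-- `z (f g' - f' g)`. -/
def wronskianZ (f g : LogSeries) : LogSeries := f * theta g - theta f * g

/-- The power series occurring in a Frobenius basis at a point of maximal unipotent monodromy. -/
structure FrobeniusBasis where
  f₀ : ℂ⟦X⟧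
  α₁ : ℂ⟦X⟧
  α₂ : ℂ⟦X⟧
  α₃ : ℂ⟦X⟧
  f₀_zero : PowerSeries.constantCoeff f₀ = 1
  α₁_zero : PowerSeries.constantCoeff α₁ = 0
  α₂_zero : PowerSeries.constantCoeff α₂ = 0
  α₃_zero : PowerSeries.constantCoeff α₃ = 0

namespace FrobeniusBasis

open Polynomial in
/-- The basis `y₀, y₁, y₂, y₃`; here `X` is `log z`. -/
def y (Y : FrobeniusBasis) : Fin 4 → LogSeries :=
  ![C Y.f₀,
    C Y.f₀ * X + C Y.α₁,
    (1 / 2 : ℂ) • (C Y.f₀ * X ^ 2) + C Y.α₁ * X + C Y.α₂,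
    (1 / 6 : ℂ) • (C Y.f₀ * X ^ 3) + (1 / 2 : ℂ) • (C Y.α₁ * X ^ 2) + C Y.α₂ * X + C Y.α₃]

/-- The quotient `yᵢ / y₀`. -/
def quot (Y : FrobeniusBasis) (i : Fin 4) : LogSeries := Polynomial.C Y.f₀⁻¹ * Y.y i

/-- `t = y₁ / y₀`. -/
def t (Y : FrobeniusBasis) : LogSeries := Y.quot 1

/-- `q = exp t = z exp (α₁ / y₀)`, as a power series in `z`. -/
def q (Y : FrobeniusBasis) : ℂ⟦X⟧ :=
  PowerSeries.X * (PowerSeries.exp ℂ).subst (Y.α₁ * Y.f₀⁻¹)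

/-- `d/dt = (θ t)⁻¹ θ`; note `θ t = 1 + θ (α₁ / y₀)`. -/
def ddt (Y : FrobeniusBasis) (f : LogSeries) : LogSeries :=
  Polynomial.C (1 + thetaSeries (Y.α₁ * Y.f₀⁻¹))⁻¹ * theta f

/-- The Gromov-Witten potential `Φ = (1/2) (y₁ y₂ / y₀² - y₃ / y₀)`. -/
def potential (Y : FrobeniusBasis) : LogSeries :=
  (1 / 2 : ℂ) • (Y.quot 1 * Y.quot 2 - Y.quot 3)

/-- `K`, a power series in `q`, is the Yukawa coupling `d²/dt² (y₂ / y₀)`. -/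
def IsYukawaCoupling (Y : FrobeniusBasis) (K : ℂ⟦X⟧) : Prop :=
  Polynomial.C (K.subst Y.q : ℂ⟦X⟧) = Y.ddt (Y.ddt (Y.quot 2))

/-- `T`, a power series in `q` without constant term, satisfies `Φ = (1/6) log³ q - T(q)`. -/
def IsPotentialSeries (Y : FrobeniusBasis) (T : ℂ⟦X⟧) : Prop :=
  PowerSeries.constantCoeff T = 0 ∧
    Y.potential = (1 / 6 : ℂ) • Y.t ^ 3 - Polynomial.C (T.subst Y.q : ℂ⟦X⟧)

end FrobeniusBasis

/-- The fourth-order equation `θ⁴ y = c₃ θ³ y + c₂ θ² y + c₁ θ y + c₀ y` with Frobenius basis `Y` is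
the (ordinary) pullback of the fifth-order equation of the case `r`. -/
structure IsPullback (r : HypergeometricCase) (c : Fin 4 → ℂ⟦X⟧) (Y : FrobeniusBasis) : Prop where
  /-- The coefficients are (expansions at `0` of) rational functions of `z`. -/
  rational : ∀ i, ∃ P Q : Polynomial ℂ, Q ≠ 0 ∧ (Q : ℂ⟦X⟧) * c i = (P : ℂ⟦X⟧)
  /-- The indicial equation at `z = 0` has `0` as a root of order four. -/
  mum : ∀ i, PowerSeries.constantCoeff (c i) = 0
  /-- `y₀, …, y₃` solve the fourth-order equation. -/
  solution : ∀ i, (theta ^ 4) (Y.y i) = ∑ m : Fin 4, Polynomial.C (c m) * (theta ^ (m : ℕ)) (Y.y i)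
  /-- The Calabi-Yau condition `y₀ y₃' - y₀' y₃ = y₁ y₂' - y₁' y₂`. -/
  calabiYau : wronskianZ (Y.y 0) (Y.y 3) = wronskianZ (Y.y 1) (Y.y 2)
  /-- The Wronskians, multiplied by `z`, solve the fifth-order equation. -/
  wronskian : ∀ i j, r.fifthOrder (wronskianZ (Y.y i) (Y.y j)) = 0
  /-- `w₀ = z (y₀ y₁' - y₀' y₁)`. -/
  w₀_eq : Polynomial.C r.w₀ = wronskianZ (Y.y 0) (Y.y 1)

/-- The sum of a power series at a complex number. -/
def seriesAt (f : ℂ⟦X⟧) (z : ℂ) : ℂ := ∑' n : ℕ, PowerSeries.coeff n f * z ^ n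

/-- Convergence of a power series at a complex number. -/
def ConvergesAt (f : ℂ⟦X⟧) (z : ℂ) : Prop := Summable fun n : ℕ => PowerSeries.coeff n f * z ^ n

/-- The value of an element of `ℂ⟦z⟧[log z]` at the point `z`, with the value `l` of `log z`. -/
def logSeriesAt (p : LogSeries) (z l : ℂ) : ℂ := p.sum fun n f => seriesAt f z * l ^ n

namespace FrobeniusBasis

/-- The value of `t = y₁ / y₀`. -/
def tAt (Y : FrobeniusBasis) (z l : ℂ) : ℂ := logSeriesAt (Y.y 1) z l / logSeriesAt (Y.y 0) z l

/-- The value of `q = z exp (α₁ / y₀)`. -/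
def qAt (Y : FrobeniusBasis) (z : ℂ) : ℂ :=
  z * Complex.exp (seriesAt Y.α₁ z / seriesAt Y.f₀ z)

/-- The value of `Φ = (1/2) (y₁ y₂ / y₀² - y₃ / y₀)`. -/
def potentialAt (Y : FrobeniusBasis) (z l : ℂ) : ℂ :=
  1 / 2 * (logSeriesAt (Y.y 1) z l * logSeriesAt (Y.y 2) z l / logSeriesAt (Y.y 0) z l ^ 2 -
    logSeriesAt (Y.y 3) z l / logSeriesAt (Y.y 0) z l)

end FrobeniusBasis

/-- The expansion
`∑ A_{n+x} (a + b (n+x) + c (n+x)²) z^{n+x} = 1/π² - (k/2) x² + (j/24) π² x⁴ + O(x⁵)` as `x → 0`,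
for `z = u exp l` with `u = ±1`, where `z^{n+x}` means `uⁿ exp ((n+x) l)`. -/
def HasRamanujanExpansion (r : HypergeometricCase) (u l a b c k j : ℂ) : Prop :=
  (fun x : ℝ => (∑' n : ℕ, (r.A (n + x) : ℂ) * (a + b * (n + x) + c * (n + x) ^ 2) *
      (u ^ n * Complex.exp ((n + x) * l))) -
    (1 / (Real.pi : ℂ) ^ 2 - k / 2 * x ^ 2 + j / 24 * (Real.pi : ℂ) ^ 2 * x ^ 4))
  =O[𝓝 0] fun x : ℝ => x ^ 5

end

open scoped PowerSeries Topology
open scoped ENNReal NNReal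

noncomputable section

/-! ### The derivation `θ` -/

/-! The theorem comes down to one algebraic relation between values at a point. Let wᵢ be the
coefficient of xⁱ in ∑ (A_{n+x}/A_x) z^{n+x}; for i < 5 it solves the fifth-order equation and has
leading term logⁱz/i!. A logarithmic solution is determined by its coefficient of z⁰
(`eq_zero_of_theta_pow_eq`), because θ acts on the coefficient of zⁿ as n + d/d(log z), which is
injective for n ≠ 0. So the Wronskians of every pullback are known: W₀₁ = w₀, W₀₂ = w₁, W₀₃ = W₁₂ =
w₂, W₁₃ = 2w₃.

Put B = a + bθ + cθ². The sum in the hypothesis is A_x ∑ (B wᵢ)(z) xⁱ, and dividing by the expansion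
of A_x gives B w₀ = 1/π², B w₁ = 0, B w₂ = -(k+e)/2, B w₃ = hζ(3)/π²
(`quadraticTheta_eq_of_hasRamanujanExpansion`). Now (f, g) ↦ (B W(f, g))(z) is an alternating form;
on functions vanishing at z it reduces to c(θf θ²g - θ²f θg). Let tᵢ = yᵢ/y₀ at z. The Calabi-Yau
condition and its derivative say that y₃ - t₃y₀ and t₁(y₂ - t₂y₀) - t₂(y₁ - t₁y₀) agree at z
together with θ and θ² of them. Pairing both with y₁ - t₁y₀ gives the equation for Φ
(`potential_relation`).

The pullback is explicit, with coefficients polynomial in D = ρz/(16(1-ρz)): the 2×2 minors of two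
solutions and their derivatives satisfy a linear system, from which the fifth-order equation follows
by five differentiations (`theta_pow_five_of_wronskians`). Its Calabi-Yau condition and the formula
for w₀ follow from uniqueness of formal solutions. Conversely a Frobenius basis can be recovered
from its Wronskians (`FrobeniusBasis.eq_of_wronskianZ_eq`), so every pullback has this basis, which
converges where the explicit coefficients do.

The expansion of A_x comes from Gauss's multiplication formula, which turns products of Pochhammer
symbols into quotients of Γ(mx+1) by powers of Γ(x+1), and from log Γ(1+x) = -γx + ζ(2)x²/2 -
ζ(3)x³/3 + O(x⁴).

Finally y₂/y₀ = t²/2 + b₂ and y₃/y₀ = t³/6 + b₂t + b₃ with power series b₂, b₃, so Φ = t³/6 - b₃/2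
and T(q) = b₃/2. The Calabi-Yau condition becomes db₃/dt = -2b₂, which is the relation with K. The
identity theorem along the segment carries T(q) = b₃/2 from 0 to z. -/

theorem thetaSeries_apply (f : ℂ⟦X⟧) : thetaSeries f = PowerSeries.X * PowerSeries.derivative ℂ f :=
  rfl

theorem coeff_thetaSeries (f : ℂ⟦X⟧) (n : ℕ) :
    PowerSeries.coeff n (thetaSeries f) = n * PowerSeries.coeff n f := by
  rw [thetaSeries_apply]
  cases n with
  | zero => simp
  | succ n =>
    rw [PowerSeries.coeff_succ_X_mul, PowerSeries.coeff_derivative]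
    push_cast; ring

theorem coeff_theta (p : LogSeries) (m : ℕ) :
    (theta p).coeff m = thetaSeries (p.coeff m) + (m + 1) * p.coeff (m + 1) := by
  induction p using Polynomial.induction_on' with
  | add p q hp hq => simp only [map_add, Polynomial.coeff_add, hp, hq]; ring
  | monomial n f =>
    rw [theta_monomial, ← thetaSeries_apply]
    simp only [Polynomial.coeff_add, Polynomial.coeff_monomial]
    rcases n with _ | n
    · simp
      split_ifs <;> simp
    · have : (m = n) ↔ (n = m) := eq_comm
      by_cases h : n = m
      · subst h; simp [mul_comm]
      · by_cases h' : n + 1 = m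
        · subst h'; simp
        · have : ¬ (n + 1 = m + 1) := by omega
          simp [h, h']

theorem theta_C (f : ℂ⟦X⟧) : theta (Polynomial.C f) = Polynomial.C (thetaSeries f) := by
  rw [← Polynomial.monomial_zero_left, theta_monomial]; simp [thetaSeries_apply]

theorem theta_X : theta (Polynomial.X : LogSeries) = 1 := by
  rw [← Polynomial.monomial_one_one_eq_X, theta_monomial]; simp

theorem theta_C_mul (f : ℂ⟦X⟧) (p : LogSeries) :
    theta (Polynomial.C f * p) = Polynomial.C (thetaSeries f) * p + Polynomial.C f * theta p := by
  ext1 m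
  simp only [coeff_theta, Polynomial.coeff_add, Polynomial.coeff_C_mul, Derivation.leibniz, smul_eq_mul]
  ring

theorem theta_X_mul (p : LogSeries) :
    theta (Polynomial.X * p) = p + Polynomial.X * theta p := by
  ext1 m
  rcases m with _ | m
  · simp [coeff_theta]
  · simp only [coeff_theta, Polynomial.coeff_add, Polynomial.coeff_X_mul]
    push_cast; ring

theorem theta_mul (p q : LogSeries) : theta (p * q) = theta p * q + p * theta q := by
  induction p using Polynomial.induction_on with
  | C f => rw [theta_C_mul, theta_C]
  | add p p' hp hq => simp only [add_mul, map_add, hp, hq]; ring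
  | monomial n f ih =>
    have : (Polynomial.C f * Polynomial.X ^ (n + 1) : LogSeries)
      = Polynomial.X * (Polynomial.C f * Polynomial.X ^ n) := by ring
    rw [this, mul_assoc, theta_X_mul, ih, theta_X_mul]; ring

theorem theta_one : theta (1 : LogSeries) = 0 := by
  rw [← Polynomial.C_1, theta_C]; simp

theorem theta_pow_succ (n : ℕ) (p : LogSeries) : theta (p ^ (n + 1)) = (n + 1) * p ^ n * theta p := by
  induction n with
  | zero => simp
  | succ n ih => rw [pow_succ, theta_mul, ih]; push_cast; ring

theorem theta_natCast_mul (n : ℕ) (p : LogSeries) : theta (n * p) = n * theta p := by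
  rw [← nsmul_eq_mul, map_nsmul, nsmul_eq_mul]

/-! ### Uniqueness of formal solutions -/

/-- The coefficient of `zⁿ`, as a polynomial in `log z`. -/
def zCoeff (n : ℕ) (p : LogSeries) : Polynomial ℂ :=
  ∑ m ∈ p.support, Polynomial.monomial m (PowerSeries.coeff n (p.coeff m))

theorem coeff_zCoeff (n : ℕ) (p : LogSeries) (m : ℕ) :
    (zCoeff n p).coeff m = PowerSeries.coeff n (p.coeff m) := by
  simp only [zCoeff, Polynomial.finsetSum_coeff, Polynomial.coeff_monomial,
    Finset.sum_ite_eq', Polynomial.mem_support_iff]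
  split_ifs with h
  · rfl
  · rw [Polynomial.notMem_support_iff.1 h]; simp

theorem ext_zCoeff {p q : LogSeries} (h : ∀ n, zCoeff n p = zCoeff n q) : p = q := by
  ext m n
  rw [← coeff_zCoeff, h, coeff_zCoeff]

theorem zCoeff_zero (n : ℕ) : zCoeff n 0 = 0 := by ext m; simp [coeff_zCoeff]

theorem zCoeff_sub (n : ℕ) (p q : LogSeries) : zCoeff n (p - q) = zCoeff n p - zCoeff n q := by
  ext m; simp [coeff_zCoeff]

theorem zCoeff_sum {ι : Type*} (s : Finset ι) (n : ℕ) (p : ι → LogSeries) :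
    zCoeff n (∑ i ∈ s, p i) = ∑ i ∈ s, zCoeff n (p i) := by
  ext m; simp [coeff_zCoeff, Polynomial.finsetSum_coeff]

/-- On a fixed power zⁿ, θ is n + d/dL acting on polynomials in L = log z. It is injective for n ≠ 0
and is plain differentiation for n = 0; uniqueness of formal solutions rests on this dichotomy. -/
theorem zCoeff_theta (n : ℕ) (p : LogSeries) :
    zCoeff n (theta p) = n * zCoeff n p + Polynomial.derivative (zCoeff n p) := by
  ext m
  rw [coeff_zCoeff, coeff_theta, Polynomial.coeff_add, Polynomial.coeff_derivative, coeff_zCoeff,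
    ← Polynomial.C_eq_natCast, Polynomial.coeff_C_mul, coeff_zCoeff, map_add, coeff_thetaSeries]
  have : ((m : ℂ⟦X⟧) + 1) = PowerSeries.C (m + 1 : ℂ) := by simp
  rw [this, PowerSeries.coeff_C_mul]; ring

theorem zCoeff_C_mul (n : ℕ) (f : ℂ⟦X⟧) (p : LogSeries) :
    zCoeff n (Polynomial.C f * p) =
      ∑ k ∈ Finset.HasAntidiagonal.antidiagonal n, Polynomial.C (PowerSeries.coeff k.1 f) * zCoeff k.2 p := by
  ext m
  simp [coeff_zCoeff, PowerSeries.coeff_mul, Polynomial.finsetSum_coeff, Polynomial.coeff_C_mul]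

/-- `zCoeff n` of `θᵐ p` depends linearly on `zCoeff n p`. -/
theorem zCoeff_theta_pow_eq_zero {n : ℕ} {p : LogSeries} (h : zCoeff n p = 0) (m : ℕ) :
    zCoeff n ((theta ^ m) p) = 0 := by
  induction m with
  | zero => simpa using h
  | succ m ih => rw [pow_succ', Module.End.mul_apply, zCoeff_theta, ih]; simp

/-- Differentiation lowers the degree, so it cannot cancel the leading term of n p. -/
theorem natCast_mul_add_derivative_injective {n : ℕ} (hn : n ≠ 0) {p : Polynomial ℂ}
    (h : n * p + Polynomial.derivative p = 0) : p = 0 := by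
  by_contra hp
  have h1 : (Polynomial.derivative p).degree < p.degree := Polynomial.degree_derivative_lt hp
  have h2 : (n * p : Polynomial ℂ).degree = p.degree := by
    rw [← Polynomial.C_eq_natCast, Polynomial.degree_C_mul (by exact_mod_cast hn)]
  have h3 : (n * p : Polynomial ℂ) = -Polynomial.derivative p := eq_neg_of_add_eq_zero_left h
  rw [h3, Polynomial.degree_neg] at h2
  exact h1.ne h2

theorem zCoeff_eq_zero_of_theta_pow {n : ℕ} (hn : n ≠ 0) {p : LogSeries} (m : ℕ)
    (h : zCoeff n ((theta ^ m) p) = 0) : zCoeff n p = 0 := by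
  induction m with
  | zero => simpa using h
  | succ m ih =>
    rw [pow_succ', Module.End.mul_apply, zCoeff_theta] at h
    exact ih (natCast_mul_add_derivative_injective hn h)

/-- A solution of `θᴺ p = ∑ cₘ θᵐ p`, with `cₘ(0) = 0`, is determined by its coefficient of `z⁰`. -/
theorem eq_zero_of_theta_pow_eq {N : ℕ} {c : Fin N → ℂ⟦X⟧}
    (hc : ∀ m, PowerSeries.constantCoeff (c m) = 0) {p : LogSeries}
    (hp : (theta ^ N) p = ∑ m : Fin N, Polynomial.C (c m) * (theta ^ (m : ℕ)) p)
    (h0 : zCoeff 0 p = 0) : p = 0 := by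
  refine ext_zCoeff fun n => ?_
  rw [zCoeff_zero]
  induction n using Nat.strong_induction_on with
  | _ n ih =>
    rcases eq_or_ne n 0 with rfl | hn
    · exact h0
    refine zCoeff_eq_zero_of_theta_pow hn N ?_
    rw [hp, zCoeff_sum]
    refine Finset.sum_eq_zero fun m _ => ?_
    rw [zCoeff_C_mul]
    refine Finset.sum_eq_zero fun k hk => ?_
    have hk' := Finset.HasAntidiagonal.mem_antidiagonal.1 hk
    -- The term that would involve the coefficient of zⁿ itself carries cₘ(0) = 0; every other term
    -- involves a lower power of z.
    rcases Nat.eq_zero_or_pos k.1 with h | h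
    · rw [h, PowerSeries.coeff_zero_eq_constantCoeff_apply, hc]; simp
    · rw [zCoeff_theta_pow_eq_zero (ih k.2 (by omega)), mul_zero]

/-! ### Frobenius solutions -/

/-- The coefficient of `xⁱ` in `∑ₙ gₙ(x) zⁿ⁺ˣ`. -/
def frob (g : ℕ → ℂ⟦X⟧) (i : ℕ) : LogSeries :=
  ∑ m ∈ Finset.range (i + 1), Polynomial.monomial m
    (PowerSeries.mk fun n => PowerSeries.coeff (i - m) (g n) / (m.factorial : ℂ))

theorem coeff_coeff_frob (g : ℕ → ℂ⟦X⟧) (i m n : ℕ) :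
    PowerSeries.coeff n ((frob g i).coeff m) =
      if m ≤ i then PowerSeries.coeff (i - m) (g n) / (m.factorial : ℂ) else 0 := by
  simp only [frob, Polynomial.finsetSum_coeff, Polynomial.coeff_monomial, Finset.sum_ite_eq',
    Finset.mem_range, Nat.lt_succ_iff]
  split_ifs <;> simp

/-- Since θ z^{n+x} = (n+x) z^{n+x}, differentiating a Frobenius family multiplies its n-th
coefficient by n + x. The power series variable inside `g n` is the exponent x, not z. -/
theorem theta_frob (g : ℕ → ℂ⟦X⟧) (i : ℕ) :
    theta (frob g i) = frob (fun n => ((n : ℂ⟦X⟧) + PowerSeries.X) * g n) i := by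
  ext m n
  have hc : ((m : ℂ⟦X⟧) + 1) = PowerSeries.C (m + 1 : ℂ) := by simp
  have hn : (n : ℂ⟦X⟧) = PowerSeries.C (n : ℂ) := by simp
  rw [coeff_theta, map_add, coeff_thetaSeries, hc, PowerSeries.coeff_C_mul]
  simp only [coeff_coeff_frob]
  rcases lt_trichotomy m i with h | rfl | h
  · obtain ⟨d, rfl⟩ := Nat.exists_eq_add_of_lt h
    have h1 : m + d + 1 - m = d + 1 := by omega
    have h2 : m + d + 1 - (m + 1) = d := by omega
    rw [if_pos (by omega), if_pos (by omega), if_pos (by omega), h1, h2, add_mul (n : ℂ⟦X⟧), map_add, hn,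
      PowerSeries.coeff_C_mul, PowerSeries.coeff_succ_X_mul, Nat.factorial_succ]
    have : ((m : ℂ) + 1) ≠ 0 := by exact_mod_cast Nat.succ_ne_zero m
    have : (m.factorial : ℂ) ≠ 0 := by exact_mod_cast m.factorial_ne_zero
    push_cast
    field_simp
  · simp [add_mul]
    ring
  · rw [if_neg (by omega), if_neg (by omega), if_neg (by omega)]; ring

theorem frob_add (g g' : ℕ → ℂ⟦X⟧) (i : ℕ) :
    frob (fun n => g n + g' n) i = frob g i + frob g' i := by
  ext m n
  simp only [Polynomial.coeff_add, map_add, coeff_coeff_frob]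
  split_ifs <;> ring

theorem frob_sum {ι : Type*} (s : Finset ι) (g : ι → ℕ → ℂ⟦X⟧) (i : ℕ) :
    frob (fun n => ∑ k ∈ s, g k n) i = ∑ k ∈ s, frob (g k) i := by
  ext m n
  simp only [Polynomial.finsetSum_coeff, map_sum, coeff_coeff_frob, Finset.sum_div]
  split_ifs <;> simp

theorem frob_smul (a : ℂ) (g : ℕ → ℂ⟦X⟧) (i : ℕ) :
    frob (fun n => a • g n) i = a • frob g i := by
  ext m n
  simp only [Polynomial.coeff_smul, map_smul, coeff_coeff_frob, smul_eq_mul]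
  split_ifs <;> ring

theorem C_mul_frob (f : ℂ⟦X⟧) (g : ℕ → ℂ⟦X⟧) (i : ℕ) :
    Polynomial.C f * frob g i =
      frob (fun n => ∑ k ∈ Finset.HasAntidiagonal.antidiagonal n, PowerSeries.coeff k.1 f • g k.2) i := by
  ext m n
  rw [Polynomial.coeff_C_mul, PowerSeries.coeff_mul]
  simp only [coeff_coeff_frob, map_sum, map_smul, smul_eq_mul]
  split_ifs
  · rw [Finset.sum_div]; refine Finset.sum_congr rfl fun k _ => by ring
  · simp

theorem theta_pow_frob (g : ℕ → ℂ⟦X⟧) (i m : ℕ) :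
    (theta ^ m) (frob g i) = frob (fun n => ((n : ℂ⟦X⟧) + PowerSeries.X) ^ m * g n) i := by
  induction m with
  | zero => simp
  | succ m ih =>
    rw [pow_succ', Module.End.mul_apply, ih, theta_frob]
    congr 1; ext1 n; ring

theorem frob_eq_of_coeff_eq {g g' : ℕ → ℂ⟦X⟧} {i : ℕ}
    (h : ∀ n, ∀ k ≤ i, PowerSeries.coeff k (g n) = PowerSeries.coeff k (g' n)) :
    frob g i = frob g' i := by
  ext m n
  simp only [coeff_coeff_frob]
  split_ifs
  · rw [h n _ (by omega)]
  · rfl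

theorem zCoeff_frob (g : ℕ → ℂ⟦X⟧) (i n : ℕ) (hg : g n = 1) :
    zCoeff n (frob g i) = Polynomial.monomial i (1 / (i.factorial : ℂ)) := by
  ext m
  rw [coeff_zCoeff, coeff_coeff_frob, hg, PowerSeries.coeff_one, Polynomial.coeff_monomial]
  rcases lt_trichotomy m i with h | rfl | h
  · rw [if_pos (by omega), if_neg (by omega), if_neg (by omega)]; simp
  · simp
  · rw [if_neg (by omega), if_neg (by omega)]

/-- The coefficients of the Frobenius solution of `θᴺ p = ∑ cₘ θᵐ p`. -/
def frobCoeff {N : ℕ} (c : Fin N → ℂ⟦X⟧) : ℕ → ℂ⟦X⟧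
  | 0 => 1
  | n + 1 => (((n + 1 : ℕ) : ℂ⟦X⟧) + PowerSeries.X)⁻¹ ^ N *
      ∑ m : Fin N, ∑ k : Fin (n + 1), PowerSeries.coeff (n + 1 - k) (c m) •
        ((((k : ℕ) : ℂ⟦X⟧) + PowerSeries.X) ^ (m : ℕ) * frobCoeff c k)

/-- The recursion makes ∑ gₙ(x) z^{n+x} satisfy the equation up to the single term x^N z^x, which
does not affect the coefficients of xⁱ with i < N. -/
theorem theta_pow_frob_frobCoeff {N : ℕ} {c : Fin N → ℂ⟦X⟧}
    (hc : ∀ m, PowerSeries.constantCoeff (c m) = 0) {i : ℕ} (hi : i < N) :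
    (theta ^ N) (frob (frobCoeff c) i) =
      ∑ m : Fin N, Polynomial.C (c m) * (theta ^ (m : ℕ)) (frob (frobCoeff c) i) := by
  simp only [theta_pow_frob, C_mul_frob]
  rw [← frob_sum]
  refine frob_eq_of_coeff_eq fun n k hk => ?_
  rcases n with _ | n
  · simp only [Nat.cast_zero, zero_add, frobCoeff, mul_one, Finset.HasAntidiagonal.antidiagonal_zero,
      Finset.sum_singleton, PowerSeries.coeff_zero_eq_constantCoeff_apply, hc, zero_smul,
      Finset.sum_const_zero, map_zero, PowerSeries.coeff_X_pow]
    rw [if_neg (by omega)]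
  · congr 1
    rw [frobCoeff, ← mul_assoc, ← mul_pow, PowerSeries.mul_inv_cancel, one_pow, one_mul]
    · refine Finset.sum_congr rfl fun m _ => ?_
      -- The recursion omits the index n + 1 of the antidiagonal; the coefficient there is cₘ(0) =
      -- 0.
      rw [← Finset.sum_range (fun k => PowerSeries.coeff (n + 1 - k) (c m) •
        ((((k : ℕ) : ℂ⟦X⟧) + PowerSeries.X) ^ (m : ℕ) * frobCoeff c k)),
        ← Finset.Nat.sum_antidiagonal_swap,
        Finset.Nat.sum_antidiagonal_eq_sum_range_succ_mk, Finset.sum_range_succ _ (n + 1)]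
      simp [hc]
    · simp; exact_mod_cast Nat.succ_ne_zero n

/-! ### The fifth-order equation and its pullback -/

theorem theta_ofNat (n : ℕ) [n.AtLeastTwo] : theta (OfNat.ofNat n : LogSeries) = 0 := by
  have := theta_natCast_mul n 1
  rw [mul_one, theta_one, mul_zero] at this
  exact_mod_cast this

theorem thetaSeries_C (a : ℂ) : thetaSeries (PowerSeries.C a) = 0 := by
  simp [thetaSeries_apply]

theorem smul_eq_C_C_mul (a : ℂ) (w : LogSeries) :
    a • w = Polynomial.C (PowerSeries.C a) * w := by
  ext m n; simp

namespace HypergeometricCase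

/-- The power series `ρ z / (16 (1 - ρ z))`. -/
def geom (r : HypergeometricCase) : ℂ⟦X⟧ :=
  PowerSeries.C (1 / 16 : ℂ) * ((1 - (r.ρ : ℂ⟦X⟧) * PowerSeries.X)⁻¹ - 1)

/-- `s₁ (1 - s₁) + s₂ (1 - s₂)`. -/
def expSum (r : HypergeometricCase) : ℂ := r.s₁ * (1 - r.s₁) + r.s₂ * (1 - r.s₂)

/-- `s₁ (1 - s₁) s₂ (1 - s₂)`. -/
def expProd (r : HypergeometricCase) : ℂ := r.s₁ * (1 - r.s₁) * (r.s₂ * (1 - r.s₂))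

theorem one_sub_mul_geom (r : HypergeometricCase) :
    (1 - (r.ρ : ℂ⟦X⟧) * PowerSeries.X) * (16 * r.geom) = (r.ρ : ℂ⟦X⟧) * PowerSeries.X := by
  have h16 : (16 : ℂ⟦X⟧) * PowerSeries.C (1 / 16 : ℂ) = 1 := by
    have : (16 : ℂ⟦X⟧) = PowerSeries.C (16 : ℂ) := (map_ofNat _ 16).symm
    rw [this, ← map_mul]; norm_num
  have hinv : (1 - (r.ρ : ℂ⟦X⟧) * PowerSeries.X) * (1 - (r.ρ : ℂ⟦X⟧) * PowerSeries.X)⁻¹ = 1 :=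
    PowerSeries.mul_inv_cancel _ (by simp)
  rw [geom, ← mul_assoc 16, h16, one_mul, mul_sub, hinv]; ring

theorem one_sub_ne_zero (r : HypergeometricCase) : (1 - (r.ρ : ℂ⟦X⟧) * PowerSeries.X) ≠ 0 := by
  intro h
  have := congrArg PowerSeries.constantCoeff h
  simp at this

theorem constantCoeff_geom (r : HypergeometricCase) : PowerSeries.constantCoeff r.geom = 0 := by
  simp [geom]

/-- This Riccati equation keeps polynomials in D stable under θ, so the order-five identity becomes
a polynomial identity. The factor 1/16 in D makes the coefficients of the pullback integral in D, S,
P. -/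
theorem thetaSeries_geom (r : HypergeometricCase) :
    thetaSeries r.geom = 16 * r.geom * r.geom + r.geom := by
  have h := r.one_sub_mul_geom
  have hn : ∀ n : ℕ, thetaSeries (n : ℂ⟦X⟧) = 0 := fun n => by
    simp
  have h16 : thetaSeries (16 : ℂ⟦X⟧) = 0 := by exact_mod_cast hn 16
  have hX : thetaSeries (PowerSeries.X : ℂ⟦X⟧) = PowerSeries.X := by simp [thetaSeries_apply]
  have h1 := congrArg thetaSeries h
  simp only [Derivation.leibniz, map_sub, hn, h16, hX, Derivation.map_one_eq_zero, smul_eq_mul] at h1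
  have h16' : (16 : ℂ⟦X⟧) ≠ 0 := fun h => by
    have := congrArg PowerSeries.constantCoeff h
    rw [map_ofNat, map_zero] at this
    norm_num at this
  refine mul_left_cancel₀ r.one_sub_ne_zero (mul_left_cancel₀ h16' ?_)
  linear_combination h1 - (1 + 16 * r.geom) * h

/-- The coefficients of the fifth-order equation in monic form. -/
def fifthCoeff (r : HypergeometricCase) : Fin 5 → ℂ⟦X⟧ :=
  ![8 * PowerSeries.C r.expProd * r.geom,
    8 * (2 * PowerSeries.C r.expProd + PowerSeries.C r.expSum) * r.geom,
    8 * (1 + 3 * PowerSeries.C r.expSum) * r.geom,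
    16 * (2 + PowerSeries.C r.expSum) * r.geom,
    40 * r.geom]

/-- The coefficients of the pullback. -/
def pullbackCoeff (r : HypergeometricCase) : Fin 4 → ℂ⟦X⟧ :=
  let D := r.geom
  let S := PowerSeries.C r.expSum
  let P := PowerSeries.C r.expProd
  ![4 * (S - 1 - P) * D + 16 * (8 * S - 19 - S * S) * D * D + 128 * (9 * S - 54) * D * D * D
      - 48384 * D * D * D * D,
    8 * (S - 1) * D + 64 * (S - 4) * D * D - 2304 * D * D * D,
    8 * S * D - 32 * D * D,
    16 * D]

theorem constantCoeff_fifthCoeff (r : HypergeometricCase) (m : Fin 5) :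
    PowerSeries.constantCoeff (r.fifthCoeff m) = 0 := by
  fin_cases m <;> simp [fifthCoeff, constantCoeff_geom]

theorem constantCoeff_pullbackCoeff (r : HypergeometricCase) (m : Fin 4) :
    PowerSeries.constantCoeff (r.pullbackCoeff m) = 0 := by
  fin_cases m <;> simp [pullbackCoeff, constantCoeff_geom]

theorem fifthOrder_eq (r : HypergeometricCase) (w : LogSeries) :
    r.fifthOrder w = Polynomial.C (1 - (r.ρ : ℂ⟦X⟧) * PowerSeries.X) *
      ((theta ^ 5) w - ∑ m : Fin 5, Polynomial.C (r.fifthCoeff m) * (theta ^ (m : ℕ)) w) := by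
  have h := congrArg (Polynomial.C (R := ℂ⟦X⟧)) r.one_sub_mul_geom
  simp only [fifthOrder, Fin.sum_univ_five, fifthCoeff, pow_succ, pow_zero, one_mul,
    Module.End.mul_apply, LinearMap.add_apply, LinearMap.smul_apply, map_add, map_smul,
    Module.End.one_apply]
  simp only [smul_eq_C_C_mul]
  simp only [expSum, expProd, Matrix.cons_val, map_mul, map_sub, map_one, map_ofNat, map_add] at h ⊢
  simp only [Fin.val_zero, Fin.val_one, Fin.val_two, pow_zero, Module.End.one_apply,
    show ((3 : Fin 5) : ℕ) = 3 from rfl, show ((4 : Fin 5) : ℕ) = 4 from rfl, pow_succ,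
    Module.End.mul_apply, one_mul]
  have h2 : (2 : LogSeries) * Polynomial.C (PowerSeries.C (1 / 2 : ℂ)) = 1 := by
    have : (2 : LogSeries) = Polynomial.C (PowerSeries.C (2 : ℂ)) := by
      rw [map_ofNat, map_ofNat]
    rw [this, ← Polynomial.C_mul, ← map_mul]; norm_num
  have h20 : (2 : LogSeries) ≠ 0 := fun h => zero_ne_one (α := LogSeries) (by rw [← h2, h, zero_mul])
  -- Doubling removes the exponent 1/2; after that w and its θ-derivatives are treated as
  -- independent variables.
  refine mul_left_cancel₀ h20 ?_
  generalize theta w = w1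
  generalize theta w1 = w2
  generalize theta w2 = w3
  generalize theta w3 = w4
  generalize theta w4 = w5
  generalize Polynomial.C (PowerSeries.C (1 / 2 : ℂ)) = k at *
  generalize Polynomial.C (PowerSeries.C (r.s₁ : ℂ)) = s at *
  generalize Polynomial.C (PowerSeries.C (r.s₂ : ℂ)) = t at *
  generalize Polynomial.C r.geom = D at *
  generalize Polynomial.C (r.ρ : ℂ⟦X⟧) = ρ at *
  generalize Polynomial.C (PowerSeries.X : ℂ⟦X⟧) = z at *
  have h5 : 2 * k * (ρ * z) = ρ * z := by rw [h2, one_mul]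
  linear_combination (5 * w4 + (4 + 2 * (s * (1 - s) + t * (1 - t))) * w3
    + (1 + 3 * (s * (1 - s) + t * (1 - t))) * w2
    + (2 * (s * (1 - s) * (t * (1 - t))) + (s * (1 - s) + t * (1 - t))) * w1
    + s * (1 - s) * (t * (1 - t)) * w) * h
    - ρ * z * (w4 + 2 * w3 + (1 + s * (1 - s) + t * (1 - t)) * w2
    + (s * (1 - s) + t * (1 - t)) * w1 + s * (1 - s) * (t * (1 - t)) * w) * h2

theorem fifthOrder_eq_zero_iff (r : HypergeometricCase) (w : LogSeries) :
    r.fifthOrder w = 0 ↔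
      (theta ^ 5) w = ∑ m : Fin 5, Polynomial.C (r.fifthCoeff m) * (theta ^ (m : ℕ)) w := by
  rw [fifthOrder_eq, mul_eq_zero, sub_eq_zero, Polynomial.C_eq_zero]
  simp [r.one_sub_ne_zero]

theorem fifthOrder_smul (r : HypergeometricCase) (a : ℂ) (w : LogSeries) :
    r.fifthOrder (a • w) = a • r.fifthOrder w := by
  simp only [fifthOrder, map_smul, smul_sub, mul_smul_comm]

theorem fifthOrder_sub (r : HypergeometricCase) (w w' : LogSeries) :
    r.fifthOrder (w - w') = r.fifthOrder w - r.fifthOrder w' := by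
  simp only [fifthOrder, map_sub]; ring

theorem eq_of_fifthOrder_eq_zero (r : HypergeometricCase) {w w' : LogSeries}
    (h : r.fifthOrder w = 0) (h' : r.fifthOrder w' = 0) (h0 : zCoeff 0 w = zCoeff 0 w') :
    w = w' := by
  rw [← sub_eq_zero]
  refine eq_zero_of_theta_pow_eq r.constantCoeff_fifthCoeff
    ((r.fifthOrder_eq_zero_iff _).1 (by rw [fifthOrder_sub, h, h', sub_zero])) ?_
  rw [zCoeff_sub, h0, sub_self]

end HypergeometricCase

/-- The fifth-order equation satisfied by the Wronskians. -/
theorem theta_pow_five_of_wronskians {D S P u₀₁ u₀₂ u₀₃ u₁₂ u₁₃ u₂₃ c₀ c₁ c₂ c₃ : LogSeries}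
    (hD : theta D = 16 * D * D + D) (hS : theta S = 0) (hP : theta P = 0)
    (hc₀ : c₀ = 4 * (S - 1 - P) * D + 16 * (8 * S - 19 - S * S) * D * D
      + 128 * (9 * S - 54) * D * D * D - 48384 * D * D * D * D)
    (hc₁ : c₁ = 8 * (S - 1) * D + 64 * (S - 4) * D * D - 2304 * D * D * D)
    (hc₂ : c₂ = 8 * S * D - 32 * D * D) (hc₃ : c₃ = 16 * D)
    (h₀₁ : theta u₀₁ = u₀₂) (h₀₂ : theta u₀₂ = u₀₃ + u₁₂)
    (h₀₃ : theta u₀₃ = u₁₃ + c₃ * u₀₃ + c₂ * u₀₂ + c₁ * u₀₁) (h₁₂ : theta u₁₂ = u₁₃)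
    (h₁₃ : theta u₁₃ = u₂₃ + c₃ * u₁₃ + c₂ * u₁₂ - c₀ * u₀₁)
    (h₂₃ : theta u₂₃ = c₃ * u₂₃ - c₁ * u₁₂ - c₀ * u₀₂) :
    theta (theta (theta (theta (theta u₀₁)))) =
      8 * P * D * u₀₁ + 8 * (2 * P + S) * D * theta u₀₁ +
      8 * (1 + 3 * S) * D * theta (theta u₀₁) + 16 * (2 + S) * D * theta (theta (theta u₀₁)) +
      40 * D * theta (theta (theta (theta u₀₁))) := by
  -- The hypotheses on the u's form a closed first-order system for the six minors, so both sides
  -- become combinations of minors with coefficients polynomial in D, S, P, and these agree. For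
  -- instance, u₂₃ occurs with coefficient 5c₃ on the left and 80D on the right, whence c₃ = 16D.
  subst hc₀ hc₁ hc₂ hc₃
  simp only [h₀₁, h₀₂, h₀₃, h₁₂, h₁₃, h₂₃, hD, hS, hP, theta_mul, theta_one, map_add,
    theta_ofNat 4, theta_ofNat 8, theta_ofNat 9, theta_ofNat 16, theta_ofNat 19, theta_ofNat 32, theta_ofNat 54, theta_ofNat 64, theta_ofNat 128, theta_ofNat 2304, theta_ofNat 48384, map_zero,
    map_sub]
  ring

theorem theta_pow_four (f : LogSeries) : (theta ^ 4) f = theta (theta (theta (theta f))) := rfl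

theorem HypergeometricCase.fifthOrder_wronskianZ (r : HypergeometricCase) {f g : LogSeries}
    (hf : (theta ^ 4) f = ∑ m : Fin 4, Polynomial.C (r.pullbackCoeff m) * (theta ^ (m : ℕ)) f)
    (hg : (theta ^ 4) g = ∑ m : Fin 4, Polynomial.C (r.pullbackCoeff m) * (theta ^ (m : ℕ)) g) :
    r.fifthOrder (wronskianZ f g) = 0 := by
  rw [fifthOrder_eq_zero_iff]
  have hD : theta (Polynomial.C r.geom) =
      16 * Polynomial.C r.geom * Polynomial.C r.geom + Polynomial.C r.geom := by
    rw [theta_C, r.thetaSeries_geom]; simp only [map_add, map_mul, map_ofNat]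
  have hk : ∀ a : ℂ, theta (Polynomial.C (PowerSeries.C a)) = 0 := fun a => by
    rw [theta_C, thetaSeries_C, map_zero]
  have key : ∀ f : LogSeries,
      ∑ m : Fin 4, Polynomial.C (r.pullbackCoeff m) * (theta ^ (m : ℕ)) f =
      Polynomial.C (r.pullbackCoeff 0) * f + Polynomial.C (r.pullbackCoeff 1) * theta f +
      Polynomial.C (r.pullbackCoeff 2) * theta (theta f) +
      Polynomial.C (r.pullbackCoeff 3) * theta (theta (theta f)) := fun f => by
    rw [Fin.sum_univ_four]; rfl
  rw [key, theta_pow_four] at hf hg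
  have := theta_pow_five_of_wronskians (u₀₁ := wronskianZ f g)
    (u₀₂ := f * theta (theta g) - theta (theta f) * g)
    (u₀₃ := f * theta (theta (theta g)) - theta (theta (theta f)) * g)
    (u₁₂ := theta f * theta (theta g) - theta (theta f) * theta g)
    (u₁₃ := theta f * theta (theta (theta g)) - theta (theta (theta f)) * theta g)
    (u₂₃ := theta (theta f) * theta (theta (theta g)) - theta (theta (theta f)) * theta (theta g))
    (c₀ := Polynomial.C (r.pullbackCoeff 0)) (c₁ := Polynomial.C (r.pullbackCoeff 1))
    (c₂ := Polynomial.C (r.pullbackCoeff 2)) (c₃ := Polynomial.C (r.pullbackCoeff 3))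
    hD (hk r.expSum) (hk r.expProd)
    (by simp only [pullbackCoeff, Matrix.cons_val, map_mul, map_sub, map_add, map_ofNat, map_one])
    (by simp only [pullbackCoeff, Matrix.cons_val, map_mul, map_sub, map_add, map_ofNat, map_one])
    (by simp only [pullbackCoeff, Matrix.cons_val, map_mul, map_sub, map_ofNat])
    (by simp only [pullbackCoeff, Matrix.cons_val, map_mul, map_ofNat])
    (by simp only [wronskianZ, map_sub, theta_mul]; ring)
    (by simp only [map_sub, theta_mul]; ring)
    (by simp only [wronskianZ, map_sub, theta_mul, hf, hg]; ring)
    (by simp only [map_sub, theta_mul]; ring)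
    (by simp only [wronskianZ, map_sub, theta_mul, hf, hg]; ring)
    (by simp only [map_sub, theta_mul, hf, hg]; ring)
  rw [Fin.sum_univ_five]
  simp only [fifthCoeff, Matrix.cons_val, map_mul, map_add, map_ofNat, map_one]
  exact this

/-! ### Uniqueness and existence of the pullback -/

theorem zCoeff_zero_eq_map (p : LogSeries) : zCoeff 0 p = p.map PowerSeries.constantCoeff := by
  ext m; simp [coeff_zCoeff]

theorem zCoeff_zero_mul (p q : LogSeries) : zCoeff 0 (p * q) = zCoeff 0 p * zCoeff 0 q := by
  simp [zCoeff_zero_eq_map]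

theorem zCoeff_smul (n : ℕ) (a : ℂ) (p : LogSeries) : zCoeff n (a • p) = a • zCoeff n p := by
  ext m; simp [coeff_zCoeff]

theorem zCoeff_zero_theta (p : LogSeries) :
    zCoeff 0 (theta p) = Polynomial.derivative (zCoeff 0 p) := by
  simp [zCoeff_theta]

theorem zCoeff_zero_wronskianZ (f g : LogSeries) :
    zCoeff 0 (wronskianZ f g) = zCoeff 0 f * Polynomial.derivative (zCoeff 0 g)
      - Polynomial.derivative (zCoeff 0 f) * zCoeff 0 g := by
  simp only [wronskianZ, zCoeff_sub, zCoeff_zero_mul, zCoeff_zero_theta]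

namespace FrobeniusBasis

variable (Y : FrobeniusBasis)

theorem y_zero : Y.y 0 = Polynomial.C Y.f₀ := rfl

theorem y_one : Y.y 1 = Polynomial.C Y.f₀ * Polynomial.X + Polynomial.C Y.α₁ := rfl

theorem y_two : Y.y 2 = (1 / 2 : ℂ) • (Polynomial.C Y.f₀ * Polynomial.X ^ 2) +
    Polynomial.C Y.α₁ * Polynomial.X + Polynomial.C Y.α₂ := rfl

theorem y_three : Y.y 3 = (1 / 6 : ℂ) • (Polynomial.C Y.f₀ * Polynomial.X ^ 3) +
    (1 / 2 : ℂ) • (Polynomial.C Y.α₁ * Polynomial.X ^ 2) +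
    Polynomial.C Y.α₂ * Polynomial.X + Polynomial.C Y.α₃ := rfl

theorem zCoeff_zero_y (i : Fin 4) :
    zCoeff 0 (Y.y i) = (1 / ((i : ℕ).factorial : ℂ)) • Polynomial.X ^ (i : ℕ) := by
  simp only [zCoeff_zero_eq_map]
  have hs : ∀ (a : ℂ) (p : LogSeries), (a • p).map PowerSeries.constantCoeff
      = a • p.map PowerSeries.constantCoeff := fun a p => by ext m; simp
  fin_cases i <;> simp [y, hs, f₀_zero, α₁_zero, α₂_zero, α₃_zero, Nat.factorial]

theorem f₀_ne_zero : Y.f₀ ≠ 0 := fun h => by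
  have := Y.f₀_zero
  simp [h] at this

theorem y_zero_ne_zero : Y.y 0 ≠ 0 := by
  rw [y_zero, Ne, Polynomial.C_eq_zero]; exact Y.f₀_ne_zero

/-- The right-hand side does not depend on the basis. By uniqueness of formal solutions, it
therefore singles out each Wronskian among the solutions of the fifth-order equation. -/
theorem zCoeff_zero_wronskianZ_y (i j : Fin 4) :
    zCoeff 0 (wronskianZ (Y.y i) (Y.y j)) =
      Polynomial.C (1 / ((i : ℕ).factorial : ℂ) * (1 / ((j : ℕ).factorial : ℂ))) *
        (Polynomial.C ((j : ℕ) : ℂ) * Polynomial.X ^ ((i : ℕ) + ((j : ℕ) - 1))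
          - Polynomial.C ((i : ℕ) : ℂ) * Polynomial.X ^ ((i : ℕ) - 1 + (j : ℕ))) := by
  rw [zCoeff_zero_wronskianZ, zCoeff_zero_y, zCoeff_zero_y]
  simp only [Polynomial.smul_eq_C_mul, Polynomial.derivative_C_mul, Polynomial.derivative_X_pow,
    map_mul, pow_add]
  ring

theorem zCoeff_zero_wronskianZ_zero_one : zCoeff 0 (wronskianZ (Y.y 0) (Y.y 1)) = 1 := by
  simp [zCoeff_zero_wronskianZ_y]

theorem zCoeff_zero_wronskianZ_zero_two :
    zCoeff 0 (wronskianZ (Y.y 0) (Y.y 2)) = Polynomial.X := by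
  rw [zCoeff_zero_wronskianZ_y]
  simp only [Fin.val_zero, Fin.val_two, Nat.cast_zero, map_zero, zero_mul, sub_zero, zero_add,
    Nat.factorial, ← mul_assoc, ← map_mul]
  norm_num

theorem zCoeff_zero_wronskianZ_zero_three :
    zCoeff 0 (wronskianZ (Y.y 0) (Y.y 3)) = Polynomial.C (1 / 2 : ℂ) * Polynomial.X ^ 2 := by
  rw [zCoeff_zero_wronskianZ_y]
  simp only [Fin.val_zero, show ((3 : Fin 4) : ℕ) = 3 from rfl, Nat.cast_zero, map_zero, zero_mul,
    sub_zero, zero_add, Nat.factorial, ← mul_assoc, ← map_mul]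
  norm_num

theorem zCoeff_zero_wronskianZ_one_two :
    zCoeff 0 (wronskianZ (Y.y 1) (Y.y 2)) = Polynomial.C (1 / 2 : ℂ) * Polynomial.X ^ 2 := by
  rw [zCoeff_zero_wronskianZ_y]
  simp only [Fin.val_one, Fin.val_two, Nat.factorial, ← mul_assoc, ← map_mul, ← sub_mul, ← map_sub]
  norm_num [← sub_mul, ← map_sub, ← mul_assoc, ← map_mul]

theorem zCoeff_zero_wronskianZ_one_three :
    zCoeff 0 (wronskianZ (Y.y 1) (Y.y 3)) = Polynomial.C (1 / 3 : ℂ) * Polynomial.X ^ 3 := by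
  rw [zCoeff_zero_wronskianZ_y]
  simp only [Fin.val_one, show ((3 : Fin 4) : ℕ) = 3 from rfl, Nat.factorial, ← mul_assoc,
    ← map_mul, ← sub_mul, ← map_sub]
  norm_num [← sub_mul, ← map_sub, ← mul_assoc, ← map_mul]

theorem ext_of_y {Y Y' : FrobeniusBasis} (h : ∀ i, Y.y i = Y'.y i) : Y = Y' := by
  have h0 : Y.f₀ = Y'.f₀ := Polynomial.C_injective (h 0)
  have h1 : Y.α₁ = Y'.α₁ := by
    have := h 1
    rw [y_one, y_one, h0] at this
    exact Polynomial.C_injective (add_left_cancel this)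
  have h2 : Y.α₂ = Y'.α₂ := by
    have := h 2
    rw [y_two, y_two, h0, h1] at this
    exact Polynomial.C_injective (add_left_cancel this)
  have h3 : Y.α₃ = Y'.α₃ := by
    have := h 3
    rw [y_three, y_three, h0, h1, h2] at this
    exact Polynomial.C_injective (add_left_cancel this)
  cases Y; cases Y'; simp_all

/-- A Frobenius basis is determined by its Wronskians. -/
theorem eq_of_wronskianZ_eq {Y Y' : FrobeniusBasis}
    (h₀₁ : wronskianZ (Y.y 0) (Y.y 1) = wronskianZ (Y'.y 0) (Y'.y 1))
    (h₀₂ : wronskianZ (Y.y 0) (Y.y 2) = wronskianZ (Y'.y 0) (Y'.y 2))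
    (h₀₃ : wronskianZ (Y.y 0) (Y.y 3) = wronskianZ (Y'.y 0) (Y'.y 3))
    (h₁₂ : wronskianZ (Y.y 1) (Y.y 2) = wronskianZ (Y'.y 1) (Y'.y 2))
    (h₁₃ : wronskianZ (Y.y 1) (Y.y 3) = wronskianZ (Y'.y 1) (Y'.y 3)) : Y = Y' := by
  -- Both inner Wronskians of Wronskians are multiples of the 3×3 Wronskian of y₀, y₁, y₂, by y₀ and
  -- by y₁. Hence the ratio y₁/y₀ is determined by W₀₁, W₀₂, W₁₂.
  have key : ∀ Z : FrobeniusBasis,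
      Z.y 1 * wronskianZ (wronskianZ (Z.y 0) (Z.y 1)) (wronskianZ (Z.y 0) (Z.y 2)) =
      Z.y 0 * wronskianZ (wronskianZ (Z.y 0) (Z.y 1)) (wronskianZ (Z.y 1) (Z.y 2)) := fun Z => by
    simp only [wronskianZ, map_sub, theta_mul]; ring
  have hN : wronskianZ (wronskianZ (Y.y 0) (Y.y 1)) (wronskianZ (Y.y 0) (Y.y 2)) ≠ 0 := fun h => by
    have := congrArg (zCoeff 0) h
    rw [zCoeff_zero_wronskianZ, zCoeff_zero_wronskianZ_zero_one, zCoeff_zero_wronskianZ_zero_two,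
      zCoeff_zero] at this
    simp at this
  have hw : wronskianZ (Y.y 0) (Y.y 1) ≠ 0 := fun h => by
    have := Y.zCoeff_zero_wronskianZ_zero_one
    rw [h, zCoeff_zero] at this
    simp at this
  have e1 : Y.y 1 * Y'.y 0 = Y'.y 1 * Y.y 0 := by
    have k1 := key Y
    have k2 := key Y'
    rw [← h₀₁, ← h₀₂, ← h₁₂] at k2
    refine mul_right_cancel₀ hN ?_
    linear_combination Y'.y 0 * k1 - Y.y 0 * k2
  have e2 := congrArg theta e1
  rw [theta_mul, theta_mul] at e2
  -- From θ(y₁/y₀) = W₀₁/y₀² one recovers y₀²; the constant term 1 then fixes the sign of y₀.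
  have e3 : Y.y 0 * Y.y 0 = Y'.y 0 * Y'.y 0 := by
    refine mul_right_cancel₀ hw ?_
    have : Y'.y 0 * Y'.y 0 * wronskianZ (Y.y 0) (Y.y 1) =
        Y.y 0 * Y.y 0 * wronskianZ (Y'.y 0) (Y'.y 1) := by
      simp only [wronskianZ]
      linear_combination Y.y 0 * Y'.y 0 * e2 -
        (Y'.y 0 * theta (Y.y 0) + Y.y 0 * theta (Y'.y 0)) * e1
    rw [this, h₀₁]
  have e4 : Y.f₀ = Y'.f₀ := by
    rw [y_zero, y_zero, ← Polynomial.C_mul, ← Polynomial.C_mul] at e3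
    rcases mul_self_eq_mul_self_iff.1 (Polynomial.C_injective e3) with h | h
    · exact h
    · have := congrArg PowerSeries.constantCoeff h
      rw [map_neg, Y.f₀_zero, Y'.f₀_zero] at this
      norm_num at this
  have e5 : Y.y 0 = Y'.y 0 := by rw [y_zero, y_zero, e4]
  have e6 : Y.y 1 = Y'.y 1 := by
    rw [← e5] at e1
    exact mul_right_cancel₀ Y.y_zero_ne_zero e1
  -- With f = y₀ and g = y₁ known, this three-term relation recovers y₂ and y₃ from their Wronskians
  -- with y₀ and y₁.
  have plucker : ∀ f g h : LogSeries,
      h * wronskianZ f g = g * wronskianZ f h - f * wronskianZ g h := fun f g h => by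
    simp only [wronskianZ]; ring
  refine ext_of_y fun i => ?_
  fin_cases i
  · exact e5
  · exact e6
  · refine mul_right_cancel₀ hw ?_
    change Y.y 2 * _ = Y'.y 2 * _
    rw [plucker (Y.y 0) (Y.y 1), h₀₂, h₁₂, e5, e6, plucker (Y'.y 0) (Y'.y 1)]
  · refine mul_right_cancel₀ hw ?_
    change Y.y 3 * _ = Y'.y 3 * _
    rw [plucker (Y.y 0) (Y.y 1), h₀₃, h₁₃, e5, e6, plucker (Y'.y 0) (Y'.y 1)]

end FrobeniusBasis

/-- The Wronskians of both bases solve the same fifth-order equation with the same leading terms, so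
they coincide. The fourth-order coefficients are never compared. -/
theorem IsPullback.unique {r : HypergeometricCase} {c c' : Fin 4 → ℂ⟦X⟧} {Y Y' : FrobeniusBasis}
    (h : IsPullback r c Y) (h' : IsPullback r c' Y') : Y = Y' := by
  have key : ∀ i j, wronskianZ (Y.y i) (Y.y j) = wronskianZ (Y'.y i) (Y'.y j) := fun i j =>
    r.eq_of_fifthOrder_eq_zero (h.wronskian i j) (h'.wronskian i j) (by
      rw [FrobeniusBasis.zCoeff_zero_wronskianZ_y, FrobeniusBasis.zCoeff_zero_wronskianZ_y])
  exact FrobeniusBasis.eq_of_wronskianZ_eq (key _ _) (key _ _) (key _ _) (key _ _) (key _ _)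

theorem frob_eq_sum (g : ℕ → ℂ⟦X⟧) (i : ℕ) :
    frob g i = ∑ m ∈ Finset.range (i + 1), (1 / (m.factorial : ℂ)) •
      (Polynomial.C (PowerSeries.mk fun n => PowerSeries.coeff (i - m) (g n)) *
        Polynomial.X ^ m) := by
  refine Finset.sum_congr rfl fun m _ => ?_
  rw [Polynomial.C_mul_X_pow_eq_monomial, Polynomial.smul_monomial]
  congr 1; ext n; simp [div_eq_inv_mul]

namespace HypergeometricCase

/-- The Frobenius basis of the pullback. -/
def pullbackBasis (r : HypergeometricCase) : FrobeniusBasis where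
  f₀ := PowerSeries.mk fun n => PowerSeries.coeff 0 (frobCoeff r.pullbackCoeff n)
  α₁ := PowerSeries.mk fun n => PowerSeries.coeff 1 (frobCoeff r.pullbackCoeff n)
  α₂ := PowerSeries.mk fun n => PowerSeries.coeff 2 (frobCoeff r.pullbackCoeff n)
  α₃ := PowerSeries.mk fun n => PowerSeries.coeff 3 (frobCoeff r.pullbackCoeff n)
  f₀_zero := by
    rw [← PowerSeries.coeff_zero_eq_constantCoeff_apply, PowerSeries.coeff_mk]
    simp [frobCoeff]
  α₁_zero := by
    rw [← PowerSeries.coeff_zero_eq_constantCoeff_apply, PowerSeries.coeff_mk]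
    simp [frobCoeff, PowerSeries.coeff_one]
  α₂_zero := by
    rw [← PowerSeries.coeff_zero_eq_constantCoeff_apply, PowerSeries.coeff_mk]
    simp [frobCoeff, PowerSeries.coeff_one]
  α₃_zero := by
    rw [← PowerSeries.coeff_zero_eq_constantCoeff_apply, PowerSeries.coeff_mk]
    simp [frobCoeff, PowerSeries.coeff_one]

theorem pullbackBasis_y (r : HypergeometricCase) (i : Fin 4) :
    r.pullbackBasis.y i = frob (frobCoeff r.pullbackCoeff) i := by
  rw [frob_eq_sum]
  fin_cases i <;>
    simp [FrobeniusBasis.y, pullbackBasis, Finset.sum_range_succ, Nat.factorial] <;> norm_num <;>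
    abel

theorem pullbackBasis_solution (r : HypergeometricCase) (i : Fin 4) :
    (theta ^ 4) (r.pullbackBasis.y i) =
      ∑ m : Fin 4, Polynomial.C (r.pullbackCoeff m) * (theta ^ (m : ℕ)) (r.pullbackBasis.y i) := by
  rw [pullbackBasis_y]
  exact theta_pow_frob_frobCoeff r.constantCoeff_pullbackCoeff i.2

end HypergeometricCase

/-- Expansions at `0` of rational functions. -/
def IsRationalSeries (f : ℂ⟦X⟧) : Prop :=
  ∃ P Q : Polynomial ℂ, Q ≠ 0 ∧ (Q : ℂ⟦X⟧) * f = (P : ℂ⟦X⟧)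

namespace IsRationalSeries

theorem mul {f g : ℂ⟦X⟧} (hf : IsRationalSeries f) (hg : IsRationalSeries g) :
    IsRationalSeries (f * g) := by
  obtain ⟨P, Q, hQ, h⟩ := hf
  obtain ⟨P', Q', hQ', h'⟩ := hg
  refine ⟨P * P', Q * Q', mul_ne_zero hQ hQ', ?_⟩
  push_cast
  rw [← h, ← h']; ring

theorem add {f g : ℂ⟦X⟧} (hf : IsRationalSeries f) (hg : IsRationalSeries g) :
    IsRationalSeries (f + g) := by
  obtain ⟨P, Q, hQ, h⟩ := hf
  obtain ⟨P', Q', hQ', h'⟩ := hg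
  refine ⟨Q' * P + Q * P', Q * Q', mul_ne_zero hQ hQ', ?_⟩
  push_cast
  rw [← h, ← h']; ring

theorem polynomial (P : Polynomial ℂ) : IsRationalSeries (P : ℂ⟦X⟧) :=
  ⟨P, 1, one_ne_zero, by simp⟩

theorem const (a : ℂ) : IsRationalSeries (PowerSeries.C a) := by
  simpa using polynomial (Polynomial.C a)

theorem sub {f g : ℂ⟦X⟧} (hf : IsRationalSeries f) (hg : IsRationalSeries g) :
    IsRationalSeries (f - g) := by
  have : f - g = f + PowerSeries.C (-1) * g := by simp [sub_eq_add_neg]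
  rw [this]
  exact hf.add ((const _).mul hg)

theorem ofNat (n : ℕ) [n.AtLeastTwo] : IsRationalSeries (OfNat.ofNat n : ℂ⟦X⟧) := by
  simpa only [map_ofNat] using const (OfNat.ofNat n)

theorem one : IsRationalSeries 1 := by simpa using const 1

theorem geom (r : HypergeometricCase) : IsRationalSeries r.geom := by
  refine ⟨Polynomial.C (r.ρ : ℂ) * Polynomial.X,
    16 * (1 - Polynomial.C (r.ρ : ℂ) * Polynomial.X), fun h => ?_, ?_⟩
  · have := congrArg (Polynomial.eval 0) h
    simp at this
  · have h16 : ((16 : Polynomial ℂ) : ℂ⟦X⟧) = 16 := map_ofNat (Polynomial.coeToPowerSeries.ringHom) 16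
    push_cast [h16]
    have := r.one_sub_mul_geom
    simp only [map_natCast]
    linear_combination this

end IsRationalSeries

namespace HypergeometricCase

theorem isRationalSeries_pullbackCoeff (r : HypergeometricCase) (i : Fin 4) :
    IsRationalSeries (r.pullbackCoeff i) := by
  have hD := IsRationalSeries.geom r
  have hS := IsRationalSeries.const r.expSum
  have hP := IsRationalSeries.const r.expProd
  have hn := fun (n : ℕ) [n.AtLeastTwo] => IsRationalSeries.ofNat n
  fin_cases i
  · exact (((((hn 4).mul ((hS.sub .one).sub hP)).mul hD).add ((((hn 16).mul
      ((((hn 8).mul hS).sub (hn 19)).sub (hS.mul hS))).mul hD).mul hD)).add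
      (((((hn 128).mul (((hn 9).mul hS).sub (hn 54))).mul hD).mul hD).mul hD)).sub
      (((((hn 48384).mul hD).mul hD).mul hD).mul hD)
  · exact ((((hn 8).mul (hS.sub .one)).mul hD).add ((((hn 64).mul (hS.sub (hn 4))).mul hD).mul
      hD)).sub ((((hn 2304).mul hD).mul hD).mul hD)
  · exact (((hn 8).mul hS).mul hD).sub (((hn 32).mul hD).mul hD)
  · exact (hn 16).mul hD

/-- The Calabi-Yau condition needs no computation: W₀₃ and W₁₂ both solve the fifth-order equation
and both begin with log²z/2. Likewise w₀ and W₀₁ both begin with 1. -/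
theorem isPullback_pullbackBasis (r : HypergeometricCase)
    (hw : r.fifthOrder (Polynomial.C r.w₀) = 0) (hw0 : PowerSeries.constantCoeff r.w₀ = 1) :
    IsPullback r r.pullbackCoeff r.pullbackBasis where
  rational := r.isRationalSeries_pullbackCoeff
  mum := r.constantCoeff_pullbackCoeff
  solution := r.pullbackBasis_solution
  calabiYau := r.eq_of_fifthOrder_eq_zero
    (r.fifthOrder_wronskianZ (r.pullbackBasis_solution 0) (r.pullbackBasis_solution 3))
    (r.fifthOrder_wronskianZ (r.pullbackBasis_solution 1) (r.pullbackBasis_solution 2)) (by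
      rw [FrobeniusBasis.zCoeff_zero_wronskianZ_zero_three,
        FrobeniusBasis.zCoeff_zero_wronskianZ_one_two])
  wronskian i j := r.fifthOrder_wronskianZ (r.pullbackBasis_solution i) (r.pullbackBasis_solution j)
  w₀_eq := r.eq_of_fifthOrder_eq_zero hw
    (r.fifthOrder_wronskianZ (r.pullbackBasis_solution 0) (r.pullbackBasis_solution 1)) (by
      rw [FrobeniusBasis.zCoeff_zero_wronskianZ_zero_one, zCoeff_zero_eq_map, Polynomial.map_C, hw0,
        map_one])

end HypergeometricCase

/-! ### Frobenius solutions of the hypergeometric equation -/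

/-- The expansion of `1 / (a + x)`. -/
def invLinear (a : ℂ) : ℂ⟦X⟧ := PowerSeries.mk fun i => (-1) ^ i / a ^ (i + 1)

theorem linear_mul_invLinear {a : ℂ} (ha : a ≠ 0) :
    (PowerSeries.C a + PowerSeries.X) * invLinear a = 1 := by
  ext n
  rw [add_mul, map_add, PowerSeries.coeff_C_mul, PowerSeries.coeff_one]
  rcases n with _ | n
  · simp [invLinear, ha]
  · rw [PowerSeries.coeff_succ_X_mul, invLinear, PowerSeries.coeff_mk, PowerSeries.coeff_mk]
    simp only [Nat.add_eq_zero_iff, one_ne_zero, and_false, if_false]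
    field_simp
    ring

theorem constantCoeff_invLinear (a : ℂ) : PowerSeries.constantCoeff (invLinear a) = 1 / a := by
  rw [← PowerSeries.coeff_zero_eq_constantCoeff_apply]
  simp [invLinear]

theorem C_X_mul_frob (a : ℂ) (g : ℕ → ℂ⟦X⟧) (i : ℕ) :
    Polynomial.C (PowerSeries.C a * PowerSeries.X) * frob g i =
      frob (fun n => Nat.casesOn n 0 fun k => a • g k) i := by
  ext m n
  rw [Polynomial.coeff_C_mul, mul_assoc, PowerSeries.coeff_C_mul]
  rcases n with _ | n
  · simp [coeff_coeff_frob]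
  · rw [PowerSeries.coeff_succ_X_mul]
    simp only [coeff_coeff_frob, map_smul, smul_eq_mul]
    split_ifs <;> ring

theorem theta_add_smul_frob (a : ℂ) (g : ℕ → ℂ⟦X⟧) (i : ℕ) :
    (theta + a • 1) (frob g i) =
      frob (fun n => (PowerSeries.C ((n : ℂ) + a) + PowerSeries.X) * g n) i := by
  rw [LinearMap.add_apply, theta_frob, LinearMap.smul_apply, Module.End.one_apply, ← frob_smul,
    ← frob_add]
  congr 1; ext1 n
  rw [PowerSeries.smul_eq_C_mul]
  simp only [map_add, map_natCast]; ring

namespace HypergeometricCase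

/-- `ρ (x + n + 1/2) (x + n + s₁) (x + n + 1 - s₁) (x + n + s₂) (x + n + 1 - s₂)`. -/
def hypNumerator (r : HypergeometricCase) (n : ℕ) : ℂ⟦X⟧ :=
  PowerSeries.C (r.ρ : ℂ) * ((PowerSeries.C ((n : ℂ) + 1 / 2) + PowerSeries.X) *
    (PowerSeries.C ((n : ℂ) + r.s₁) + PowerSeries.X) *
    (PowerSeries.C ((n : ℂ) + (1 - r.s₁)) + PowerSeries.X) *
    (PowerSeries.C ((n : ℂ) + r.s₂) + PowerSeries.X) *
    (PowerSeries.C ((n : ℂ) + (1 - r.s₂)) + PowerSeries.X))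

/-- The expansion of `A_{n+x} / A_x` at `x = 0`. -/
def hypCoeff (r : HypergeometricCase) : ℕ → ℂ⟦X⟧
  | 0 => 1
  | n + 1 => invLinear (n + 1) ^ 5 * (r.hypNumerator n * r.hypCoeff n)

theorem pow_mul_hypCoeff_succ (r : HypergeometricCase) (n : ℕ) :
    (((n + 1 : ℕ) : ℂ⟦X⟧) + PowerSeries.X) ^ 5 * r.hypCoeff (n + 1) =
      r.hypNumerator n * r.hypCoeff n := by
  have h : (((n + 1 : ℕ) : ℂ⟦X⟧) + PowerSeries.X) * invLinear (n + 1) = 1 := by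
    rw [← linear_mul_invLinear (a := (n : ℂ) + 1) (by exact_mod_cast Nat.succ_ne_zero n)]
    simp
  rw [hypCoeff, ← mul_assoc, ← mul_pow, h, one_pow, one_mul]

/-- The recurrence for A_{n+x}/A_x says that the operator sends ∑ (A_{n+x}/A_x) z^{n+x} to x⁵z^x,
which has no part of degree below five in x. -/
theorem fifthOrder_frob_hypCoeff (r : HypergeometricCase) {i : ℕ} (hi : i < 5) :
    r.fifthOrder (frob r.hypCoeff i) = 0 := by
  have hρ : (r.ρ : ℂ⟦X⟧) = PowerSeries.C (r.ρ : ℂ) := (map_natCast _ _).symm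
  rw [fifthOrder, sub_eq_zero]
  simp only [Module.End.mul_apply, theta_add_smul_frob]
  rw [theta_pow_frob, hρ, C_X_mul_frob]
  refine frob_eq_of_coeff_eq fun n k hk => ?_
  rcases n with _ | n
  · simp [hypCoeff, PowerSeries.coeff_X_pow, show ¬k = 5 by omega]
  · rw [pow_mul_hypCoeff_succ]
    congr 1
    dsimp only
    rw [hypNumerator, PowerSeries.smul_eq_C_mul]
    ring

theorem zCoeff_zero_frob_hypCoeff (r : HypergeometricCase) (i : ℕ) :
    zCoeff 0 (frob r.hypCoeff i) = Polynomial.monomial i (1 / (i.factorial : ℂ)) :=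
  zCoeff_frob _ _ _ rfl

/-- The inequalities on the parameters which hold in all hypergeometric cases. -/
structure IsAdmissible (r : HypergeometricCase) : Prop where
  s₁_pos : 0 < (r.s₁ : ℝ)
  s₁_lt : (r.s₁ : ℝ) < 1
  s₂_pos : 0 < (r.s₂ : ℝ)
  s₂_lt : (r.s₂ : ℝ) < 1
  s₁_ge : 1 / 12 ≤ (r.s₁ : ℝ)
  s₁_le : (r.s₁ : ℝ) ≤ 11 / 12
  s₂_ge : 1 / 12 ≤ (r.s₂ : ℝ)
  s₂_le : (r.s₂ : ℝ) ≤ 11 / 12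
  ρ_pos : 0 < (r.ρ : ℝ)

theorem isAdmissible_of_mem {r : HypergeometricCase} (hr : r ∈ hypergeometricTable) :
    r.IsAdmissible := by
  simp only [hypergeometricTable, List.mem_cons, List.not_mem_nil, or_false] at hr
  rcases hr with rfl | rfl | rfl | rfl | rfl | rfl | rfl | rfl | rfl | rfl | rfl | rfl | rfl | rfl <;>
    constructor <;> norm_num

/-- The bound on y keeps s + y positive for every exponent s ≥ 1/12, so the functional equation of Γ
applies. The later restriction |x| < 1/12 comes from here. -/
theorem A_add_one {r : HypergeometricCase} (hr : r.IsAdmissible) {y : ℝ} (hy : -(1 / 12) < y) :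
    r.A (y + 1) * (y + 1) ^ 5 = r.ρ * ((y + 1 / 2) * (y + r.s₁) * (y + (1 - r.s₁)) * (y + r.s₂) *
      (y + (1 - r.s₂))) * r.A y := by
  have hp : ∀ s : ℝ, 1 / 12 ≤ s → pochhammerReal s (y + 1) = (y + s) * pochhammerReal s y := by
    intro s hs
    have : s + y ≠ 0 := by linarith
    rw [pochhammerReal, ← add_assoc, Real.Gamma_add_one this, pochhammerReal]; ring
  have hy1 : y + 1 ≠ 0 := by linarith
  have hG : Real.Gamma (y + 1) ≠ 0 := (Real.Gamma_pos_of_pos (by linarith)).ne'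
  rw [A, A, hp _ (by norm_num), hp _ hr.s₁_ge, hp _ hr.s₂_ge,
    hp (1 - r.s₁) (by linarith [hr.s₁_le]), hp (1 - r.s₂) (by linarith [hr.s₂_le]),
    Real.Gamma_add_one hy1, Real.rpow_add_one hr.ρ_pos.ne']
  have key : ∀ a b g : ℝ, b ≠ 0 → g ≠ 0 → a / (b * g) ^ 5 * b ^ 5 = a / g ^ 5 := fun a b g hb hg => by
    field_simp
  rw [key _ _ _ hy1 hG]
  ring

theorem A_zero {r : HypergeometricCase} (hr : r.IsAdmissible) : r.A 0 = 1 := by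
  have hp : ∀ s : ℝ, 0 < s → pochhammerReal s 0 = 1 := fun s hs => by
    rw [pochhammerReal, add_zero, div_self (Real.Gamma_pos_of_pos hs).ne']
  rw [A, hp _ (by norm_num), hp _ hr.s₁_pos, hp _ hr.s₂_pos, hp _ (by linarith [hr.s₁_lt]),
    hp _ (by linarith [hr.s₂_lt])]
  simp

theorem constantCoeff_hypCoeff {r : HypergeometricCase} (hr : r.IsAdmissible) (n : ℕ) :
    PowerSeries.constantCoeff (r.hypCoeff n) = r.A n := by
  induction n with
  | zero => simp [hypCoeff, A_zero hr]
  | succ n ih =>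
    have hn : ((n : ℂ) + 1) ≠ 0 := by exact_mod_cast Nat.succ_ne_zero n
    have h := congrArg ((↑) : ℝ → ℂ) (A_add_one hr (y := n) (by
      have : (0 : ℝ) ≤ n := n.cast_nonneg
      linarith))
    rw [hypCoeff, map_mul, map_mul, ih, map_pow, constantCoeff_invLinear, hypNumerator]
    simp only [map_mul, map_add, PowerSeries.constantCoeff_C, PowerSeries.constantCoeff_X, add_zero]
    push_cast at h ⊢
    rw [div_pow, one_pow, div_mul_eq_mul_div, one_mul, ← h]
    field_simp

theorem C_w₀ {r : HypergeometricCase} (hr : r.IsAdmissible) :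
    Polynomial.C r.w₀ = frob r.hypCoeff 0 := by
  have : r.w₀ = PowerSeries.mk fun n => PowerSeries.coeff 0 (r.hypCoeff n) := by
    ext n
    simp [w₀, constantCoeff_hypCoeff hr]
  rw [frob_eq_sum, this]; simp

theorem exists_isPullback {r : HypergeometricCase} (hr : r.IsAdmissible) :
    IsPullback r r.pullbackCoeff r.pullbackBasis := by
  refine r.isPullback_pullbackBasis ?_ ?_
  · rw [C_w₀ hr]; exact r.fifthOrder_frob_hypCoeff (by norm_num)
  · rw [← PowerSeries.coeff_zero_eq_constantCoeff_apply]
    simp [w₀, A_zero hr]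

end HypergeometricCase

namespace IsPullback

variable {r : HypergeometricCase} {c : Fin 4 → ℂ⟦X⟧} {Y : FrobeniusBasis}

theorem wronskianZ_zero_one (h : IsPullback r c Y) :
    wronskianZ (Y.y 0) (Y.y 1) = frob r.hypCoeff 0 :=
  r.eq_of_fifthOrder_eq_zero (h.wronskian _ _) (r.fifthOrder_frob_hypCoeff (by norm_num)) (by
    rw [Y.zCoeff_zero_wronskianZ_zero_one, r.zCoeff_zero_frob_hypCoeff]; simp)

theorem wronskianZ_zero_two (h : IsPullback r c Y) :
    wronskianZ (Y.y 0) (Y.y 2) = frob r.hypCoeff 1 :=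
  r.eq_of_fifthOrder_eq_zero (h.wronskian _ _) (r.fifthOrder_frob_hypCoeff (by norm_num)) (by
    rw [Y.zCoeff_zero_wronskianZ_zero_two, r.zCoeff_zero_frob_hypCoeff]
    simp [Polynomial.X])

theorem wronskianZ_one_two (h : IsPullback r c Y) :
    wronskianZ (Y.y 1) (Y.y 2) = frob r.hypCoeff 2 :=
  r.eq_of_fifthOrder_eq_zero (h.wronskian _ _) (r.fifthOrder_frob_hypCoeff (by norm_num)) (by
    rw [Y.zCoeff_zero_wronskianZ_one_two, r.zCoeff_zero_frob_hypCoeff,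
      Polynomial.C_mul_X_pow_eq_monomial]
    norm_num [Nat.factorial])

/-- The factor 2 appears because W₁₃ begins with log³z/3, whereas the third Frobenius solution
begins with log³z/6. -/
theorem wronskianZ_one_three (h : IsPullback r c Y) :
    wronskianZ (Y.y 1) (Y.y 3) = (2 : ℂ) • frob r.hypCoeff 3 :=
  r.eq_of_fifthOrder_eq_zero (h.wronskian _ _)
    (by rw [r.fifthOrder_smul, r.fifthOrder_frob_hypCoeff (by norm_num), smul_zero]) (by
    rw [Y.zCoeff_zero_wronskianZ_one_three, zCoeff_smul, r.zCoeff_zero_frob_hypCoeff,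
      Polynomial.C_mul_X_pow_eq_monomial, Polynomial.smul_monomial]
    norm_num [Nat.factorial])

end IsPullback

/-! ### Convergence of power series -/

open scoped ENNReal NNReal

/-- The sum `∑ |fₙ| rⁿ`. -/
def majNorm (r : ℝ≥0∞) (f : ℂ⟦X⟧) : ℝ≥0∞ := ∑' n, ‖PowerSeries.coeff n f‖ₑ * r ^ n

theorem majNorm_zero (r : ℝ≥0∞) : majNorm r 0 = 0 := by simp [majNorm]

theorem majNorm_add_le (r : ℝ≥0∞) (f g : ℂ⟦X⟧) : majNorm r (f + g) ≤ majNorm r f + majNorm r g := by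
  rw [majNorm, majNorm, majNorm, ← ENNReal.tsum_add]
  refine ENNReal.tsum_le_tsum fun n => ?_
  rw [map_add, ← add_mul]
  gcongr
  exact enorm_add_le _ _

theorem majNorm_neg (r : ℝ≥0∞) (f : ℂ⟦X⟧) : majNorm r (-f) = majNorm r f := by
  simp [majNorm]

/-- Taking values in [0, ∞] lets the Cauchy product estimate hold without any convergence
assumption. -/
theorem majNorm_mul_le (r : ℝ≥0∞) (f g : ℂ⟦X⟧) : majNorm r (f * g) ≤ majNorm r f * majNorm r g := by
  rw [majNorm, majNorm, majNorm, ← ENNReal.tsum_mul_right]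
  simp_rw [← ENNReal.tsum_mul_left]
  rw [← ENNReal.tsum_prod, ← (Finset.HasAntidiagonal.sigmaAntidiagonalEquivProd (A := ℕ)).tsum_eq, ENNReal.tsum_sigma']
  refine ENNReal.tsum_le_tsum fun n => ?_
  rw [tsum_fintype, Finset.univ_eq_attach, PowerSeries.coeff_mul]
  simp only [Finset.HasAntidiagonal.sigmaAntidiagonalEquivProd_apply]
  rw [Finset.sum_attach (Finset.HasAntidiagonal.antidiagonal n) (fun k => ‖PowerSeries.coeff k.1 f‖ₑ * r ^ k.1 *
    (‖PowerSeries.coeff k.2 g‖ₑ * r ^ k.2))]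
  calc _ ≤ (∑ k ∈ Finset.HasAntidiagonal.antidiagonal n, ‖PowerSeries.coeff k.1 f * PowerSeries.coeff k.2 g‖ₑ) * r ^ n := by
        gcongr; exact enorm_sum_le _ _
    _ = _ := by
        rw [Finset.sum_mul]
        refine Finset.sum_congr rfl fun k hk => ?_
        rw [← Finset.HasAntidiagonal.mem_antidiagonal.1 hk, enorm_mul, pow_add]; ring

theorem majNorm_C (r : ℝ≥0∞) (a : ℂ) : majNorm r (PowerSeries.C a) = ‖a‖ₑ := by
  rw [majNorm, tsum_eq_single 0]
  · simp
  · intro n hn; simp [PowerSeries.coeff_C, hn]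

theorem majNorm_one (r : ℝ≥0∞) : majNorm r 1 = 1 := by
  simpa using majNorm_C r 1

theorem majNorm_X (r : ℝ≥0∞) : majNorm r PowerSeries.X = r := by
  rw [majNorm, tsum_eq_single 1]
  · simp
  · intro n hn; simp [PowerSeries.coeff_X, hn]

theorem majNorm_mono {r s : ℝ≥0∞} (h : r ≤ s) (f : ℂ⟦X⟧) : majNorm r f ≤ majNorm s f :=
  ENNReal.tsum_le_tsum fun n => by gcongr

theorem enorm_coeff_mul_le_majNorm (r : ℝ≥0∞) (f : ℂ⟦X⟧) (n : ℕ) :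
    ‖PowerSeries.coeff n f‖ₑ * r ^ n ≤ majNorm r f :=
  ENNReal.le_tsum n

theorem summable_norm_of_majNorm {f : ℂ⟦X⟧} {z : ℂ} (h : majNorm ‖z‖ₑ f ≠ ∞) :
    Summable fun n => ‖PowerSeries.coeff n f * z ^ n‖ := by
  refine (ENNReal.summable_toReal h).congr fun n => ?_
  simp

theorem seriesAt_add {f g : ℂ⟦X⟧} {z : ℂ} (hf : majNorm ‖z‖ₑ f ≠ ∞) (hg : majNorm ‖z‖ₑ g ≠ ∞) :
    seriesAt (f + g) z = seriesAt f z + seriesAt g z := by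
  rw [seriesAt, seriesAt, seriesAt, ← (summable_norm_of_majNorm hf).of_norm.tsum_add
    (summable_norm_of_majNorm hg).of_norm]
  simp [add_mul]

theorem seriesAt_mul {f g : ℂ⟦X⟧} {z : ℂ} (hf : majNorm ‖z‖ₑ f ≠ ∞) (hg : majNorm ‖z‖ₑ g ≠ ∞) :
    seriesAt (f * g) z = seriesAt f z * seriesAt g z := by
  rw [seriesAt, seriesAt, seriesAt, tsum_mul_tsum_eq_tsum_sum_antidiagonal_of_summable_norm
    (summable_norm_of_majNorm hf) (summable_norm_of_majNorm hg)]
  refine tsum_congr fun n => ?_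
  rw [PowerSeries.coeff_mul, Finset.sum_mul]
  refine Finset.sum_congr rfl fun k hk => ?_
  rw [← Finset.HasAntidiagonal.mem_antidiagonal.1 hk, pow_add]; ring

theorem seriesAt_C (a z : ℂ) : seriesAt (PowerSeries.C a) z = a := by
  rw [seriesAt, tsum_eq_single 0]
  · simp
  · intro n hn; simp [PowerSeries.coeff_C, hn]

theorem seriesAt_one (z : ℂ) : seriesAt 1 z = 1 := by simpa using seriesAt_C 1 z

theorem seriesAt_X (z : ℂ) : seriesAt PowerSeries.X z = z := by
  rw [seriesAt, tsum_eq_single 1]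
  · simp
  · intro n hn; simp [PowerSeries.coeff_X, hn]

theorem seriesAt_zero (z : ℂ) : seriesAt 0 z = 0 := by simpa using seriesAt_C 0 z

/-- The power series which converge absolutely on the open disc of radius `R`. -/
def discSubring (R : ℝ≥0) : Subring ℂ⟦X⟧ where
  carrier := {f | ∀ r : ℝ≥0, r < R → majNorm r f ≠ ∞}
  mul_mem' hf hg r hr := ((majNorm_mul_le _ _ _).trans_lt
    (ENNReal.mul_lt_top (hf r hr).lt_top (hg r hr).lt_top)).ne
  one_mem' r _ := by simp [majNorm_one]
  add_mem' hf hg r hr := ((majNorm_add_le _ _ _).trans_lt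
    (ENNReal.add_lt_top.2 ⟨(hf r hr).lt_top, (hg r hr).lt_top⟩)).ne
  zero_mem' r _ := by simp [majNorm_zero]
  neg_mem' hf r hr := by rw [majNorm_neg]; exact hf r hr

variable {R : ℝ≥0}

theorem majNorm_ne_top_of_mem {f : ℂ⟦X⟧} (hf : f ∈ discSubring R) {z : ℂ} (hz : ‖z‖₊ < R) :
    majNorm ‖z‖ₑ f ≠ ∞ := hf _ hz

theorem C_mem_discSubring (a : ℂ) : PowerSeries.C a ∈ discSubring R := fun r _ => by
  rw [majNorm_C]; exact enorm_ne_top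

theorem exists_coeff_bound_of_mem {f : ℂ⟦X⟧} (hf : f ∈ discSubring R) {r : ℝ≥0} (hr : r < R) :
    ∃ C : ℝ, ∀ n, ‖PowerSeries.coeff n f‖ * (r : ℝ) ^ n ≤ C := by
  refine ⟨(majNorm r f).toReal, fun n => ?_⟩
  have h := ENNReal.toReal_mono (hf r hr) (enorm_coeff_mul_le_majNorm r f n)
  simpa using h

/-- Boundedness at an intermediate radius s dominates the series at r by a geometric one of ratio
r/s. Thus on an open disc bounds on the terms can replace summability. -/
theorem mem_discSubring_of_coeff_bound {f : ℂ⟦X⟧}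
    (hf : ∀ r : ℝ≥0, 0 < r → r < R → ∃ C : ℝ, ∀ n, ‖PowerSeries.coeff n f‖ * (r : ℝ) ^ n ≤ C) :
    f ∈ discSubring R := by
  intro r hr
  obtain ⟨s, hrs, hsR⟩ := exists_between hr
  have hs : 0 < s := lt_of_le_of_lt (by simp) hrs
  obtain ⟨C, hC⟩ := hf s hs hsR
  have hs' : (0 : ℝ) < s := hs
  have hsum : Summable fun n => C * ((r : ℝ) / s) ^ n :=
    (summable_geometric_of_lt_one (div_nonneg r.coe_nonneg s.coe_nonneg) ((div_lt_one hs').2 hrs)).mul_left _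
  have h2 : Summable fun n => ‖PowerSeries.coeff n f‖ * (r : ℝ) ^ n := by
    refine Summable.of_nonneg_of_le (fun n => by positivity) (fun n => ?_) hsum
    rw [div_pow, mul_div_assoc', le_div_iff₀ (by positivity)]
    calc _ = (‖PowerSeries.coeff n f‖ * (s : ℝ) ^ n) * (r : ℝ) ^ n := by ring
      _ ≤ _ := by gcongr; exact hC n
  have h3 := h2.tsum_ofReal_ne_top
  rw [majNorm]
  convert h3 using 4 with n
  rw [ENNReal.ofReal_mul (by positivity), ENNReal.ofReal_pow (by positivity), ofReal_norm,
    ENNReal.ofReal_coe_nnreal]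

theorem thetaSeries_mem_discSubring {f : ℂ⟦X⟧} (hf : f ∈ discSubring R) :
    thetaSeries f ∈ discSubring R := by
  refine mem_discSubring_of_coeff_bound fun r hr0 hr => ?_
  obtain ⟨s, hrs, hsR⟩ := exists_between hr
  obtain ⟨C, hC⟩ := exists_coeff_bound_of_mem hf hsR
  have hr' : (0 : ℝ) < r := hr0
  have hs' : (0 : ℝ) < s := hr'.trans hrs
  have hlim := tendsto_self_mul_const_pow_of_lt_one (r := (r : ℝ) / s) (by positivity)
    ((div_lt_one hs').2 hrs)
  obtain ⟨M, hM⟩ := hlim.bddAbove_range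
  refine ⟨C * M, fun n => ?_⟩
  have h1 : (n : ℝ) * ((r : ℝ) / s) ^ n ≤ M := hM ⟨n, rfl⟩
  have hC0 : 0 ≤ C := le_trans (by positivity) (hC n)
  rw [coeff_thetaSeries, norm_mul, Complex.norm_natCast]
  calc _ = (‖PowerSeries.coeff n f‖ * (s : ℝ) ^ n) * ((n : ℝ) * ((r : ℝ) / s) ^ n) := by
        rw [div_pow]; field_simp
    _ ≤ _ := mul_le_mul (hC n) h1 (by positivity) hC0

theorem inv_one_sub_mem_discSubring (ρ : ℕ) (hR : (ρ : ℝ≥0) * R ≤ 1) :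
    (1 - (ρ : ℂ⟦X⟧) * PowerSeries.X)⁻¹ ∈ discSubring R := by
  have h : (1 - (ρ : ℂ⟦X⟧) * PowerSeries.X)⁻¹ = PowerSeries.mk fun n => (ρ : ℂ) ^ n := by
    rw [PowerSeries.inv_eq_iff_mul_eq_one (by simp)]
    ext n
    have hρ : (ρ : ℂ⟦X⟧) = PowerSeries.C (ρ : ℂ) := (map_natCast _ _).symm
    rw [mul_sub, mul_one, map_sub, hρ, mul_left_comm, PowerSeries.coeff_C_mul, PowerSeries.coeff_one]
    rcases n with _ | n
    · simp
    · rw [PowerSeries.coeff_succ_mul_X]; simp [pow_succ']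
  rw [h]
  refine mem_discSubring_of_coeff_bound fun r hr0 hr => ⟨1, fun n => ?_⟩
  rw [PowerSeries.coeff_mk, norm_pow, Complex.norm_natCast, ← mul_pow]
  refine pow_le_one₀ (by positivity) ?_
  have : (ρ : ℝ≥0) * r ≤ 1 := le_trans (by gcongr) hR
  exact_mod_cast this

/-- Power series solutions of `θᴺ⁺¹ f = ∑ cₘ θᵐ f + g` converge where the coefficients do. -/
theorem mem_discSubring_of_theta_pow_eq {N : ℕ} {c : Fin (N + 1) → ℂ⟦X⟧} {f g : ℂ⟦X⟧}
    (hc0 : ∀ m, PowerSeries.constantCoeff (c m) = 0) (hc : ∀ m, c m ∈ discSubring R)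
    (hg : g ∈ discSubring R)
    (h : thetaSeries^[N + 1] f = ∑ m : Fin (N + 1), c m * thetaSeries^[(m : ℕ)] f + g) :
    f ∈ discSubring R := by
  refine mem_discSubring_of_coeff_bound fun r hr0 hr => ?_
  obtain ⟨s, hrs, hsR⟩ := exists_between hr
  have hr' : (0 : ℝ) < r := hr0
  have hs' : (0 : ℝ) < s := hr'.trans hrs
  choose C hC using fun m => exists_coeff_bound_of_mem (hc m) hsR
  obtain ⟨G, hG⟩ := exists_coeff_bound_of_mem hg hr
  set q : ℝ := (r : ℝ) / s with hq
  have hq0 : 0 ≤ q := by positivity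
  have hq1 : q < 1 := (div_lt_one hs').2 hrs
  have hC0 : ∀ m, 0 ≤ C m := fun m => le_trans (by positivity) (hC m 0)
  have hG0 : 0 ≤ G := le_trans (by positivity) (hG 0)
  have hiter : ∀ (m : ℕ) (φ : ℂ⟦X⟧) (n : ℕ),
      PowerSeries.coeff n (thetaSeries^[m] φ) = (n : ℂ) ^ m * PowerSeries.coeff n φ := by
    intro m φ n
    induction m with
    | zero => simp
    | succ m ih => rw [Function.iterate_succ_apply', coeff_thetaSeries, ih]; ring
  set F : ℕ → ℝ := fun n => ‖PowerSeries.coeff n f‖ * (r : ℝ) ^ n with hF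
  have hF0 : ∀ n, 0 ≤ F n := fun n => by positivity
  have hcq : ∀ m k, ‖PowerSeries.coeff k (c m)‖ * (r : ℝ) ^ k ≤ C m * q ^ k := by
    intro m k
    rw [hq, div_pow, mul_div_assoc', le_div_iff₀ (by positivity)]
    calc _ = (‖PowerSeries.coeff k (c m)‖ * (s : ℝ) ^ k) * (r : ℝ) ^ k := by ring
      _ ≤ _ := by gcongr; exact hC m k
  -- In the coefficient of zⁿ the left side carries n^{N+1}, the terms on the right at most n^N.
  -- Dividing by n^N leaves a spare factor n.
  have hrec : ∀ n : ℕ, n ≠ 0 → (n : ℝ) * F n ≤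
      ∑ m : Fin (N + 1), ∑ k ∈ (Finset.HasAntidiagonal.antidiagonal n).filter (fun k => k.1 ≠ 0),
        C m * q ^ k.1 * F k.2 + G := by
    intro n hn
    have hn1 : (1 : ℝ) ≤ n := by exact_mod_cast Nat.one_le_iff_ne_zero.2 hn
    have h1 := congrArg (PowerSeries.coeff n) h
    rw [hiter, map_add, map_sum] at h1
    have h2 : (n : ℝ) ^ (N + 1) * F n ≤ (n : ℝ) ^ N * (∑ m : Fin (N + 1),
        ∑ k ∈ (Finset.HasAntidiagonal.antidiagonal n).filter (fun k => k.1 ≠ 0), C m * q ^ k.1 * F k.2 + G) := by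
      calc (n : ℝ) ^ (N + 1) * F n = ‖(n : ℂ) ^ (N + 1) * PowerSeries.coeff n f‖ * (r : ℝ) ^ n := by
            rw [norm_mul, norm_pow, Complex.norm_natCast, mul_assoc]
        _ ≤ (∑ m, ‖PowerSeries.coeff n (c m * thetaSeries^[(m : ℕ)] f)‖
              + ‖PowerSeries.coeff n g‖) * (r : ℝ) ^ n := by
            rw [h1]
            gcongr
            exact (norm_add_le _ _).trans (by gcongr; exact norm_sum_le _ _)
        _ ≤ _ := by
            rw [add_mul, mul_add, Finset.sum_mul, Finset.mul_sum]
            refine add_le_add (Finset.sum_le_sum fun m _ => ?_) ?_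
            · rw [PowerSeries.coeff_mul, Finset.mul_sum]
              rw [← Finset.sum_filter_of_ne (p := fun k : ℕ × ℕ => k.1 ≠ 0) (by
                intro k _ hk h0
                refine hk ?_
                rw [h0, PowerSeries.coeff_zero_eq_constantCoeff_apply, hc0, zero_mul])]
              refine (mul_le_mul_of_nonneg_right (norm_sum_le _ _) (by positivity)).trans ?_
              rw [Finset.sum_mul]
              refine Finset.sum_le_sum fun k hk => ?_
              have hk' := Finset.HasAntidiagonal.mem_antidiagonal.1 (Finset.mem_filter.1 hk).1
              have hk2 : (k.2 : ℝ) ≤ n := by exact_mod_cast (by omega : k.2 ≤ n)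
              have hpow : (k.2 : ℝ) ^ (m : ℕ) ≤ (n : ℝ) ^ N :=
                (pow_le_pow_left₀ (by positivity) hk2 _).trans
                  (pow_le_pow_right₀ hn1 (by omega))
              rw [hiter, norm_mul, norm_mul, norm_pow, Complex.norm_natCast, ← hk', pow_add]
              rw [hk']
              calc _ = (k.2 : ℝ) ^ (m : ℕ) * ((‖PowerSeries.coeff k.1 (c m)‖ * (r : ℝ) ^ k.1) * F k.2) := by
                    simp only [hF]; ring
                _ ≤ _ := by
                    refine mul_le_mul hpow ?_ (by positivity) (by positivity)
                    exact mul_le_mul_of_nonneg_right (hcq m k.1) (hF0 _)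
            · calc _ ≤ G := hG n
                _ ≤ _ := le_mul_of_one_le_left hG0 (one_le_pow₀ hn1)
    rw [pow_succ, mul_assoc] at h2
    exact le_of_mul_le_mul_left h2 (by positivity)
  -- Beyond M the spare factor n exceeds every constant in the recursion, so a bound on the first M
  -- + 1 terms propagates. The summand 1 in the bound makes it at least 1, so that the inhomogeneous
  -- constant G is at most G times it.
  obtain ⟨M, hM⟩ := exists_nat_gt ((∑ m, C m) * (1 - q)⁻¹ + G)
  refine ⟨1 + ∑ n ∈ Finset.range (M + 1), F n, fun n => ?_⟩
  set D := 1 + ∑ n ∈ Finset.range (M + 1), F n with hD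
  have hD1 : 1 ≤ D := le_add_of_nonneg_right (Finset.sum_nonneg fun n _ => hF0 n)
  change F n ≤ D
  induction n using Nat.strong_induction_on with
  | _ n ih =>
    rcases Nat.lt_or_ge n (M + 1) with hn | hn
    · have := Finset.single_le_sum (f := F) (fun n _ => hF0 n) (Finset.mem_range.2 hn)
      linarith
    · have hn0 : n ≠ 0 := by omega
      have hnM : (M : ℝ) ≤ n := by exact_mod_cast (by omega : M ≤ n)
      have hn1 : (0 : ℝ) < n := by exact_mod_cast Nat.pos_of_ne_zero hn0
      have h1 : ∑ m : Fin (N + 1), ∑ k ∈ (Finset.HasAntidiagonal.antidiagonal n).filter (fun k => k.1 ≠ 0),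
          C m * q ^ k.1 * F k.2 ≤ (∑ m, C m) * (1 - q)⁻¹ * D := by
        rw [Finset.sum_mul, Finset.sum_mul]
        refine Finset.sum_le_sum fun m _ => ?_
        calc _ ≤ ∑ k ∈ (Finset.HasAntidiagonal.antidiagonal n).filter (fun k => k.1 ≠ 0), C m * q ^ k.1 * D := by
              refine Finset.sum_le_sum fun k hk => ?_
              have hk1 := (Finset.mem_filter.1 hk).2
              have hk' := Finset.HasAntidiagonal.mem_antidiagonal.1 (Finset.mem_filter.1 hk).1
              have := hC0 m
              exact mul_le_mul_of_nonneg_left (ih k.2 (by omega)) (by positivity)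
          _ ≤ ∑ k ∈ Finset.HasAntidiagonal.antidiagonal n, C m * q ^ k.1 * D :=
              Finset.sum_le_sum_of_subset_of_nonneg (Finset.filter_subset _ _) fun k _ _ => by
                have := hC0 m
                positivity
          _ = C m * (∑ k ∈ Finset.range (n + 1), q ^ k) * D := by
              rw [Finset.Nat.sum_antidiagonal_eq_sum_range_succ_mk, Finset.mul_sum, Finset.sum_mul]
          _ ≤ _ := by
              gcongr
              · exact hC0 m
              · rw [← tsum_geometric_of_lt_one hq0 hq1]
                exact (summable_geometric_of_lt_one hq0 hq1).sum_le_tsum _ fun k _ => by positivity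
      refine le_of_mul_le_mul_left ?_ hn1
      calc (n : ℝ) * F n ≤ (∑ m, C m) * (1 - q)⁻¹ * D + G := (hrec n hn0).trans (by gcongr)
        _ ≤ ((∑ m, C m) * (1 - q)⁻¹ + G) * D := by nlinarith
        _ ≤ n * D := by gcongr; linarith

variable {R : ℝ≥0}

/-! ### Evaluation of logarithmic series -/

/-- The value of a convergent power series, as a ring homomorphism. -/
def seriesHom {z : ℂ} (hz : ‖z‖₊ < R) : discSubring R →+* ℂ where
  toFun f := seriesAt f z
  map_one' := seriesAt_one z
  map_mul' f g := seriesAt_mul (majNorm_ne_top_of_mem f.2 hz) (majNorm_ne_top_of_mem g.2 hz)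
  map_zero' := seriesAt_zero z
  map_add' f g := seriesAt_add (majNorm_ne_top_of_mem f.2 hz) (majNorm_ne_top_of_mem g.2 hz)

/-- The logarithmic series whose coefficients converge on the open disc of radius `R`. -/
def logSubring (R : ℝ≥0) : Subring LogSeries where
  carrier := {p | ∀ m, p.coeff m ∈ discSubring R}
  mul_mem' hp hq m := by
    rw [Polynomial.coeff_mul]
    exact sum_mem fun k _ => mul_mem (hp _) (hq _)
  one_mem' m := by
    rw [Polynomial.coeff_one]
    split_ifs
    exacts [one_mem _, zero_mem _]
  add_mem' hp hq m := by rw [Polynomial.coeff_add]; exact add_mem (hp m) (hq m)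
  zero_mem' m := by rw [Polynomial.coeff_zero]; exact zero_mem _
  neg_mem' hp m := by rw [Polynomial.coeff_neg]; exact neg_mem (hp m)

theorem mem_logSubring {p : LogSeries} : p ∈ logSubring R ↔ ∀ m, p.coeff m ∈ discSubring R := Iff.rfl

theorem C_mem_logSubring {f : ℂ⟦X⟧} : Polynomial.C f ∈ logSubring R ↔ f ∈ discSubring R := by
  rw [mem_logSubring]
  refine ⟨fun h => by simpa using h 0, fun h m => ?_⟩
  rw [Polynomial.coeff_C]
  split_ifs
  exacts [h, zero_mem _]

theorem X_mem_logSubring : (Polynomial.X : LogSeries) ∈ logSubring R := fun m => by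
  rw [Polynomial.coeff_X]
  split_ifs
  exacts [one_mem _, zero_mem _]

theorem smul_mem_logSubring {p : LogSeries} (hp : p ∈ logSubring R) (a : ℂ) :
    a • p ∈ logSubring R := by
  rw [smul_eq_C_C_mul]
  exact mul_mem (C_mem_logSubring.2 (C_mem_discSubring a)) hp

theorem theta_mem_logSubring {p : LogSeries} (hp : p ∈ logSubring R) : theta p ∈ logSubring R := by
  intro m
  rw [coeff_theta]
  exact add_mem (thetaSeries_mem_discSubring (hp m))
    (mul_mem (add_mem (natCast_mem _ m) (one_mem _)) (hp _))

theorem theta_pow_mem_logSubring {p : LogSeries} (hp : p ∈ logSubring R) (n : ℕ) :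
    (theta ^ n) p ∈ logSubring R := by
  induction n with
  | zero => simpa using hp
  | succ n ih => rw [pow_succ', Module.End.mul_apply]; exact theta_mem_logSubring ih

theorem wronskianZ_mem_logSubring {p q : LogSeries} (hp : p ∈ logSubring R)
    (hq : q ∈ logSubring R) : wronskianZ p q ∈ logSubring R :=
  sub_mem (mul_mem hp (theta_mem_logSubring hq)) (mul_mem (theta_mem_logSubring hp) hq)

theorem exists_map_eq_of_mem_logSubring {p : LogSeries} (hp : p ∈ logSubring R) :
    ∃ P : Polynomial (discSubring R), P.map (discSubring R).subtype = p := by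
  have : p ∈ Polynomial.lifts (discSubring R).subtype :=
    (Polynomial.lifts_iff_coeff_lifts p).2 fun m => ⟨⟨p.coeff m, hp m⟩, rfl⟩
  simpa [Polynomial.mem_lifts] using this

/-- On convergent series evaluation is `eval₂` along a ring homomorphism. The rules for sums and
products, which may fail for divergent `tsum`s, are obtained from this. -/
theorem logSeriesAt_map {z : ℂ} (hz : ‖z‖₊ < R) (P : Polynomial (discSubring R)) (l : ℂ) :
    logSeriesAt (P.map (discSubring R).subtype) z l = P.eval₂ (seriesHom hz) l := by
  rw [logSeriesAt, Polynomial.eval₂_eq_sum, Polynomial.sum, Polynomial.sum,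
    Polynomial.support_map_of_injective _ (discSubring R).subtype_injective]
  refine Finset.sum_congr rfl fun m _ => ?_
  rw [Polynomial.coeff_map]; rfl

theorem logSeriesAt_add {z : ℂ} (hz : ‖z‖₊ < R) (l : ℂ) {p q : LogSeries} (hp : p ∈ logSubring R)
    (hq : q ∈ logSubring R) : logSeriesAt (p + q) z l = logSeriesAt p z l + logSeriesAt q z l := by
  obtain ⟨P, rfl⟩ := exists_map_eq_of_mem_logSubring hp
  obtain ⟨Q, rfl⟩ := exists_map_eq_of_mem_logSubring hq
  rw [← Polynomial.map_add, logSeriesAt_map hz, logSeriesAt_map hz, logSeriesAt_map hz,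
    Polynomial.eval₂_add]

theorem logSeriesAt_sub {z : ℂ} (hz : ‖z‖₊ < R) (l : ℂ) {p q : LogSeries} (hp : p ∈ logSubring R)
    (hq : q ∈ logSubring R) : logSeriesAt (p - q) z l = logSeriesAt p z l - logSeriesAt q z l := by
  obtain ⟨P, rfl⟩ := exists_map_eq_of_mem_logSubring hp
  obtain ⟨Q, rfl⟩ := exists_map_eq_of_mem_logSubring hq
  rw [← Polynomial.map_sub, logSeriesAt_map hz, logSeriesAt_map hz, logSeriesAt_map hz,
    Polynomial.eval₂_sub]

theorem logSeriesAt_mul {z : ℂ} (hz : ‖z‖₊ < R) (l : ℂ) {p q : LogSeries} (hp : p ∈ logSubring R)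
    (hq : q ∈ logSubring R) : logSeriesAt (p * q) z l = logSeriesAt p z l * logSeriesAt q z l := by
  obtain ⟨P, rfl⟩ := exists_map_eq_of_mem_logSubring hp
  obtain ⟨Q, rfl⟩ := exists_map_eq_of_mem_logSubring hq
  rw [← Polynomial.map_mul, logSeriesAt_map hz, logSeriesAt_map hz, logSeriesAt_map hz,
    Polynomial.eval₂_mul]

theorem logSeriesAt_C (f : ℂ⟦X⟧) (z l : ℂ) : logSeriesAt (Polynomial.C f) z l = seriesAt f z := by
  rw [logSeriesAt, Polynomial.sum_C_index] <;> simp [seriesAt_zero]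

theorem logSeriesAt_X (z l : ℂ) : logSeriesAt Polynomial.X z l = l := by
  rw [logSeriesAt, Polynomial.sum_X_index] <;> simp [seriesAt_zero, seriesAt_one]

theorem logSeriesAt_smul {z : ℂ} (hz : ‖z‖₊ < R) (l a : ℂ) {p : LogSeries} (hp : p ∈ logSubring R) :
    logSeriesAt (a • p) z l = a * logSeriesAt p z l := by
  rw [smul_eq_C_C_mul, logSeriesAt_mul hz l (C_mem_logSubring.2 (C_mem_discSubring a)) hp, logSeriesAt_C,
    seriesAt_C]

theorem logSeriesAt_pow {z : ℂ} (hz : ‖z‖₊ < R) (l : ℂ) {p : LogSeries} (hp : p ∈ logSubring R)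
    (n : ℕ) : logSeriesAt (p ^ n) z l = logSeriesAt p z l ^ n := by
  obtain ⟨P, rfl⟩ := exists_map_eq_of_mem_logSubring hp
  rw [← Polynomial.map_pow, logSeriesAt_map hz, logSeriesAt_map hz, Polynomial.eval₂_pow]

/-! ### Convergence of the pullback -/

theorem theta_pow_C (n : ℕ) (f : ℂ⟦X⟧) :
    (theta ^ n) (Polynomial.C f) = Polynomial.C (thetaSeries^[n] f) := by
  induction n with
  | zero => simp
  | succ n ih => rw [pow_succ', Module.End.mul_apply, ih, theta_C, Function.iterate_succ_apply']

/-- Logarithmic solutions of `θᴺ⁺¹ p = ∑ cₘ θᵐ p` converge if their coefficients of positive powers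
of the logarithm do. -/
theorem mem_logSubring_of_theta_pow_eq {N : ℕ} {c : Fin (N + 1) → ℂ⟦X⟧} {p : LogSeries}
    (hc0 : ∀ m, PowerSeries.constantCoeff (c m) = 0) (hc : ∀ m, c m ∈ discSubring R)
    (hp : (theta ^ (N + 1)) p = ∑ m : Fin (N + 1), Polynomial.C (c m) * (theta ^ (m : ℕ)) p)
    {q : LogSeries} (hq : q ∈ logSubring R) {f : ℂ⟦X⟧} (hpq : p = q + Polynomial.C f) :
    f ∈ discSubring R := by
  refine mem_discSubring_of_theta_pow_eq hc0 hc (g := (∑ m : Fin (N + 1),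
    Polynomial.C (c m) * (theta ^ (m : ℕ)) q - (theta ^ (N + 1)) q).coeff 0) ?_ ?_
  · exact (sub_mem (sum_mem fun m _ => mul_mem (C_mem_logSubring.2 (hc m))
      (theta_pow_mem_logSubring hq _)) (theta_pow_mem_logSubring hq _) : _ ∈ logSubring R) 0
  · subst hpq
    simp only [map_add, theta_pow_C, mul_add, Finset.sum_add_distrib, ← Polynomial.C_mul] at hp
    have := congrArg (fun p => Polynomial.coeff p 0) hp
    simp only [Polynomial.coeff_add, Polynomial.coeff_C_zero, Polynomial.finsetSum_coeff] at this
    rw [Polynomial.coeff_sub, Polynomial.finsetSum_coeff]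
    linear_combination this

namespace HypergeometricCase

/-- The radius of convergence of `w₀`. -/
def radius (r : HypergeometricCase) : ℝ≥0 := (r.ρ : ℝ≥0)⁻¹

theorem nnnorm_lt_radius {r : HypergeometricCase} (hr : r.IsAdmissible) {z : ℂ}
    (hz : r.ρ * ‖z‖ < 1) : ‖z‖₊ < r.radius := by
  have h := hr.ρ_pos
  rw [radius, ← NNReal.coe_lt_coe, NNReal.coe_inv, NNReal.coe_natCast, coe_nnnorm, ← one_div,
    lt_div_iff₀' h]
  exact hz

theorem geom_mem_discSubring (r : HypergeometricCase) : r.geom ∈ discSubring r.radius := by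
  refine mul_mem (C_mem_discSubring _) (sub_mem (inv_one_sub_mem_discSubring _ ?_) (one_mem _))
  rw [radius]
  exact mul_inv_le_one

theorem pullbackCoeff_mem_discSubring (r : HypergeometricCase) (i : Fin 4) :
    r.pullbackCoeff i ∈ discSubring r.radius := by
  have hD := r.geom_mem_discSubring
  have hS := C_mem_discSubring (R := r.radius) r.expSum
  have hP := C_mem_discSubring (R := r.radius) r.expProd
  have h1 := one_mem (discSubring r.radius)
  have hn := fun (n : ℕ) [n.AtLeastTwo] => ofNat_mem (discSubring r.radius) n
  fin_cases i
  · exact sub_mem (add_mem (add_mem (mul_mem (mul_mem (hn 4) (sub_mem (sub_mem hS h1) hP)) hD)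
      (mul_mem (mul_mem (mul_mem (hn 16) (sub_mem (sub_mem (mul_mem (hn 8) hS) (hn 19))
      (mul_mem hS hS))) hD) hD)) (mul_mem (mul_mem (mul_mem (mul_mem (hn 128)
      (sub_mem (mul_mem (hn 9) hS) (hn 54))) hD) hD) hD))
      (mul_mem (mul_mem (mul_mem (mul_mem (hn 48384) hD) hD) hD) hD)
  · exact sub_mem (add_mem (mul_mem (mul_mem (hn 8) (sub_mem hS h1)) hD)
      (mul_mem (mul_mem (mul_mem (hn 64) (sub_mem hS (hn 4))) hD) hD))
      (mul_mem (mul_mem (mul_mem (hn 2304) hD) hD) hD)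
  · exact sub_mem (mul_mem (mul_mem (hn 8) hS) hD) (mul_mem (mul_mem (hn 32) hD) hD)
  · exact mul_mem (hn 16) hD

/-- Each of f₀, α₁, α₂, α₃ is the log-free part of the next basis element, whose remaining terms use
only the earlier series; so convergence is obtained one series at a time. -/
theorem pullbackBasis_mem_discSubring (r : HypergeometricCase) :
    r.pullbackBasis.f₀ ∈ discSubring r.radius ∧ r.pullbackBasis.α₁ ∈ discSubring r.radius ∧
      r.pullbackBasis.α₂ ∈ discSubring r.radius ∧ r.pullbackBasis.α₃ ∈ discSubring r.radius := by
  have key := fun i {q : LogSeries} hq {f : ℂ⟦X⟧} => mem_logSubring_of_theta_pow_eq (q := q) (f := f)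
    r.constantCoeff_pullbackCoeff
    r.pullbackCoeff_mem_discSubring (r.pullbackBasis_solution i) hq
  have hX := X_mem_logSubring (R := r.radius)
  have h0 := key 0 (zero_mem _) (zero_add _).symm
  have h1 := key 1 (mul_mem (C_mem_logSubring.2 h0) hX) rfl
  have h2 := key 2 (add_mem (smul_mem_logSubring (mul_mem (C_mem_logSubring.2 h0) (pow_mem hX 2)) _)
    (mul_mem (C_mem_logSubring.2 h1) hX)) rfl
  exact ⟨h0, h1, h2, key 3 (add_mem (add_mem
    (smul_mem_logSubring (mul_mem (C_mem_logSubring.2 h0) (pow_mem hX 3)) _)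
    (smul_mem_logSubring (mul_mem (C_mem_logSubring.2 h1) (pow_mem hX 2)) _))
    (mul_mem (C_mem_logSubring.2 h2) hX)) rfl⟩

end HypergeometricCase

/-- A Frobenius basis whose power series converge on the open disc of radius `R`. -/
structure FrobeniusBasis.ConvergesOn (Y : FrobeniusBasis) (R : ℝ≥0) : Prop where
  f₀ : Y.f₀ ∈ discSubring R
  α₁ : Y.α₁ ∈ discSubring R
  α₂ : Y.α₂ ∈ discSubring R
  α₃ : Y.α₃ ∈ discSubring R

theorem FrobeniusBasis.ConvergesOn.y_mem {Y : FrobeniusBasis} (h : Y.ConvergesOn R) (i : Fin 4) :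
    Y.y i ∈ logSubring R := by
  have hX := X_mem_logSubring (R := R)
  have h0 := C_mem_logSubring.2 h.f₀
  have h1 := C_mem_logSubring.2 h.α₁
  have h2 := C_mem_logSubring.2 h.α₂
  have h3 := C_mem_logSubring.2 h.α₃
  fin_cases i
  · exact h0
  · exact add_mem (mul_mem h0 hX) h1
  · exact add_mem (add_mem (smul_mem_logSubring (mul_mem h0 (pow_mem hX 2)) _) (mul_mem h1 hX)) h2
  · exact add_mem (add_mem (add_mem (smul_mem_logSubring (mul_mem h0 (pow_mem hX 3)) _)
      (smul_mem_logSubring (mul_mem h1 (pow_mem hX 2)) _)) (mul_mem h2 hX)) h3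

/-- Nothing is known about where the coefficients of an arbitrary pullback converge; uniqueness
replaces its basis by the explicit one. -/
theorem IsPullback.convergesOn {r : HypergeometricCase} (hr : r.IsAdmissible) {c : Fin 4 → ℂ⟦X⟧}
    {Y : FrobeniusBasis} (h : IsPullback r c Y) : Y.ConvergesOn r.radius := by
  rw [h.unique (HypergeometricCase.exists_isPullback hr)]
  obtain ⟨h0, h1, h2, h3⟩ := r.pullbackBasis_mem_discSubring
  exact ⟨h0, h1, h2, h3⟩

theorem convergesAt_of_mem {f : ℂ⟦X⟧} (hf : f ∈ discSubring R) {z : ℂ} (hz : ‖z‖₊ < R) :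
    ConvergesAt f z :=
  (summable_norm_of_majNorm (majNorm_ne_top_of_mem hf hz)).of_norm

/-! ### Expansions in the exponent -/

/-- One step of comparing Taylor coefficients: the limit at 0 kills p, and then x is divided out.
The division is the reason for the punctured neighbourhood. -/
theorem coeff_eq_zero_of_isBigO {p : ℂ} {g : ℝ → ℂ} {n : ℕ} (hg : ContinuousAt g 0)
    (h : (fun x : ℝ => p + x * g x) =O[𝓝[≠] 0] fun x : ℝ => x ^ (n + 1)) :
    p = 0 ∧ g =O[𝓝[≠] 0] fun x : ℝ => x ^ n := by
  have h0 : Filter.Tendsto (fun x : ℝ => p + x * g x) (𝓝[≠] 0) (𝓝 p) := by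
    have : ContinuousAt (fun x : ℝ => p + x * g x) 0 := by fun_prop
    simpa [ContinuousAt] using this.tendsto.mono_left (nhdsWithin_le_nhds (s := {0}ᶜ))
  have h1 : Filter.Tendsto (fun x : ℝ => x ^ (n + 1)) (𝓝[≠] 0) (𝓝 0) := by
    have : ContinuousAt (fun x : ℝ => x ^ (n + 1)) 0 := by fun_prop
    simpa [ContinuousAt] using this.tendsto.mono_left (nhdsWithin_le_nhds (s := {0}ᶜ))
  have hp : p = 0 := tendsto_nhds_unique h0 (h.trans_tendsto h1)
  refine ⟨hp, ?_⟩
  subst hp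
  obtain ⟨C, hC⟩ := h.bound
  refine Asymptotics.IsBigO.of_bound C ?_
  filter_upwards [hC, self_mem_nhdsWithin] with x hx hx0
  have hx0' : 0 < ‖x‖ := norm_pos_iff.2 hx0
  rw [zero_add, norm_mul, Complex.norm_real, pow_succ, norm_mul] at hx
  refine le_of_mul_le_mul_left ?_ hx0'
  linarith

theorem cubic_coeffs_eq_zero_of_isBigO {p₀ p₁ p₂ p₃ : ℂ}
    (h : (fun x : ℝ => p₀ + p₁ * x + p₂ * x ^ 2 + p₃ * x ^ 3) =O[𝓝 0] fun x : ℝ => x ^ 4) :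
    p₀ = 0 ∧ p₁ = 0 ∧ p₂ = 0 ∧ p₃ = 0 := by
  have h0 : (fun x : ℝ => p₀ + x * (p₁ + x * (p₂ + x * (p₃ + x * 0))))
      =O[𝓝[≠] 0] fun x : ℝ => x ^ 4 := by
    refine (h.mono nhdsWithin_le_nhds).congr_left fun x => ?_
    ring
  obtain ⟨e0, h1⟩ := coeff_eq_zero_of_isBigO (by fun_prop) h0
  obtain ⟨e1, h2⟩ := coeff_eq_zero_of_isBigO (by fun_prop) h1
  obtain ⟨e2, h3⟩ := coeff_eq_zero_of_isBigO (by fun_prop) h2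
  obtain ⟨e3, -⟩ := coeff_eq_zero_of_isBigO (by fun_prop) h3
  exact ⟨e0, e1, e2, e3⟩

/-- The Taylor remainder is controlled by `majNorm δ f` alone, so the bound can be summed over a
whole family of series. -/
theorem norm_seriesAt_sub_le {δ : ℝ≥0} {f : ℂ⟦X⟧} (hδ : 0 < δ) (hf : majNorm δ f ≠ ∞) {x : ℂ}
    (hx : ‖x‖ ≤ δ) (N : ℕ) :
    ‖seriesAt f x - ∑ i ∈ Finset.range N, PowerSeries.coeff i f * x ^ i‖ ≤
      (majNorm δ f).toReal * (‖x‖ / δ) ^ N := by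
  have hδ' : (0 : ℝ) < δ := hδ
  have hx' : ‖x‖ₑ ≤ δ := by
    rw [enorm_eq_nnnorm]; exact_mod_cast hx
  have hs := summable_norm_of_majNorm
    (((majNorm_mono hx' f).trans_lt hf.lt_top).ne)
  have hsδ : Summable fun n => ‖PowerSeries.coeff n f‖ * (δ : ℝ) ^ n := by
    refine (ENNReal.summable_toReal hf).congr fun n => ?_
    simp
  have htsum : (majNorm δ f).toReal = ∑' n, ‖PowerSeries.coeff n f‖ * (δ : ℝ) ^ n := by
    rw [majNorm, ENNReal.tsum_toReal_eq]
    · simp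
    · intro n; exact ENNReal.mul_ne_top enorm_ne_top (by simp)
  rw [seriesAt, ← hs.of_norm.sum_add_tsum_nat_add N, add_sub_cancel_left]
  have hs' := (summable_nat_add_iff N).2 hs
  refine (norm_tsum_le_tsum_norm hs').trans ?_
  have hle : ∀ n, ‖PowerSeries.coeff (n + N) f * x ^ (n + N)‖ ≤
      (‖PowerSeries.coeff (n + N) f‖ * (δ : ℝ) ^ (n + N)) * (‖x‖ / δ) ^ N := fun n => by
    rw [norm_mul, norm_pow, mul_assoc]
    gcongr
    rw [pow_add, pow_add, div_pow, mul_assoc, mul_div_cancel₀ _ (by positivity)]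
    gcongr
  have hsδ' := (summable_nat_add_iff N).2 hsδ
  refine (hs'.tsum_le_tsum hle (hsδ'.mul_right _)).trans ?_
  rw [tsum_mul_right, htsum]
  refine mul_le_mul_of_nonneg_right ?_ (by positivity)
  rw [← hsδ.sum_add_tsum_nat_add N]
  exact le_add_of_nonneg_left (Finset.sum_nonneg fun n _ => by positivity)

/-- Termwise Taylor expansion of a series of power series. -/
theorem tsum_seriesAt_isBigO {δ : ℝ≥0} (hδ : 0 < δ) {H : ℕ → ℂ⟦X⟧} {z : ℂ} {M : ℕ → ℝ}
    (hM0 : ∀ n, 0 ≤ M n) (hH : ∀ n, majNorm δ (H n) ≤ ENNReal.ofReal (M n))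
    (hM : Summable fun n => M n * ‖z‖ ^ n) (N : ℕ) :
    (fun x : ℝ => ∑' n, seriesAt (H n) x * z ^ n -
      ∑ i ∈ Finset.range N, (∑' n, PowerSeries.coeff i (H n) * z ^ n) * (x : ℂ) ^ i)
      =O[𝓝 0] fun x : ℝ => x ^ N := by
  have hδ' : (0 : ℝ) < δ := hδ
  have htop : ∀ n, majNorm δ (H n) ≠ ∞ := fun n => ((hH n).trans_lt ENNReal.ofReal_lt_top).ne
  have hle : ∀ n, (majNorm δ (H n)).toReal ≤ M n := fun n =>
    ENNReal.toReal_le_of_le_ofReal (hM0 n) (hH n)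
  have hcoeff : ∀ i, Summable fun n => PowerSeries.coeff i (H n) * z ^ n := by
    intro i
    refine Summable.of_norm_bounded (g := fun n => (M n * ‖z‖ ^ n) / (δ : ℝ) ^ i) (hM.div_const _) fun n => ?_
    rw [le_div_iff₀ (by positivity), norm_mul, norm_pow]
    have := ENNReal.toReal_mono ENNReal.ofReal_ne_top
      ((enorm_coeff_mul_le_majNorm δ (H n) i).trans (hH n))
    rw [ENNReal.toReal_ofReal (hM0 n)] at this
    simp only [ENNReal.toReal_mul, toReal_enorm, ENNReal.toReal_pow, ENNReal.coe_toReal] at this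
    calc _ = (‖PowerSeries.coeff i (H n)‖ * (δ : ℝ) ^ i) * ‖z‖ ^ n := by ring
      _ ≤ _ := by gcongr
  have hterm : ∀ x : ℝ, ‖x‖ ≤ δ → ∀ n, ‖(seriesAt (H n) x -
      ∑ i ∈ Finset.range N, PowerSeries.coeff i (H n) * (x : ℂ) ^ i) * z ^ n‖ ≤
      (M n * ‖z‖ ^ n) * (‖x‖ / δ) ^ N := by
    intro x hx n
    rw [norm_mul, norm_pow]
    have := norm_seriesAt_sub_le hδ (htop n) (x := x) (by rwa [Complex.norm_real]) N
    rw [Complex.norm_real] at this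
    calc _ ≤ (M n * (‖x‖ / δ) ^ N) * ‖z‖ ^ n := by
          gcongr
          exact this.trans (by gcongr; exact hle n)
      _ = _ := by ring
  refine Asymptotics.IsBigO.of_bound ((∑' n, M n * ‖z‖ ^ n) / (δ : ℝ) ^ N) ?_
  filter_upwards [Metric.closedBall_mem_nhds (0 : ℝ) hδ'] with x hx
  rw [mem_closedBall_zero_iff] at hx
  have hsub : Summable fun n => (seriesAt (H n) x -
      ∑ i ∈ Finset.range N, PowerSeries.coeff i (H n) * (x : ℂ) ^ i) * z ^ n :=
    Summable.of_norm_bounded (hM.mul_right _) (hterm x hx)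
  have hsum : Summable fun n => (∑ i ∈ Finset.range N,
      PowerSeries.coeff i (H n) * (x : ℂ) ^ i) * z ^ n := by
    simp_rw [Finset.sum_mul]
    refine summable_sum fun i _ => ?_
    refine ((hcoeff i).mul_right ((x : ℂ) ^ i)).congr fun n => by ring
  have e1 : ∑' n, seriesAt (H n) x * z ^ n = ∑' n, (seriesAt (H n) x -
      ∑ i ∈ Finset.range N, PowerSeries.coeff i (H n) * (x : ℂ) ^ i) * z ^ n +
      ∑' n, (∑ i ∈ Finset.range N, PowerSeries.coeff i (H n) * (x : ℂ) ^ i) * z ^ n := by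
    rw [← hsub.tsum_add hsum]
    refine tsum_congr fun n => by ring
  have e2 : ∑' n, (∑ i ∈ Finset.range N, PowerSeries.coeff i (H n) * (x : ℂ) ^ i) * z ^ n =
      ∑ i ∈ Finset.range N, (∑' n, PowerSeries.coeff i (H n) * z ^ n) * (x : ℂ) ^ i := by
    simp_rw [Finset.sum_mul]
    rw [Summable.tsum_finsetSum fun i _ =>
      ((hcoeff i).mul_right ((x : ℂ) ^ i)).congr fun n => by ring]
    refine Finset.sum_congr rfl fun i _ => ?_
    rw [← tsum_mul_right]
    refine tsum_congr fun n => by ring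
  rw [e1, e2, add_sub_cancel_right]
  refine (tsum_of_norm_bounded ((hM.mul_right _).hasSum) (hterm x hx)).trans ?_
  rw [tsum_mul_right, norm_pow, div_pow]
  apply le_of_eq; ring

/-- The expansion of `exp (l x)`. -/
def expSeries' (l : ℂ) : ℂ⟦X⟧ := PowerSeries.mk fun i => l ^ i / (i.factorial : ℂ)

theorem seriesAt_expSeries' (l x : ℂ) : seriesAt (expSeries' l) x = Complex.exp (l * x) := by
  rw [Complex.exp_eq_exp_ℂ, NormedSpace.exp_eq_tsum_div, seriesAt]
  refine tsum_congr fun n => ?_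
  rw [expSeries', PowerSeries.coeff_mk, mul_pow]; ring

theorem majNorm_expSeries'_ne_top (l : ℂ) (δ : ℝ≥0) : majNorm δ (expSeries' l) ≠ ∞ := by
  have h := (Real.summable_pow_div_factorial (‖l‖ * δ)).tsum_ofReal_ne_top
  rw [majNorm]
  convert h using 4 with n
  rw [expSeries', PowerSeries.coeff_mk, mul_pow, mul_div_right_comm, ENNReal.ofReal_mul (by positivity),
    ENNReal.ofReal_pow (by positivity), ENNReal.ofReal_coe_nnreal, ← ofReal_norm, norm_div, norm_pow,
    Complex.norm_natCast]

/-- With z^x read as exp(lx), the i-th Frobenius series is the coefficient of xⁱ in ∑ gₙ(x) exp(lx)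
zⁿ. The factorials in `frob` are those of the exponential. -/
theorem logSeriesAt_frob (g : ℕ → ℂ⟦X⟧) (i : ℕ) (z l : ℂ)
    (hg : ∀ m, Summable fun n => PowerSeries.coeff m (g n) * z ^ n) :
    logSeriesAt (frob g i) z l = ∑' n, PowerSeries.coeff i (g n * expSeries' l) * z ^ n := by
  have hdeg : (frob g i).natDegree < i + 1 := by
    refine Nat.lt_succ_of_le (Polynomial.natDegree_le_iff_coeff_eq_zero.2 fun m hm => ?_)
    ext n
    rw [coeff_coeff_frob, if_neg (by omega)]; simp
  rw [logSeriesAt, Polynomial.sum_over_range' _ (by simp [seriesAt_zero]) _ hdeg]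
  have h1 : ∀ m ∈ Finset.range (i + 1), seriesAt ((frob g i).coeff m) z * l ^ m =
      ∑' n, PowerSeries.coeff (i - m) (g n) * (l ^ m / (m.factorial : ℂ)) * z ^ n := by
    intro m hm
    rw [seriesAt, ← tsum_mul_right]
    refine tsum_congr fun n => ?_
    rw [coeff_coeff_frob, if_pos (by simpa [Nat.lt_succ_iff] using hm)]; ring
  rw [Finset.sum_congr rfl h1, ← Summable.tsum_finsetSum fun m _ =>
    ((hg (i - m)).mul_right (l ^ m / (m.factorial : ℂ))).congr fun n => by ring]
  refine tsum_congr fun n => ?_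
  rw [PowerSeries.coeff_mul, ← Finset.Nat.sum_antidiagonal_swap,
    Finset.Nat.sum_antidiagonal_eq_sum_range_succ_mk, Finset.sum_mul]
  refine Finset.sum_congr rfl fun m _ => ?_
  simp [expSeries']

/-! ### The expansion of the hypergeometric series in the exponent -/

theorem majNorm_linear_le {a : ℂ} {b : ℝ} (hb : 0 ≤ b) (ha : ‖a‖ ≤ b) :
    majNorm (1 / 2 : ℝ≥0) (PowerSeries.C a + PowerSeries.X) ≤ ENNReal.ofReal (b + 1 / 2) := by
  refine (majNorm_add_le _ _ _).trans ?_
  rw [majNorm_C, majNorm_X, ENNReal.ofReal_add hb (by norm_num), ← ofReal_norm]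
  gcongr
  rw [← ENNReal.ofReal_coe_nnreal]; norm_num

/-- The radius 1/2 in x stays away from the pole at -(n+1) uniformly in n, and the geometric series
of absolute values sums to 1/(n + 1 - 1/2). -/
theorem majNorm_invLinear_le (n : ℕ) :
    majNorm (1 / 2 : ℝ≥0) (invLinear (n + 1)) ≤ ENNReal.ofReal (((n : ℝ) + 1 / 2)⁻¹) := by
  have hn : (0 : ℝ) < (n : ℝ) + 1 := by positivity
  have hlt : (1 / 2 : ℝ) / (n + 1) < 1 := by
    rw [div_lt_one hn]; have : (0 : ℝ) ≤ n := n.cast_nonneg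
    linarith
  have hs := summable_geometric_of_lt_one (r := (1 / 2 : ℝ) / (n + 1)) (by positivity) hlt
  have h2 : ((n : ℝ) + 1 / 2)⁻¹ = ∑' i : ℕ, ((n : ℝ) + 1)⁻¹ * ((1 / 2 : ℝ) / (n + 1)) ^ i := by
    rw [tsum_mul_left, tsum_geometric_of_lt_one (by positivity) hlt, ← mul_inv]
    congr 1; field_simp; ring
  rw [h2, ENNReal.ofReal_tsum_of_nonneg (fun i => by positivity) (hs.mul_left _), majNorm]
  refine ENNReal.tsum_le_tsum fun i => le_of_eq ?_
  have hnn : ‖(n : ℂ) + 1‖ = (n : ℝ) + 1 := by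
    have : ((n : ℂ) + 1) = ((n + 1 : ℕ) : ℂ) := by push_cast; ring
    rw [this, Complex.norm_natCast]; push_cast; ring
  rw [invLinear, PowerSeries.coeff_mk, ← ofReal_norm, norm_div, norm_pow, norm_pow, hnn, norm_neg,
    norm_one, one_pow, ← ENNReal.ofReal_coe_nnreal, ← ENNReal.ofReal_pow (by positivity),
    ← ENNReal.ofReal_mul (by positivity)]
  congr 1
  push_cast
  rw [div_pow (1 / 2 : ℝ) ((n : ℝ) + 1) i, pow_succ]
  field_simp

theorem majNorm_mul_le_of_le {r : ℝ≥0∞} {f g : ℂ⟦X⟧} {a b : ℝ} (ha : 0 ≤ a)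
    (hf : majNorm r f ≤ ENNReal.ofReal a) (hg : majNorm r g ≤ ENNReal.ofReal b) :
    majNorm r (f * g) ≤ ENNReal.ofReal (a * b) := by
  rw [ENNReal.ofReal_mul ha]
  exact (majNorm_mul_le _ _ _).trans (by gcongr)

theorem majNorm_pow_le_of_le {r : ℝ≥0∞} {f : ℂ⟦X⟧} {a : ℝ} (ha : 0 ≤ a)
    (hf : majNorm r f ≤ ENNReal.ofReal a) (n : ℕ) :
    majNorm r (f ^ n) ≤ ENNReal.ofReal (a ^ n) := by
  induction n with
  | zero => simp [majNorm_one]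
  | succ n ih => rw [pow_succ, pow_succ]; exact majNorm_mul_le_of_le (by positivity) ih hf

theorem tendsto_add_div_add (a b : ℝ) :
    Filter.Tendsto (fun n : ℕ => ((n : ℝ) + a) / (n + b)) Filter.atTop (𝓝 1) := by
  have h1 : Filter.Tendsto (fun n : ℕ => (n : ℝ) + b) Filter.atTop Filter.atTop :=
    Filter.tendsto_atTop_add_const_right _ _ tendsto_natCast_atTop_atTop
  have h2 : Filter.Tendsto (fun n : ℕ => 1 + (a - b) / ((n : ℝ) + b)) Filter.atTop (𝓝 1) := by
    simpa using (h1.const_div_atTop (a - b)).const_add 1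
  refine h2.congr' ?_
  filter_upwards [h1.eventually_gt_atTop 0] with n hn
  field_simp
  ring

namespace HypergeometricCase

variable {r : HypergeometricCase}

/-- The factors of `hypBound`. -/
def hypRatio (r : HypergeometricCase) (n : ℕ) : ℝ :=
  ((n : ℝ) + 1 / 2)⁻¹ ^ 5 * (r.ρ * (((n : ℝ) + 1 / 2 + 1 / 2) * ((n : ℝ) + r.s₁ + 1 / 2) *
    ((n : ℝ) + (1 - r.s₁) + 1 / 2) * ((n : ℝ) + r.s₂ + 1 / 2) * ((n : ℝ) + (1 - r.s₂) + 1 / 2)))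

/-- A bound for the norm of `hypCoeff`. -/
def hypBound (r : HypergeometricCase) : ℕ → ℝ
  | 0 => 1
  | n + 1 => r.hypRatio n * r.hypBound n

theorem hypRatio_pos (hr : r.IsAdmissible) (n : ℕ) : 0 < r.hypRatio n := by
  have h1 := hr.s₁_pos
  have h2 := hr.s₂_pos
  have h3 := sub_pos.2 hr.s₁_lt
  have h4 := sub_pos.2 hr.s₂_lt
  have h5 := hr.ρ_pos
  unfold hypRatio
  positivity

theorem hypBound_pos (hr : r.IsAdmissible) (n : ℕ) : 0 < r.hypBound n := by
  induction n with
  | zero => exact one_pos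
  | succ n ih => exact mul_pos (hypRatio_pos hr n) ih

theorem majNorm_hypCoeff_le (hr : r.IsAdmissible) (n : ℕ) :
    majNorm (1 / 2 : ℝ≥0) (r.hypCoeff n) ≤ ENNReal.ofReal (r.hypBound n) := by
  have h1 := hr.s₁_pos
  have h2 := hr.s₂_pos
  have h3 := sub_pos.2 hr.s₁_lt
  have h4 := sub_pos.2 hr.s₂_lt
  have h5 := hr.ρ_pos
  induction n with
  | zero => simp [hypCoeff, hypBound, majNorm_one]
  | succ n ih =>
    have key : ∀ s : ℝ, 0 < s → majNorm (1 / 2 : ℝ≥0)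
        (PowerSeries.C ((n : ℂ) + (s : ℂ)) + PowerSeries.X) ≤ ENNReal.ofReal ((n : ℝ) + s + 1 / 2) :=
      fun s hs => majNorm_linear_le (by positivity) (by
        rw [← Complex.ofReal_natCast, ← Complex.ofReal_add, Complex.norm_real,
          Real.norm_of_nonneg (by positivity)])
    have k0 := key (1 / 2) (by norm_num)
    have k1 := key _ h1
    have k2 := key _ h2
    have k3 := key _ h3
    have k4 := key _ h4
    simp only [Complex.ofReal_sub, Complex.ofReal_one, Complex.ofReal_ratCast, Complex.ofReal_div,
      Complex.ofReal_ofNat] at k0 k1 k2 k3 k4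
    have kρ : majNorm (1 / 2 : ℝ≥0) (PowerSeries.C (r.ρ : ℂ)) ≤ ENNReal.ofReal (r.ρ : ℝ) := by
      rw [majNorm_C, ← ofReal_norm, Complex.norm_natCast]
    rw [hypCoeff, hypBound, hypRatio, hypNumerator, ← mul_assoc (invLinear _ ^ 5)]
    refine majNorm_mul_le_of_le (by positivity) (majNorm_mul_le_of_le (by positivity)
      (majNorm_pow_le_of_le (by positivity) (majNorm_invLinear_le n) 5)
      (majNorm_mul_le_of_le (by positivity) kρ (majNorm_mul_le_of_le (by positivity)
      (majNorm_mul_le_of_le (by positivity) (majNorm_mul_le_of_le (by positivity)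
      (majNorm_mul_le_of_le (by positivity) k0 k1) k3) k2) k4))) ih

theorem tendsto_hypRatio (r : HypergeometricCase) :
    Filter.Tendsto r.hypRatio Filter.atTop (𝓝 r.ρ) := by
  have key := fun a => tendsto_add_div_add a (1 / 2)
  have h := (((((key (1 / 2 + 1 / 2)).mul (key (r.s₁ + 1 / 2))).mul (key ((1 - r.s₁) + 1 / 2))).mul
    (key (r.s₂ + 1 / 2))).mul (key ((1 - r.s₂) + 1 / 2))).const_mul (r.ρ : ℝ)
  simp only [mul_one] at h
  refine h.congr fun n => ?_
  rw [hypRatio]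
  simp only [div_eq_mul_inv]
  ring

/-- The ratio of consecutive terms tends to ρ|z| < 1. The factor (n+1)² is there to absorb the
quadratic polynomial in n + x. -/
theorem summable_hypBound (hr : r.IsAdmissible) {z : ℂ} (hz : r.ρ * ‖z‖ < 1) (hz0 : z ≠ 0) :
    Summable fun n => r.hypBound n * ((n : ℝ) + 1) ^ 2 * ‖z‖ ^ n := by
  have hz' : 0 < ‖z‖ := norm_pos_iff.2 hz0
  refine summable_of_ratio_test_tendsto_lt_one (l := r.ρ * (1 : ℝ) ^ 2 * ‖z‖) (by simpa using hz)
    (Filter.Eventually.of_forall fun n => ?_) ?_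
  · have := hypBound_pos hr n
    positivity
  · refine ((r.tendsto_hypRatio.mul ((tendsto_add_div_add 2 1).pow 2)).mul_const ‖z‖).congr fun n => ?_
    have h1 := hypBound_pos hr n
    have h2 := hypRatio_pos hr n
    rw [Real.norm_of_nonneg (by rw [hypBound]; positivity), Real.norm_of_nonneg (by positivity),
      hypBound, pow_succ ‖z‖]
    push_cast
    field_simp
    ring

/-- Both sides equal A_x at n = 0 and obey the same recurrence in n, whose factor (n+1+x)⁵ is
nonzero for these x. -/
theorem seriesAt_hypCoeff (hr : r.IsAdmissible) {x : ℝ} (hx : |x| < 1 / 12) (n : ℕ) :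
    (r.A (n + x) : ℂ) = r.A x * seriesAt (r.hypCoeff n) x := by
  have hx1 := (abs_lt.1 hx).1
  have hxe : ‖(x : ℂ)‖ₑ ≤ (1 / 2 : ℝ≥0) := by
    rw [enorm_eq_nnnorm]
    have : ‖(x : ℂ)‖₊ ≤ 1 / 2 := by
      rw [← NNReal.coe_le_coe]
      push_cast
      rw [Complex.norm_real, Real.norm_eq_abs]
      linarith
    exact_mod_cast this
  have fin : ∀ {f : ℂ⟦X⟧} {a : ℝ}, majNorm (1 / 2 : ℝ≥0) f ≤ ENNReal.ofReal a →
      majNorm ‖(x : ℂ)‖ₑ f ≠ ∞ := fun h =>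
    ((majNorm_mono hxe _).trans_lt (h.trans_lt ENNReal.ofReal_lt_top)).ne
  have hlin : ∀ a : ℂ, majNorm ‖(x : ℂ)‖ₑ (PowerSeries.C a + PowerSeries.X) ≠ ∞ := fun a =>
    fin (majNorm_linear_le (norm_nonneg a) le_rfl)
  have hmul : ∀ {f g : ℂ⟦X⟧}, majNorm ‖(x : ℂ)‖ₑ f ≠ ∞ → majNorm ‖(x : ℂ)‖ₑ g ≠ ∞ →
      majNorm ‖(x : ℂ)‖ₑ (f * g) ≠ ∞ := fun hf hg =>
    ((majNorm_mul_le _ _ _).trans_lt (ENNReal.mul_lt_top hf.lt_top hg.lt_top)).ne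
  have hC : ∀ a : ℂ, majNorm ‖(x : ℂ)‖ₑ (PowerSeries.C a) ≠ ∞ := fun a => by
    rw [majNorm_C]; exact enorm_ne_top
  have hX : majNorm ‖(x : ℂ)‖ₑ PowerSeries.X ≠ ∞ := by rw [majNorm_X]; exact enorm_ne_top
  have elin : ∀ a : ℂ, seriesAt (PowerSeries.C a + PowerSeries.X) x = a + x := fun a => by
    rw [seriesAt_add (hC a) hX, seriesAt_C, seriesAt_X]
  induction n with
  | zero => simp [hypCoeff, seriesAt_one]
  | succ n ih =>
    have hn : (0 : ℝ) ≤ n := n.cast_nonneg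
    have hA := congrArg ((↑) : ℝ → ℂ) (A_add_one hr (y := n + x) (by linarith))
    have hrec := congrArg (fun f => seriesAt f x) (r.pow_mul_hypCoeff_succ n)
    have hcast : (((n + 1 : ℕ) : ℂ⟦X⟧) + PowerSeries.X) = PowerSeries.C ((n : ℂ) + 1) + PowerSeries.X := by
      simp
    have hpow : ∀ k, majNorm ‖(x : ℂ)‖ₑ ((PowerSeries.C ((n : ℂ) + 1) + PowerSeries.X) ^ k) ≠ ∞ ∧
        seriesAt ((PowerSeries.C ((n : ℂ) + 1) + PowerSeries.X) ^ k) x = ((n : ℂ) + 1 + x) ^ k := by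
      intro k
      induction k with
      | zero => simp [majNorm_one, seriesAt_one]
      | succ k ihk =>
        rw [pow_succ]
        exact ⟨hmul ihk.1 (hlin _), by rw [seriesAt_mul ihk.1 (hlin _), ihk.2, elin, pow_succ]⟩
    have m1 := hmul (hlin ((n : ℂ) + 1 / 2)) (hlin ((n : ℂ) + r.s₁))
    have m2 := hmul m1 (hlin ((n : ℂ) + (1 - r.s₁)))
    have m3 := hmul m2 (hlin ((n : ℂ) + r.s₂))
    have m4 := hmul m3 (hlin ((n : ℂ) + (1 - r.s₂)))
    have hh := fun n => fin (majNorm_hypCoeff_le hr n)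
    rw [hcast, seriesAt_mul (hpow 5).1 (hh _), (hpow 5).2, hypNumerator,
      seriesAt_mul (hmul (hC _) m4) (hh _), seriesAt_mul (hC _) m4, seriesAt_mul m3 (hlin _),
      seriesAt_mul m2 (hlin _), seriesAt_mul m1 (hlin _), seriesAt_mul (hlin _) (hlin _),
      seriesAt_C] at hrec
    simp only [elin] at hrec
    have hne : ((n : ℂ) + 1 + x) ^ 5 ≠ 0 := by
      refine pow_ne_zero _ ?_
      have : (n : ℝ) + 1 + x ≠ 0 := by linarith
      exact_mod_cast this
    refine mul_right_cancel₀ hne ?_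
    have e : ((n + 1 : ℕ) : ℝ) + x = n + x + 1 := by push_cast; ring
    rw [e]
    push_cast at hA
    linear_combination hA - r.A x * hrec + (r.ρ * ((n + x + 1 / 2) * (n + x + r.s₁) *
      (n + x + (1 - r.s₁)) * (n + x + r.s₂) * (n + x + (1 - r.s₂)))) * ih

/-- The operator `a + b θ + c θ²`. -/
def _root_.quadraticTheta (a b c : ℂ) (p : LogSeries) : LogSeries :=
  a • p + b • theta p + c • theta (theta p)

theorem _root_.quadraticTheta_frob (a b c : ℂ) (g : ℕ → ℂ⟦X⟧) (i : ℕ) :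
    quadraticTheta a b c (frob g i) = frob (fun n =>
      (PowerSeries.C a + PowerSeries.C b * (PowerSeries.C (n : ℂ) + PowerSeries.X) +
        PowerSeries.C c * (PowerSeries.C (n : ℂ) + PowerSeries.X) ^ 2) * g n) i := by
  rw [quadraticTheta, theta_frob, theta_frob, ← frob_smul, ← frob_smul, ← frob_smul, ← frob_add,
    ← frob_add]
  congr 1; ext1 n
  simp only [PowerSeries.smul_eq_C_mul, map_natCast]; ring

/-- The expansion in `x` of `∑ A_{n+x} (a + b (n + x) + c (n + x)²) z^{n+x}`. -/
theorem tsum_A_isBigO (hr : r.IsAdmissible) (a b c : ℂ) {z u l : ℂ} (hz : r.ρ * ‖z‖ < 1)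
    (hzl : z = u * Complex.exp l) (hu : u ≠ 0) :
    ∃ S : ℝ → ℂ, (∀ x : ℝ, |x| < 1 / 12 →
      ∑' n : ℕ, (r.A (n + x) : ℂ) * (a + b * (n + x) + c * (n + x) ^ 2) *
        (u ^ n * Complex.exp ((n + x) * l)) = r.A x * S x) ∧
      (fun x : ℝ => S x - ∑ i ∈ Finset.range 4,
        logSeriesAt (quadraticTheta a b c (frob r.hypCoeff i)) z l * (x : ℂ) ^ i)
        =O[𝓝 0] fun x : ℝ => x ^ 4 := by
  have hz0 : z ≠ 0 := by rw [hzl]; exact mul_ne_zero hu (Complex.exp_ne_zero _)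
  set Q : ℕ → ℂ⟦X⟧ := fun n =>
      (PowerSeries.C a + PowerSeries.C b * (PowerSeries.C (n : ℂ) + PowerSeries.X) +
        PowerSeries.C c * (PowerSeries.C (n : ℂ) + PowerSeries.X) ^ 2) with hQ
  set B : ℝ := ‖a‖ + ‖b‖ + ‖c‖ with hB
  have hC : ∀ (r : ℝ≥0∞) (a : ℂ), majNorm r (PowerSeries.C a) ≤ ENNReal.ofReal ‖a‖ := fun r a => by
    rw [majNorm_C, ofReal_norm]
  have hQB : ∀ n, majNorm (1 / 2 : ℝ≥0) (Q n) ≤ ENNReal.ofReal (B * ((n : ℝ) + 1) ^ 2) := by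
    intro n
    have hn : (0 : ℝ) ≤ n := n.cast_nonneg
    have h1 : majNorm (1 / 2 : ℝ≥0) (PowerSeries.C (n : ℂ) + PowerSeries.X) ≤
        ENNReal.ofReal ((n : ℝ) + 1) :=
      (majNorm_linear_le hn (by rw [Complex.norm_natCast])).trans
        (ENNReal.ofReal_le_ofReal (by linarith))
    have h2 := majNorm_mul_le_of_le (norm_nonneg b) (hC _ b) h1
    have h3 := majNorm_mul_le_of_le (norm_nonneg c) (hC _ c) (majNorm_pow_le_of_le (by positivity) h1 2)
    refine (majNorm_add_le _ _ _).trans ((add_le_add ((majNorm_add_le _ _ _).trans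
      (add_le_add (hC _ a) h2)) h3).trans ?_)
    rw [← ENNReal.ofReal_add (by positivity) (by positivity), ← ENNReal.ofReal_add (by positivity)
      (by positivity)]
    refine ENNReal.ofReal_le_ofReal ?_
    have hn1 : (1 : ℝ) ≤ (n : ℝ) + 1 := by linarith
    have hn2 : (1 : ℝ) ≤ ((n : ℝ) + 1) ^ 2 := one_le_pow₀ hn1
    have hn3 : (n : ℝ) + 1 ≤ ((n : ℝ) + 1) ^ 2 := by nlinarith
    rw [hB, add_mul, add_mul]
    gcongr
    exact le_mul_of_one_le_right (norm_nonneg a) hn2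
  set E := (majNorm (1 / 2 : ℝ≥0) (expSeries' l)).toReal with hE
  have hEx : majNorm (1 / 2 : ℝ≥0) (expSeries' l) ≤ ENNReal.ofReal E := by
    rw [hE, ENNReal.ofReal_toReal (majNorm_expSeries'_ne_top l _)]
  set H : ℕ → ℂ⟦X⟧ := fun n => Q n * r.hypCoeff n * expSeries' l with hH
  set M : ℕ → ℝ := fun n => B * ((n : ℝ) + 1) ^ 2 * r.hypBound n * E with hM
  have hB0 : 0 ≤ B := by positivity
  have hE0 : 0 ≤ E := ENNReal.toReal_nonneg
  have hbp := hypBound_pos hr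
  have hM0 : ∀ n, 0 ≤ M n := fun n => by
    have := hbp n
    positivity
  have hQA : ∀ n, majNorm (1 / 2 : ℝ≥0) (Q n * r.hypCoeff n) ≤
      ENNReal.ofReal (B * ((n : ℝ) + 1) ^ 2 * r.hypBound n) := fun n =>
    majNorm_mul_le_of_le (by positivity) (hQB n) (majNorm_hypCoeff_le hr n)
  have hHM : ∀ n, majNorm (1 / 2 : ℝ≥0) (H n) ≤ ENNReal.ofReal (M n) := fun n => by
    have := hbp n
    exact majNorm_mul_le_of_le (by positivity) (hQA n) hEx
  have hsum0 := summable_hypBound hr hz hz0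
  have hMs : Summable fun n => M n * ‖z‖ ^ n :=
    (hsum0.mul_left (B * E)).congr fun n => by simp only [hM]; ring
  refine ⟨fun x => ∑' n, seriesAt (H n) x * z ^ n, fun x hx => ?_, ?_⟩
  · rw [← tsum_mul_left]
    refine tsum_congr fun n => ?_
    have hxe : ‖(x : ℂ)‖ₑ ≤ (1 / 2 : ℝ≥0) := by
      rw [enorm_eq_nnnorm]
      have : ‖(x : ℂ)‖₊ ≤ 1 / 2 := by
        rw [← NNReal.coe_le_coe]
        push_cast
        rw [Complex.norm_real, Real.norm_eq_abs]
        linarith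
      exact_mod_cast this
    have fin : ∀ {f : ℂ⟦X⟧} {a : ℝ}, majNorm (1 / 2 : ℝ≥0) f ≤ ENNReal.ofReal a →
        majNorm ‖(x : ℂ)‖ₑ f ≠ ∞ := fun h =>
      ((majNorm_mono hxe _).trans_lt (h.trans_lt ENNReal.ofReal_lt_top)).ne
    have hlin := fin (majNorm_linear_le (norm_nonneg (n : ℂ)) le_rfl)
    have hmul : ∀ {f g : ℂ⟦X⟧}, majNorm ‖(x : ℂ)‖ₑ f ≠ ∞ → majNorm ‖(x : ℂ)‖ₑ g ≠ ∞ →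
        majNorm ‖(x : ℂ)‖ₑ (f * g) ≠ ∞ := fun hf hg =>
      ((majNorm_mul_le _ _ _).trans_lt (ENNReal.mul_lt_top hf.lt_top hg.lt_top)).ne
    have hadd : ∀ {f g : ℂ⟦X⟧}, majNorm ‖(x : ℂ)‖ₑ f ≠ ∞ → majNorm ‖(x : ℂ)‖ₑ g ≠ ∞ →
        majNorm ‖(x : ℂ)‖ₑ (f + g) ≠ ∞ := fun hf hg =>
      ((majNorm_add_le _ _ _).trans_lt (ENNReal.add_lt_top.2 ⟨hf.lt_top, hg.lt_top⟩)).ne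
    have hC' : ∀ a : ℂ, majNorm ‖(x : ℂ)‖ₑ (PowerSeries.C a) ≠ ∞ := fun a => fin (hC _ a)
    have hX : majNorm ‖(x : ℂ)‖ₑ PowerSeries.X ≠ ∞ := by rw [majNorm_X]; exact enorm_ne_top
    have h2 : (PowerSeries.C (n : ℂ) + PowerSeries.X) ^ 2 =
        (PowerSeries.C (n : ℂ) + PowerSeries.X) * (PowerSeries.C (n : ℂ) + PowerSeries.X) := sq _
    have eQ : seriesAt (Q n) x = a + b * (n + x) + c * (n + x) ^ 2 := by
      simp only [hQ]
      rw [h2, seriesAt_add (hadd (hC' a) (hmul (hC' b) hlin)) (hmul (hC' c) (hmul hlin hlin)),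
        seriesAt_add (hC' a) (hmul (hC' b) hlin), seriesAt_mul (hC' b) hlin,
        seriesAt_mul (hC' c) (hmul hlin hlin), seriesAt_mul hlin hlin, seriesAt_add (hC' _) hX]
      simp only [seriesAt_C, seriesAt_X]
      ring
    have hexp : Complex.exp ((n + x) * l) = Complex.exp l ^ n * Complex.exp (l * x) := by
      rw [← Complex.exp_nat_mul, ← Complex.exp_add]; congr 1; ring
    simp only [hH]
    rw [seriesAt_mul (fin (hQA n)) (fin hEx), seriesAt_mul (fin (hQB n))
      (fin (majNorm_hypCoeff_le hr n)), eQ, seriesAt_expSeries', seriesAt_hypCoeff hr hx, hexp, hzl,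
      mul_pow]
    ring
  · have key := tsum_seriesAt_isBigO (δ := 1 / 2) (by norm_num) hM0 hHM hMs 4
    refine key.congr_left fun x => ?_
    congr 1
    refine Finset.sum_congr rfl fun i _ => ?_
    congr 1
    rw [quadraticTheta_frob, logSeriesAt_frob]
    intro m
    have hs2 : Summable fun n : ℕ => (B * ((n : ℝ) + 1) ^ 2 * r.hypBound n) * ‖z‖ ^ n :=
      (hsum0.mul_left B).congr fun n => by ring
    refine Summable.of_norm_bounded (hs2.mul_left (2 ^ m)) fun n => ?_
    have hb := hbp n
    have h3 := ENNReal.toReal_mono ENNReal.ofReal_ne_top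
      ((enorm_coeff_mul_le_majNorm (1 / 2 : ℝ≥0) (Q n * r.hypCoeff n) m).trans (hQA n))
    rw [ENNReal.toReal_ofReal (by positivity)] at h3
    simp only [ENNReal.toReal_mul, toReal_enorm, ENNReal.toReal_pow, ENNReal.coe_toReal] at h3
    push_cast at h3
    rw [norm_mul, norm_pow, ← mul_assoc]
    gcongr
    have h2 : (2 : ℝ) ^ m * (1 / 2) ^ m = 1 := by rw [← mul_pow]; norm_num
    calc ‖PowerSeries.coeff m (Q n * r.hypCoeff n)‖
        = 2 ^ m * (‖PowerSeries.coeff m (Q n * r.hypCoeff n)‖ * (1 / 2 : ℝ) ^ m) := by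
          linear_combination (-‖PowerSeries.coeff m (Q n * r.hypCoeff n)‖) * h2
      _ ≤ _ := by gcongr

/-- The values of `(a + b θ + c θ²) Wᵢ` forced by the expansion. -/
theorem quadraticTheta_eq_of_hasRamanujanExpansion (hr : r.IsAdmissible) {α β : ℂ}
    (hA : (fun x : ℝ => (r.A x : ℂ) - (1 + α * x ^ 2 - β * x ^ 3)) =O[𝓝 0] fun x : ℝ => x ^ 4)
    {z u l a b c k j : ℂ} (hz : r.ρ * ‖z‖ < 1) (hzl : z = u * Complex.exp l) (hu : u ≠ 0)
    (h : HasRamanujanExpansion r u l a b c k j) :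
    logSeriesAt (quadraticTheta a b c (frob r.hypCoeff 0)) z l = 1 / (Real.pi : ℂ) ^ 2 ∧
    logSeriesAt (quadraticTheta a b c (frob r.hypCoeff 1)) z l = 0 ∧
    logSeriesAt (quadraticTheta a b c (frob r.hypCoeff 2)) z l =
      -(k / 2) - α * (1 / (Real.pi : ℂ) ^ 2) ∧
    logSeriesAt (quadraticTheta a b c (frob r.hypCoeff 3)) z l = β * (1 / (Real.pi : ℂ) ^ 2) := by
  obtain ⟨S, hS, hS'⟩ := tsum_A_isBigO hr a b c hz hzl hu
  simp only [Finset.sum_range_succ, Finset.sum_range_zero, zero_add, pow_zero, mul_one,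
    pow_one] at hS'
  generalize logSeriesAt (quadraticTheta a b c (frob r.hypCoeff 0)) z l = e₀ at *
  generalize logSeriesAt (quadraticTheta a b c (frob r.hypCoeff 1)) z l = e₁ at *
  generalize logSeriesAt (quadraticTheta a b c (frob r.hypCoeff 2)) z l = e₂ at *
  generalize logSeriesAt (quadraticTheta a b c (frob r.hypCoeff 3)) z l = e₃ at *
  have hbdd : ∀ f : ℝ → ℂ, ContinuousAt f 0 → f =O[𝓝 0] fun _ : ℝ => (1 : ℝ) := fun f hf =>
    hf.tendsto.isBigO_one ℝ
  have hx4 : (fun x : ℝ => x ^ 4) =O[𝓝 0] fun _ : ℝ => (1 : ℝ) :=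
    Filter.Tendsto.isBigO_one ℝ (c := (0 : ℝ) ^ 4) ((continuous_pow 4).tendsto 0)
  have hpoly : ∀ f : ℝ → ℂ, ContinuousAt f 0 →
      (fun x : ℝ => (x : ℂ) ^ 4 * f x) =O[𝓝 0] fun x : ℝ => x ^ 4 := fun f hf => by
    have h1 : (fun x : ℝ => (x : ℂ) ^ 4) =O[𝓝 0] fun x : ℝ => x ^ 4 :=
      Asymptotics.isBigO_of_le _ fun x => by simp
    simpa using h1.mul (hbdd f hf)
  -- Only the coefficients up to x³ are used; the term containing j is put into the error.
  have hmain : (fun x : ℝ => (r.A x : ℂ) * S x - (1 / (Real.pi : ℂ) ^ 2 - k / 2 * x ^ 2))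
      =O[𝓝 0] fun x : ℝ => x ^ 4 := by
    have h5 : (fun x : ℝ => x ^ 5) =O[𝓝 0] fun x : ℝ => x ^ 4 := by
      have : (fun x : ℝ => x ^ 4 * x) =O[𝓝 0] fun x : ℝ => x ^ 4 * (1 : ℝ) :=
        (Asymptotics.isBigO_refl _ _).mul
          (Filter.Tendsto.isBigO_one ℝ (c := (0 : ℝ)) (Continuous.tendsto continuous_id 0))
      refine (this.congr (fun x => ?_) fun x => ?_) <;> ring
    refine ((h.trans h5).add (hpoly (fun _ => j / 24 * (Real.pi : ℂ) ^ 2)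
      continuousAt_const)).congr' ?_ Filter.EventuallyEq.rfl
    filter_upwards [Metric.ball_mem_nhds (0 : ℝ) (by norm_num : (0 : ℝ) < 1 / 12)] with x hx
    rw [mem_ball_zero_iff, Real.norm_eq_abs] at hx
    rw [hS x hx]
    ring
  have hSb : S =O[𝓝 0] fun _ : ℝ => (1 : ℝ) := by
    refine ((hS'.trans hx4).add (hbdd (fun x : ℝ => e₀ + e₁ * x + e₂ * x ^ 2 + e₃ * x ^ 3)
      (by fun_prop))).congr_left fun x => ?_
    ring
  have h1 := hA.mul hSb
  have h2 := (hbdd (fun x : ℝ => 1 + α * x ^ 2 - β * x ^ 3) (by fun_prop)).mul hS'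
  simp only [mul_one, one_mul] at h1 h2
  -- These are the terms of degree at least four in (1 + αx² - βx³)(e₀ + e₁x + e₂x² + e₃x³).
  have h3 := hpoly (fun x : ℝ => α * e₂ - β * e₁ + (α * e₃ - β * e₂) * x - β * e₃ * x ^ 2)
    (by fun_prop)
  have hfin : (fun x : ℝ => (e₀ - 1 / (Real.pi : ℂ) ^ 2) + e₁ * x + (e₂ + α * e₀ + k / 2) * x ^ 2 +
      (e₃ + α * e₁ - β * e₀) * x ^ 3) =O[𝓝 0] fun x : ℝ => x ^ 4 := by
    refine (((hmain.sub h1).sub h2).sub h3).congr_left fun x => ?_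
    ring
  obtain ⟨p0, p1, p2, p3⟩ := cubic_coeffs_eq_zero_of_isBigO hfin
  refine ⟨by linear_combination p0, p1, by linear_combination p2 - α * p0, ?_⟩
  linear_combination p3 - α * p1 + β * p0

end HypergeometricCase

/-! ### The multiplication formula for the Gamma function -/

theorem convexOn_log_Gamma_add_div {m : ℕ} (hm : 0 < m) (k : ℕ) :
    ConvexOn ℝ (Set.Ioi 0) fun x : ℝ => Real.log (Real.Gamma ((x + k) / m)) := by
  have hm' : (0 : ℝ) < m := by exact_mod_cast hm
  refine ⟨convex_Ioi _, fun x hx y hy a b ha hb hab => ?_⟩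
  have hx' : (x + k) / m ∈ Set.Ioi (0 : ℝ) := by
    have : (0 : ℝ) < x := hx
    simp only [Set.mem_Ioi]; positivity
  have hy' : (y + k) / m ∈ Set.Ioi (0 : ℝ) := by
    have : (0 : ℝ) < y := hy
    simp only [Set.mem_Ioi]; positivity
  have h := Real.convexOn_log_Gamma.2 hx' hy' ha hb hab
  have e : a • ((x + k) / m) + b • ((y + k) / m) = (a • x + b • y + k) / (m : ℝ) := by
    simp only [smul_eq_mul]
    field_simp
    linear_combination (k : ℝ) * hab
  rwa [e] at h

theorem convexOn_sum_log_Gamma {m : ℕ} (hm : 0 < m) (N : ℕ) :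
    ConvexOn ℝ (Set.Ioi 0) fun x : ℝ =>
      ∑ k ∈ Finset.range N, Real.log (Real.Gamma ((x + k) / m)) := by
  induction N with
  | zero => simpa using convexOn_const (0 : ℝ) (convex_Ioi (0 : ℝ))
  | succ N ih =>
    simp only [Finset.sum_range_succ]
    exact ih.add (convexOn_log_Gamma_add_div hm N)

/-- **Gauss's multiplication formula**, normalised at `1`. -/
theorem Gamma_eq_rpow_mul_prod_Gamma {m : ℕ} (hm : 0 < m) {x : ℝ} (hx : 0 < x) :
    Real.Gamma x = (m : ℝ) ^ (x - 1) * ∏ k ∈ Finset.range m,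
      (Real.Gamma ((x + k) / m) / Real.Gamma ((1 + k) / m)) := by
  have hm' : (0 : ℝ) < m := by exact_mod_cast hm
  have hG : ∀ (k : ℕ) {y : ℝ}, 0 < y → 0 < Real.Gamma ((y + k) / m) := fun k y hy =>
    Real.Gamma_pos_of_pos (by positivity)
  have hpos : ∀ {y : ℝ}, 0 < y → 0 < (m : ℝ) ^ (y - 1) * ∏ k ∈ Finset.range m,
      (Real.Gamma ((y + k) / m) / Real.Gamma ((1 + k) / m)) := fun {y} hy =>
    mul_pos (Real.rpow_pos_of_pos hm' _)
      (Finset.prod_pos fun k _ => div_pos (hG k hy) (hG k one_pos))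
  -- Bohr-Mollerup: the right-hand side is log-convex, satisfies f(y+1) = y f(y), and equals 1 at 1.
  refine (Real.eq_Gamma_of_log_convex (f := fun y => (m : ℝ) ^ (y - 1) * ∏ k ∈ Finset.range m,
      (Real.Gamma ((y + k) / m) / Real.Gamma ((1 + k) / m))) ?_ ?_ hpos ?_ hx).symm
  · have h1 : ConvexOn ℝ (Set.Ioi 0) fun y : ℝ => (y - 1) * Real.log m := by
      refine ⟨convex_Ioi _, fun x _ y _ a b _ _ hab => le_of_eq ?_⟩
      simp only [smul_eq_mul]
      linear_combination (Real.log m) * hab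
    refine ((h1.add (convexOn_sum_log_Gamma hm m)).add_const
      (-∑ k ∈ Finset.range m, Real.log (Real.Gamma ((1 + k) / m)))).congr fun y hy => ?_
    have hy' : (0 : ℝ) < y := hy
    simp only [Function.comp_apply, Pi.add_apply]
    rw [Real.log_mul (Real.rpow_pos_of_pos hm' _).ne' (Finset.prod_pos fun k _ =>
      div_pos (hG k hy') (hG k one_pos)).ne', Real.log_rpow hm', Real.log_prod fun k _ =>
      (div_pos (hG k hy') (hG k one_pos)).ne']
    rw [Finset.sum_congr rfl fun k _ => Real.log_div (hG k hy').ne' (hG k one_pos).ne',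
      Finset.sum_sub_distrib]
    ring
  · intro y hy
    have h1 := Finset.prod_range_succ (fun k : ℕ => Real.Gamma ((y + k) / m)) m
    have h2 := Finset.prod_range_succ' (fun k : ℕ => Real.Gamma ((y + k) / m)) m
    rw [h1] at h2
    have h3 : Real.Gamma ((y + m) / m) = y / m * Real.Gamma (y / m) := by
      rw [← Real.Gamma_add_one (by positivity)]
      congr 1; field_simp
    -- Replacing y by y + 1 shifts the index: the factor k = 0 is exchanged for the factor k = m,
    -- which is y/m times it.
    have h4 : ∏ k ∈ Finset.range m, Real.Gamma ((y + 1 + k) / m) =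
        (∏ k ∈ Finset.range m, Real.Gamma ((y + k) / m)) * (y / m) := by
      have hne : Real.Gamma (y / m) ≠ 0 := (Real.Gamma_pos_of_pos (by positivity)).ne'
      refine mul_right_cancel₀ hne ?_
      rw [mul_assoc, ← h3, h2, Nat.cast_zero, add_zero]
      congr 1
      refine Finset.prod_congr rfl fun k _ => ?_
      push_cast
      congr 2; ring
    simp only [Finset.prod_div_distrib]
    rw [h4, add_sub_cancel_right]
    have h5 : (m : ℝ) ^ y = (m : ℝ) ^ (y - 1) * m := by
      rw [← Real.rpow_add_one hm'.ne', sub_add_cancel]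
    rw [h5]
    field_simp
  · simp only [sub_self, Real.rpow_zero, one_mul]
    exact Finset.prod_eq_one fun k _ => div_self (hG k one_pos).ne'

/-- This is Gauss's formula with m + 1 factors at the point (m+1)x + 1, where the arguments become
(k+1)/(m+1) + x. The last factor, k = m, is Γ(x+1) and moves to the denominator. -/
theorem prod_pochhammerReal {m : ℕ} {x : ℝ} (hx : 0 < (m + 1 : ℕ) * x + 1) :
    ∏ k ∈ Finset.range m, pochhammerReal ((k + 1) / (m + 1 : ℕ)) x =
      Real.Gamma ((m + 1 : ℕ) * x + 1) /
        (((m + 1 : ℕ) : ℝ) ^ (((m + 1 : ℕ) : ℝ) * x) * Real.Gamma (x + 1)) := by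
  have hm : (0 : ℝ) < (m + 1 : ℕ) := by positivity
  have hx1 : 0 < x + 1 := by
    have h1 : (1 : ℝ) ≤ (m + 1 : ℕ) := by exact_mod_cast Nat.succ_le_succ m.zero_le
    by_contra h
    nlinarith
  have h := Gamma_eq_rpow_mul_prod_Gamma m.succ_pos hx
  rw [Finset.prod_range_succ, add_sub_cancel_right] at h
  have e1 : ∀ k : ℕ, ((m + 1 : ℕ) * x + 1 + k) / ((m + 1 : ℕ) : ℝ) =
      ((k : ℝ) + 1) / (m + 1 : ℕ) + x := fun k => by field_simp; ring
  have e2 : ((m : ℝ) + 1) / (m + 1 : ℕ) = 1 := by push_cast; field_simp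
  have e3 : ∀ k : ℕ, (1 + (k : ℝ)) / ((m + 1 : ℕ) : ℝ) = ((k : ℝ) + 1) / (m + 1 : ℕ) := fun k => by
    rw [add_comm]
  simp only [Nat.succ_eq_add_one, e1, e2, e3, Real.Gamma_one, div_one] at h
  have hG := (Real.Gamma_pos_of_pos hx1).ne'
  have hr := (Real.rpow_pos_of_pos hm (((m + 1 : ℕ) : ℝ) * x)).ne'
  rw [eq_div_iff (mul_ne_zero hr hG), h, add_comm 1 x]
  simp only [pochhammerReal]
  ring

/-! ### Logarithmic expansions -/

/-- `log f(x) = l x + a x² + b x³ + O(x⁴)` as `x → 0`. -/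
def HasLogExpansion (f : ℝ → ℝ) (l a b : ℝ) : Prop :=
  (∀ᶠ x in 𝓝 0, 0 < f x) ∧
    (fun x => Real.log (f x) - (l * x + a * x ^ 2 + b * x ^ 3)) =O[𝓝 0] fun x => x ^ 4

namespace HasLogExpansion

variable {f g : ℝ → ℝ} {l a b l' a' b' : ℝ}

theorem congr (hf : HasLogExpansion f l a b) (h : ∀ᶠ x in 𝓝 0, f x = g x) :
    HasLogExpansion g l a b := by
  refine ⟨?_, hf.2.congr' ?_ Filter.EventuallyEq.rfl⟩
  · filter_upwards [hf.1, h] with x h1 h2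
    rwa [← h2]
  · filter_upwards [h] with x hx
    rw [hx]

theorem mul (hf : HasLogExpansion f l a b) (hg : HasLogExpansion g l' a' b') :
    HasLogExpansion (fun x => f x * g x) (l + l') (a + a') (b + b') := by
  refine ⟨?_, (hf.2.add hg.2).congr' ?_ Filter.EventuallyEq.rfl⟩
  · filter_upwards [hf.1, hg.1] with x h1 h2 using mul_pos h1 h2
  · filter_upwards [hf.1, hg.1] with x h1 h2
    rw [Real.log_mul h1.ne' h2.ne']; ring

theorem div (hf : HasLogExpansion f l a b) (hg : HasLogExpansion g l' a' b') :
    HasLogExpansion (fun x => f x / g x) (l - l') (a - a') (b - b') := by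
  refine ⟨?_, (hf.2.sub hg.2).congr' ?_ Filter.EventuallyEq.rfl⟩
  · filter_upwards [hf.1, hg.1] with x h1 h2 using div_pos h1 h2
  · filter_upwards [hf.1, hg.1] with x h1 h2
    rw [Real.log_div h1.ne' h2.ne']; ring

theorem pow (hf : HasLogExpansion f l a b) (n : ℕ) :
    HasLogExpansion (fun x => f x ^ n) (n * l) (n * a) (n * b) := by
  refine ⟨?_, (hf.2.const_mul_left (n : ℝ)).congr' ?_ Filter.EventuallyEq.rfl⟩
  · filter_upwards [hf.1] with x h1 using pow_pos h1 n
  · filter_upwards with x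
    rw [Real.log_pow]; ring

theorem comp_const_mul (hf : HasLogExpansion f l a b) (c : ℝ) :
    HasLogExpansion (fun x => f (c * x)) (c * l) (c ^ 2 * a) (c ^ 3 * b) := by
  have ht : Filter.Tendsto (fun x : ℝ => c * x) (𝓝 0) (𝓝 0) := by
    have : Continuous fun x : ℝ => c * x := by fun_prop
    simpa using this.tendsto 0
  refine ⟨ht.eventually hf.1, ?_⟩
  have h1 := hf.2.comp_tendsto ht
  have h2 : (fun x : ℝ => (c * x) ^ 4) =O[𝓝 0] fun x : ℝ => x ^ 4 := by
    refine ((Asymptotics.isBigO_refl (fun x : ℝ => x ^ 4) (𝓝 0)).const_mul_left (c ^ 4)).congr_left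
      fun x => by ring
  refine (h1.trans h2).congr_left fun x => ?_
  simp only [Function.comp_apply]; ring

/-- Exponentiating an expansion without linear term. -/
theorem sub_isBigO (hf : HasLogExpansion f 0 a b) :
    (fun x => f x - (1 + a * x ^ 2 + b * x ^ 3)) =O[𝓝 0] fun x => x ^ 4 := by
  set u : ℝ → ℝ := fun x => Real.log (f x) with hu
  have h1 : (fun x => u x - (a * x ^ 2 + b * x ^ 3)) =O[𝓝 0] fun x => x ^ 4 :=
    hf.2.congr_left fun x => by simp only [hu]; ring
  have h42 : (fun x : ℝ => x ^ 4) =O[𝓝 0] fun x : ℝ => x ^ 2 := by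
    have : (fun x : ℝ => x ^ 2 * x ^ 2) =O[𝓝 0] fun x : ℝ => x ^ 2 * (1 : ℝ) :=
      (Asymptotics.isBigO_refl _ _).mul
        (Filter.Tendsto.isBigO_one ℝ (c := (0 : ℝ) ^ 2) ((continuous_pow 2).tendsto 0))
    refine (this.congr (fun x => ?_) fun x => ?_) <;> ring
  have h2 : u =O[𝓝 0] fun x => x ^ 2 := by
    have h3 : (fun x : ℝ => x ^ 2 * (a + b * x)) =O[𝓝 0] fun x : ℝ => x ^ 2 * (1 : ℝ) :=
      (Asymptotics.isBigO_refl _ _).mul (Filter.Tendsto.isBigO_one ℝ (c := a + b * (0 : ℝ))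
        ((by fun_prop : Continuous fun x : ℝ => a + b * x).tendsto 0))
    refine ((h1.trans h42).add (h3.congr_right fun x => mul_one _)).congr_left fun x => ?_
    ring
  have hu0 : Filter.Tendsto u (𝓝 0) (𝓝 0) := by
    refine h2.trans_tendsto ?_
    simpa using (continuous_pow 2).tendsto (0 : ℝ)
  -- Without a linear term u = O(x²), so the quadratic error of the exponential is already O(x⁴).
  have h4 : (fun x => Real.exp (u x) - 1 - u x) =O[𝓝 0] fun x => x ^ 4 := by
    have h5 := (Real.exp_sub_sum_range_isBigO_pow 2).comp_tendsto hu0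
    have h6 := h5.trans (h2.pow 2)
    refine h6.congr (fun x => ?_) fun x => ?_
    · simp [Finset.sum_range_succ]; ring
    · ring
  refine (h4.add h1).congr' ?_ Filter.EventuallyEq.rfl
  filter_upwards [hf.1] with x hx
  simp only [hu]
  rw [Real.exp_log hx]; ring

end HasLogExpansion

/-- `∑ 1/kⁿ` over `k ≥ 1`. -/
def zetaReal (n : ℕ) : ℝ := ∑' k : ℕ, 1 / ((k : ℝ) + 1) ^ n

theorem summable_zetaReal {n : ℕ} (hn : 1 < n) : Summable fun k : ℕ => 1 / ((k : ℝ) + 1) ^ n := by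
  have := (summable_nat_add_iff 1).2 (Real.summable_one_div_nat_pow.2 hn)
  simpa using this

/-- The logarithm of the Weierstrass product, obtained from the limit formula for log Γ and the
definition of γ through harmonic numbers. -/
theorem tendsto_sum_log_Gamma {x : ℝ} (hx : 0 < x + 1) :
    Filter.Tendsto (fun n : ℕ => ∑ k ∈ Finset.range (n + 1),
      (x / ((k : ℝ) + 1) - Real.log (1 + x / ((k : ℝ) + 1)))) Filter.atTop
      (𝓝 (Real.log (Real.Gamma (x + 1)) + x * Real.eulerMascheroniConstant)) := by
  have h1 := Real.BohrMollerup.tendsto_log_gamma hx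
  have h2 := (Real.tendsto_harmonic_sub_log.comp (Filter.tendsto_add_atTop_nat 1)).const_mul x
  -- The Γ limit is normalised with log n, whereas the harmonic number with n + 1 terms is compared
  -- with log(n+1). This null sequence reconciles the two.
  have h3 : Filter.Tendsto (fun n : ℕ => (x + 1) * (Real.log ((n : ℝ) + 1) - Real.log n))
      Filter.atTop (𝓝 0) := by
    have h4 : Filter.Tendsto (fun n : ℕ => Real.log (((n : ℝ) + 1) / (n + 0))) Filter.atTop (𝓝 0) := by
      have := (Real.continuousAt_log one_ne_zero).tendsto.comp (tendsto_add_div_add 1 0)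
      simpa [Function.comp_def] using this
    have h5 := h4.const_mul (x + 1)
    rw [mul_zero] at h5
    refine h5.congr' ?_
    filter_upwards [Filter.eventually_gt_atTop 0] with n hn
    have : (0 : ℝ) < n := by exact_mod_cast hn
    rw [add_zero, Real.log_div (by positivity) (by positivity)]
  have h6 := (h1.add h2).add h3
  rw [add_zero] at h6
  refine h6.congr fun n => ?_
  simp only [Real.BohrMollerup.logGammaSeq, Function.comp_apply, harmonic, Finset.sum_sub_distrib]
  have e1 : ∀ k ∈ Finset.range (n + 1), Real.log (x + 1 + (k : ℝ)) =
      Real.log ((k : ℝ) + 1) + Real.log (1 + x / ((k : ℝ) + 1)) := by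
    intro k _
    have hk : (0 : ℝ) < (k : ℝ) + 1 := by positivity
    have hk' : 0 < 1 + x / ((k : ℝ) + 1) := by
      have : 0 < (k : ℝ) + 1 + x := by
        have : (0 : ℝ) ≤ k := k.cast_nonneg
        linarith
      rw [show 1 + x / ((k : ℝ) + 1) = ((k : ℝ) + 1 + x) / ((k : ℝ) + 1) by field_simp]
      positivity
    rw [← Real.log_mul hk.ne' hk'.ne']
    congr 1
    field_simp
    ring
  have e2 : ∑ k ∈ Finset.range (n + 1), Real.log ((k : ℝ) + 1) =
      Real.log (n.factorial : ℝ) + Real.log ((n : ℝ) + 1) := by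
    rw [← Real.log_prod (fun k _ => by positivity)]
    rw [← Real.log_mul (by positivity) (by positivity)]
    congr 1
    have : ((n + 1).factorial : ℝ) = ∏ k ∈ Finset.range (n + 1), ((k : ℝ) + 1) := by
      rw [← Finset.prod_range_add_one_eq_factorial]; push_cast; rfl
    rw [← this, Nat.factorial_succ]; push_cast; ring
  rw [Finset.sum_congr rfl e1, Finset.sum_add_distrib, e2]
  push_cast
  simp only [div_eq_mul_inv, ← Finset.mul_sum]
  ring

/-- Each term x/k - log(1 + x/k) is expanded to third order. For |x| < 1/2 its error is at most
2x⁴/k⁴, and summing over k gives 2ζ(4)x⁴. -/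
theorem hasLogExpansion_Gamma : HasLogExpansion (fun x => Real.Gamma (x + 1))
    (-Real.eulerMascheroniConstant) (zetaReal 2 / 2) (-(zetaReal 3 / 3)) := by
  have hev : ∀ᶠ x : ℝ in 𝓝 0, |x| < 1 / 2 := by
    filter_upwards [Metric.ball_mem_nhds (0 : ℝ) (by norm_num : (0 : ℝ) < 1 / 2)] with x hx
    rwa [mem_ball_zero_iff, Real.norm_eq_abs] at hx
  refine ⟨?_, Asymptotics.IsBigO.of_bound (2 * zetaReal 4) ?_⟩
  · filter_upwards [hev] with x hx
    exact Real.Gamma_pos_of_pos (by linarith [(abs_lt.1 hx).1])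
  filter_upwards [hev] with x hx
  have hlim := tendsto_sum_log_Gamma (x := x) (by linarith [(abs_lt.1 hx).1])
  have hz : ∀ n, 1 < n → Filter.Tendsto (fun N : ℕ => ∑ k ∈ Finset.range (N + 1),
      1 / ((k : ℝ) + 1) ^ n) Filter.atTop (𝓝 (zetaReal n)) := fun n hn =>
    (summable_zetaReal hn).hasSum.tendsto_sum_nat.comp (Filter.tendsto_add_atTop_nat 1)
  have h1 := (hlim.sub ((hz 2 (by norm_num)).const_mul (x ^ 2 / 2))).add
    ((hz 3 (by norm_num)).const_mul (x ^ 3 / 3))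
  have hterm : ∀ k : ℕ, |x / ((k : ℝ) + 1) - Real.log (1 + x / ((k : ℝ) + 1))
      - x ^ 2 / 2 * (1 / ((k : ℝ) + 1) ^ 2) + x ^ 3 / 3 * (1 / ((k : ℝ) + 1) ^ 3)| ≤
      2 * x ^ 4 * (1 / ((k : ℝ) + 1) ^ 4) := by
    intro k
    have hk : (0 : ℝ) < (k : ℝ) + 1 := by positivity
    have hk1 : (1 : ℝ) ≤ (k : ℝ) + 1 := by linarith [(k.cast_nonneg : (0 : ℝ) ≤ k)]
    have hu : |-(x / ((k : ℝ) + 1))| ≤ 1 / 2 := by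
      rw [abs_neg, abs_div, abs_of_pos hk, div_le_iff₀ hk]
      linarith
    have h := Real.abs_log_sub_add_sum_range_le (x := -(x / ((k : ℝ) + 1))) (by linarith) 3
    simp only [Finset.sum_range_succ, Finset.sum_range_zero] at h
    rw [← abs_neg] at h
    have e : -(0 + (-(x / ((k : ℝ) + 1))) ^ (0 + 1) / ((0 : ℕ) + 1) +
        (-(x / ((k : ℝ) + 1))) ^ (1 + 1) / ((1 : ℕ) + 1) +
        (-(x / ((k : ℝ) + 1))) ^ (2 + 1) / ((2 : ℕ) + 1) + Real.log (1 - -(x / ((k : ℝ) + 1)))) =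
        x / ((k : ℝ) + 1) - Real.log (1 + x / ((k : ℝ) + 1))
      - x ^ 2 / 2 * (1 / ((k : ℝ) + 1) ^ 2) + x ^ 3 / 3 * (1 / ((k : ℝ) + 1) ^ 3) := by
      rw [sub_neg_eq_add]
      push_cast
      field_simp
      ring
    rw [e] at h
    refine h.trans ?_
    have h4 : |-(x / ((k : ℝ) + 1))| ^ (3 + 1) = x ^ 4 * (1 / ((k : ℝ) + 1) ^ 4) := by
      rw [abs_neg, show 3 + 1 = 4 from rfl, ← abs_pow, abs_of_nonneg (by positivity), div_pow]; ring
    rw [h4, div_le_iff₀ (by linarith)]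
    have : 0 ≤ x ^ 4 * (1 / ((k : ℝ) + 1) ^ 4) := by positivity
    nlinarith
  have h2 : ∀ N : ℕ, |∑ k ∈ Finset.range (N + 1),
      (x / ((k : ℝ) + 1) - Real.log (1 + x / ((k : ℝ) + 1))) - x ^ 2 / 2 *
      ∑ k ∈ Finset.range (N + 1), 1 / ((k : ℝ) + 1) ^ 2 + x ^ 3 / 3 *
      ∑ k ∈ Finset.range (N + 1), 1 / ((k : ℝ) + 1) ^ 3| ≤ 2 * x ^ 4 * zetaReal 4 := by
    intro N
    rw [Finset.mul_sum, Finset.mul_sum, ← Finset.sum_sub_distrib, ← Finset.sum_add_distrib]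
    refine (Finset.abs_sum_le_sum_abs _ _).trans ((Finset.sum_le_sum fun k _ => hterm k).trans ?_)
    rw [← Finset.mul_sum]
    gcongr
    exact (summable_zetaReal (by norm_num)).sum_le_tsum _ fun k _ => by positivity
  have h3 := le_of_tendsto h1.abs (Filter.Eventually.of_forall h2)
  rw [Real.norm_eq_abs, Real.norm_of_nonneg (by positivity : (0 : ℝ) ≤ x ^ 4)]
  calc _ = |Real.log (Real.Gamma (x + 1)) + x * Real.eulerMascheroniConstant
      - x ^ 2 / 2 * zetaReal 2 + x ^ 3 / 3 * zetaReal 3| := by congr 1; ring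
    _ ≤ _ := h3
    _ = _ := by ring

/-! ### The expansion of `A_x` -/

theorem zetaReal_two : zetaReal 2 = Real.pi ^ 2 / 6 := by
  have h := hasSum_zeta_two
  have := (hasSum_nat_add_iff' 1).2 h
  simp only [Finset.sum_range_one, Nat.cast_zero] at this
  have e := this.tsum_eq
  norm_num at e
  rw [zetaReal]
  simpa using e

theorem zetaReal_three : (zetaReal 3 : ℂ) = riemannZeta 3 := by
  have h := zeta_eq_tsum_one_div_nat_add_one_cpow (s := 3) (by norm_num)
  rw [h, zetaReal, Complex.ofReal_tsum]
  refine tsum_congr fun n => ?_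
  push_cast
  rw [← Complex.cpow_natCast]
  norm_num

/-- The product `f` of `n` Pochhammer symbols, normalised as `κ^x f(x) / Γ(x+1)^n`, has a
logarithmic expansion without linear term. -/
def IsGammaBlock (f : ℝ → ℝ) (n : ℕ) (κ a b : ℝ) : Prop :=
  0 < κ ∧ HasLogExpansion (fun x => κ ^ x * f x / Real.Gamma (x + 1) ^ n) 0
    (zetaReal 2 / 2 * a) (-(zetaReal 3 / 3 * b))

theorem eventually_Gamma_add_one_ne_zero : ∀ᶠ x : ℝ in 𝓝 0, Real.Gamma (x + 1) ≠ 0 :=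
  hasLogExpansion_Gamma.1.mono fun _ hx => hx.ne'

namespace IsGammaBlock

variable {f g h : ℝ → ℝ} {m n : ℕ} {κ a b κ' a' b' : ℝ}

theorem mul (hf : IsGammaBlock f m κ a b) (hg : IsGammaBlock g n κ' a' b')
    (hh : ∀ x, h x = f x * g x) : IsGammaBlock h (m + n) (κ * κ') (a + a') (b + b') := by
  refine ⟨mul_pos hf.1 hg.1, ?_⟩
  have := hf.2.mul hg.2
  rw [add_zero, ← mul_add, ← neg_add, ← mul_add] at this
  refine this.congr (Filter.Eventually.of_forall fun x => ?_)
  rw [hh, Real.mul_rpow hf.1.le hg.1.le, pow_add]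
  ring

/-- The Gauss product over all fractions k/m also contains the fractions that are not in lowest
terms; division by their blocks isolates the reduced ones. -/
theorem of_mul (hf : IsGammaBlock f (m + n) κ a b) (hg : IsGammaBlock g n κ' a' b')
    (hh : ∀ x, f x = h x * g x) : IsGammaBlock h m (κ / κ') (a - a') (b - b') := by
  refine ⟨div_pos hf.1 hg.1, ?_⟩
  have := hf.2.div hg.2
  rw [sub_zero, ← mul_sub, show -(zetaReal 3 / 3 * b) - -(zetaReal 3 / 3 * b') =
    -(zetaReal 3 / 3 * (b - b')) by ring] at this
  refine this.congr ?_
  filter_upwards [hg.2.1, eventually_Gamma_add_one_ne_zero] with x hx hG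
  have hg0 : g x ≠ 0 := by
    intro h0
    simp [h0] at hx
  have hκ : κ' ^ x ≠ 0 := (Real.rpow_pos_of_pos hg.1 x).ne'
  rw [hh, Real.div_rpow hf.1.le hg.1.le, pow_add]
  field_simp

end IsGammaBlock

/-- With M = m + 1, the normalised product is Γ(Mx+1)/Γ(x+1)^M: the constant κ = M^M cancels the
power in Gauss's formula. The linear terms Mγ cancel, leaving M² - M and M³ - M as multiples of the
ζ(2) and ζ(3) terms. -/
theorem isGammaBlock_prod_pochhammerReal (m : ℕ) :
    IsGammaBlock (fun x => ∏ k ∈ Finset.range m, pochhammerReal ((k + 1) / (m + 1 : ℕ)) x) m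
      (((m + 1 : ℕ) : ℝ) ^ (m + 1)) (((m + 1 : ℕ) : ℝ) ^ 2 - (m + 1 : ℕ))
      (((m + 1 : ℕ) : ℝ) ^ 3 - (m + 1 : ℕ)) := by
  have hm : (0 : ℝ) < (m + 1 : ℕ) := by positivity
  refine ⟨by positivity, ?_⟩
  have h := (hasLogExpansion_Gamma.comp_const_mul ((m + 1 : ℕ) : ℝ)).div
    (hasLogExpansion_Gamma.pow (m + 1))
  rw [sub_self] at h
  have ev : ∀ᶠ x : ℝ in 𝓝 0, 0 < ((m + 1 : ℕ) : ℝ) * x + 1 := by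
    have hc : Continuous fun x : ℝ => ((m + 1 : ℕ) : ℝ) * x + 1 := by fun_prop
    exact hc.continuousAt.eventually_const_lt (by simp)
  have h' := h.congr (g := fun x => (((m + 1 : ℕ) : ℝ) ^ (m + 1)) ^ x *
      (∏ k ∈ Finset.range m, pochhammerReal ((k + 1) / (m + 1 : ℕ)) x) /
      Real.Gamma (x + 1) ^ m) (by
    filter_upwards [ev, eventually_Gamma_add_one_ne_zero] with x hx hG
    have e : (((m + 1 : ℕ) : ℝ) ^ (m + 1)) ^ x =
        ((m + 1 : ℕ) : ℝ) ^ (((m + 1 : ℕ) : ℝ) * x) := by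
      rw [Real.rpow_mul hm.le, Real.rpow_natCast]
    rw [prod_pochhammerReal hx, e]
    have := (Real.rpow_pos_of_pos hm (((m + 1 : ℕ) : ℝ) * x)).ne'
    field_simp
    ring)
  convert h' using 1 <;> ring

theorem isGammaBlock_half : IsGammaBlock (pochhammerReal (1 / 2)) 1 4 2 6 := by
  have h := isGammaBlock_prod_pochhammerReal 1
  norm_num [Finset.prod_range_succ] at h ⊢
  exact h

theorem isGammaBlock_half_half : IsGammaBlock
    (fun x => pochhammerReal (1 / 2) x * pochhammerReal (1 / 2) x) 2 16 4 12 := by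
  have h := isGammaBlock_half.mul isGammaBlock_half fun _ => rfl
  norm_num at h ⊢
  exact h

theorem isGammaBlock_third : IsGammaBlock
    (fun x => pochhammerReal (1 / 3) x * pochhammerReal (2 / 3) x) 2 27 6 24 := by
  have h := isGammaBlock_prod_pochhammerReal 2
  norm_num [Finset.prod_range_succ] at h ⊢
  exact h

theorem isGammaBlock_quarter : IsGammaBlock
    (fun x => pochhammerReal (1 / 4) x * pochhammerReal (3 / 4) x) 2 64 10 54 := by
  have h := (isGammaBlock_prod_pochhammerReal 3).of_mul (m := 2) (n := 1) isGammaBlock_half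
    (h := fun x => pochhammerReal (1 / 4) x * pochhammerReal (3 / 4) x) fun x => by
      norm_num [Finset.prod_range_succ]; ring
  norm_num at h ⊢
  exact h

theorem isGammaBlock_sixth : IsGammaBlock
    (fun x => pochhammerReal (1 / 6) x * pochhammerReal (5 / 6) x) 2 432 22 180 := by
  have h := (isGammaBlock_prod_pochhammerReal 5).of_mul (m := 2) (n := 3)
    (isGammaBlock_third.mul isGammaBlock_half fun _ => rfl)
    (h := fun x => pochhammerReal (1 / 6) x * pochhammerReal (5 / 6) x) fun x => by
      norm_num [Finset.prod_range_succ]; ring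
  norm_num at h ⊢
  exact h

theorem isGammaBlock_fifth : IsGammaBlock (fun x => pochhammerReal (1 / 5) x *
    pochhammerReal (4 / 5) x * (pochhammerReal (2 / 5) x * pochhammerReal (3 / 5) x))
    4 3125 20 120 := by
  have h := isGammaBlock_prod_pochhammerReal 4
  norm_num [Finset.prod_range_succ] at h ⊢
  convert h using 2
  ring

theorem isGammaBlock_eighth : IsGammaBlock (fun x => pochhammerReal (1 / 8) x *
    pochhammerReal (7 / 8) x * (pochhammerReal (3 / 8) x * pochhammerReal (5 / 8) x))
    4 65536 44 444 := by
  have h := (isGammaBlock_prod_pochhammerReal 7).of_mul (m := 4) (n := 3)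
    (isGammaBlock_quarter.mul isGammaBlock_half fun _ => rfl)
    (h := fun x => pochhammerReal (1 / 8) x * pochhammerReal (7 / 8) x *
      (pochhammerReal (3 / 8) x * pochhammerReal (5 / 8) x)) fun x => by
      norm_num [Finset.prod_range_succ]; ring
  norm_num at h ⊢
  exact h

theorem isGammaBlock_tenth : IsGammaBlock (fun x => pochhammerReal (1 / 10) x *
    pochhammerReal (9 / 10) x * (pochhammerReal (3 / 10) x * pochhammerReal (7 / 10) x))
    4 800000 68 864 := by
  have h := (isGammaBlock_prod_pochhammerReal 9).of_mul (m := 4) (n := 5)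
    (isGammaBlock_fifth.mul isGammaBlock_half fun _ => rfl)
    (h := fun x => pochhammerReal (1 / 10) x * pochhammerReal (9 / 10) x *
      (pochhammerReal (3 / 10) x * pochhammerReal (7 / 10) x)) fun x => by
      norm_num [Finset.prod_range_succ]; ring
  norm_num at h ⊢
  exact h

/-- Of the eleven fractions k/12, seven reduce to the blocks of 1/3, 1/6, 1/2 and 1/4; those with
numerators 1, 5, 7, 11 remain. -/
theorem isGammaBlock_twelfth : IsGammaBlock (fun x => pochhammerReal (1 / 12) x *
    pochhammerReal (11 / 12) x * (pochhammerReal (5 / 12) x * pochhammerReal (7 / 12) x))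
    4 2985984 92 1452 := by
  have h := (isGammaBlock_prod_pochhammerReal 11).of_mul (m := 4) (n := 7)
    (((isGammaBlock_third.mul isGammaBlock_sixth fun _ => rfl).mul isGammaBlock_half
      fun _ => rfl).mul isGammaBlock_quarter fun _ => rfl)
    (h := fun x => pochhammerReal (1 / 12) x * pochhammerReal (11 / 12) x *
      (pochhammerReal (5 / 12) x * pochhammerReal (7 / 12) x)) fun x => by
      norm_num [Finset.prod_range_succ]; ring
  norm_num at h ⊢
  exact h

namespace HypergeometricCase

/-- The product of the Pochhammer symbols with parameters `s₁, 1 - s₁, s₂, 1 - s₂`. -/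
def pochhammerProd (r : HypergeometricCase) (x : ℝ) : ℝ :=
  pochhammerReal r.s₁ x * pochhammerReal (1 - r.s₁) x *
    (pochhammerReal r.s₂ x * pochhammerReal (1 - r.s₂) x)

/-- The block of 1/2, with invariants 4, 2, 6, is still missing from A_x. Multiplying by it yields
ρ, 6e, 3h, and then (ζ(2)/2)·6e = eπ²/2 and (ζ(3)/3)·3h = hζ(3). -/
theorem isGammaBlock_pochhammerProd {r : HypergeometricCase} (hr : r ∈ hypergeometricTable) :
    IsGammaBlock r.pochhammerProd 4 (r.ρ / 4) (6 * r.e - 2) (3 * r.h - 6) := by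
  simp only [hypergeometricTable, List.mem_cons, List.not_mem_nil, or_false] at hr
  rcases hr with rfl | rfl | rfl | rfl | rfl | rfl | rfl | rfl | rfl | rfl | rfl | rfl | rfl | rfl
  · have h := isGammaBlock_fifth
    unfold pochhammerProd; norm_num at h ⊢; exact h
  · have h := isGammaBlock_tenth
    unfold pochhammerProd; norm_num at h ⊢; exact h
  · have h := isGammaBlock_half_half.mul isGammaBlock_half_half fun _ => rfl
    unfold pochhammerProd; norm_num at h ⊢; exact h
  · have h := isGammaBlock_third.mul isGammaBlock_third fun _ => rfl
    unfold pochhammerProd; norm_num at h ⊢; exact h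
  · have h := isGammaBlock_half_half.mul isGammaBlock_third fun _ => rfl
    unfold pochhammerProd; norm_num at h ⊢; exact h
  · have h := isGammaBlock_half_half.mul isGammaBlock_quarter fun _ => rfl
    unfold pochhammerProd; norm_num at h ⊢; exact h
  · have h := isGammaBlock_eighth
    unfold pochhammerProd; norm_num at h ⊢; exact h
  · have h := isGammaBlock_sixth.mul isGammaBlock_third fun _ => rfl
    unfold pochhammerProd; norm_num at h ⊢; exact h
  · have h := isGammaBlock_twelfth
    unfold pochhammerProd; norm_num at h ⊢; exact h
  · have h := isGammaBlock_quarter.mul isGammaBlock_quarter fun _ => rfl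
    unfold pochhammerProd; norm_num at h ⊢; exact h
  · have h := isGammaBlock_quarter.mul isGammaBlock_third fun _ => rfl
    unfold pochhammerProd; norm_num at h ⊢; exact h
  · have h := isGammaBlock_sixth.mul isGammaBlock_quarter fun _ => rfl
    unfold pochhammerProd; norm_num at h ⊢; exact h
  · have h := isGammaBlock_sixth.mul isGammaBlock_sixth fun _ => rfl
    unfold pochhammerProd; norm_num at h ⊢; exact h
  · have h := isGammaBlock_half_half.mul isGammaBlock_sixth fun _ => rfl
    unfold pochhammerProd; norm_num at h ⊢; exact h

theorem A_sub_isBigO {r : HypergeometricCase} (hr : r ∈ hypergeometricTable) :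
    (fun x : ℝ => (r.A x : ℂ) - (1 + r.e / 2 * (Real.pi : ℂ) ^ 2 * x ^ 2
      - r.h * riemannZeta 3 * x ^ 3)) =O[𝓝 0] fun x : ℝ => x ^ 4 := by
  have h := (isGammaBlock_half.mul (isGammaBlock_pochhammerProd hr)
    fun _ => rfl).2.sub_isBigO
  rw [← Complex.isBigO_ofReal_left] at h
  refine h.congr_left fun x => ?_
  have e : (4 : ℝ) * (r.ρ / 4) = r.ρ := by ring
  simp only [e, pochhammerProd, A]
  push_cast
  rw [zetaReal_two, zetaReal_three]
  push_cast
  ring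

end HypergeometricCase

/-! ### The potential and the Yukawa coupling -/

theorem wronskianZ_mul_mul (c f g : LogSeries) :
    wronskianZ (c * f) (c * g) = c ^ 2 * wronskianZ f g := by
  simp only [wronskianZ, theta_mul]; ring

theorem C_C_half : 2 * Polynomial.C (PowerSeries.C (1 / 2 : ℂ)) = (1 : LogSeries) := by
  rw [← map_ofNat Polynomial.C 2, ← map_ofNat PowerSeries.C 2, ← map_mul, ← map_mul]
  norm_num

theorem C_C_sixth : 6 * Polynomial.C (PowerSeries.C (1 / 6 : ℂ)) = (1 : LogSeries) := by
  rw [← map_ofNat Polynomial.C 6, ← map_ofNat PowerSeries.C 6, ← map_mul, ← map_mul]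
  norm_num

theorem C_C_half_eq : (Polynomial.C (PowerSeries.C (1 / 2 : ℂ)) : LogSeries) =
    3 * Polynomial.C (PowerSeries.C (1 / 6 : ℂ)) := by
  rw [← map_ofNat Polynomial.C 3, ← map_ofNat PowerSeries.C 3, ← map_mul, ← map_mul]
  norm_num

theorem theta_sq (p : LogSeries) : theta (p ^ 2) = 2 * p * theta p := by
  rw [pow_two, theta_mul]; ring

theorem theta_smul (a : ℂ) (p : LogSeries) : theta (a • p) = a • theta p := map_smul _ _ _

/-- `z d/dz` and substitution: the chain rule. -/
theorem thetaSeries_subst (f : ℂ⟦X⟧) {g : ℂ⟦X⟧} (hg : PowerSeries.HasSubst g) :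
    thetaSeries (f.subst g : ℂ⟦X⟧) = (PowerSeries.derivative ℂ f).subst g * thetaSeries g := by
  rw [thetaSeries_apply, thetaSeries_apply, PowerSeries.derivative_subst hg]
  ring

namespace FrobeniusBasis

variable (Y : FrobeniusBasis)

/-- The power series in `y₁ / y₀ = log z + a₁`. -/
def a₁ : ℂ⟦X⟧ := Y.α₁ * Y.f₀⁻¹

/-- The series `y₂ / y₀ - t² / 2`. -/
def b₂ : ℂ⟦X⟧ := Y.α₂ * Y.f₀⁻¹ - PowerSeries.C (1 / 2) * Y.a₁ ^ 2

/-- The series `y₃ / y₀ - t³ / 6 - b₂ t`. -/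
def b₃ : ℂ⟦X⟧ := Y.α₃ * Y.f₀⁻¹ - Y.a₁ * (Y.α₂ * Y.f₀⁻¹) + PowerSeries.C (1 / 3) * Y.a₁ ^ 3

theorem constantCoeff_a₁ : PowerSeries.constantCoeff Y.a₁ = 0 := by simp [a₁, Y.α₁_zero]

theorem constantCoeff_b₃ : PowerSeries.constantCoeff Y.b₃ = 0 := by
  simp [b₃, Y.α₃_zero, Y.α₂_zero, Y.constantCoeff_a₁]

theorem f₀_mul_inv : Y.f₀ * Y.f₀⁻¹ = 1 := PowerSeries.mul_inv_cancel _ (by simp [Y.f₀_zero])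

theorem C_f₀_mul_inv : Polynomial.C Y.f₀ * Polynomial.C Y.f₀⁻¹ = (1 : LogSeries) := by
  rw [← map_mul, f₀_mul_inv, map_one]

theorem y_eq_mul_quot (i : Fin 4) : Y.y i = Polynomial.C Y.f₀ * Y.quot i := by
  rw [quot, ← mul_assoc, C_f₀_mul_inv, one_mul]

theorem quot_zero : Y.quot 0 = 1 := by
  rw [quot, y_zero, mul_comm, C_f₀_mul_inv]

theorem t_eq : Y.t = Polynomial.X + Polynomial.C Y.a₁ := by
  rw [t, quot, y_one, a₁, map_mul]
  linear_combination Polynomial.X * Y.C_f₀_mul_inv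

theorem quot_one : Y.quot 1 = Y.t := rfl

theorem quot_two : Y.quot 2 = (1 / 2 : ℂ) • Y.t ^ 2 + Polynomial.C Y.b₂ := by
  rw [quot, y_two, t_eq, smul_eq_C_C_mul, smul_eq_C_C_mul, b₂]
  simp only [map_sub, map_mul, map_pow, a₁]
  linear_combination (Polynomial.C (PowerSeries.C (1 / 2 : ℂ)) * Polynomial.X ^ 2) *
    Y.C_f₀_mul_inv - Polynomial.C Y.α₁ * Polynomial.C Y.f₀⁻¹ * Polynomial.X * C_C_half

theorem quot_three : Y.quot 3 = (1 / 6 : ℂ) • Y.t ^ 3 + Polynomial.C Y.b₂ * Y.t +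
    Polynomial.C Y.b₃ := by
  have h3 : Polynomial.C (PowerSeries.C (1 / 3 : ℂ)) =
      2 * Polynomial.C (PowerSeries.C (1 / 6 : ℂ)) := by
    rw [← map_ofNat Polynomial.C 2, ← map_ofNat PowerSeries.C 2, ← map_mul, ← map_mul]
    norm_num
  rw [quot, y_three, t_eq, smul_eq_C_C_mul, smul_eq_C_C_mul, smul_eq_C_C_mul, b₃, b₂]
  simp only [map_sub, map_add, map_mul, map_pow, a₁, h3, C_C_half_eq]
  linear_combination (Polynomial.C (PowerSeries.C (1 / 6 : ℂ)) * Polynomial.X ^ 3) *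
    Y.C_f₀_mul_inv

theorem potential_eq : Y.potential = (1 / 6 : ℂ) • Y.t ^ 3 -
    Polynomial.C (PowerSeries.C (1 / 2) * Y.b₃) := by
  rw [potential, quot_one, quot_two, quot_three]
  simp only [smul_eq_C_C_mul, map_mul, C_C_half_eq]
  linear_combination (Polynomial.C (PowerSeries.C (1 / 6 : ℂ)) * Y.t ^ 3) * C_C_sixth

theorem theta_t : theta Y.t = Polynomial.C (1 + thetaSeries Y.a₁) := by
  rw [t_eq, map_add, theta_X, theta_C, map_add, map_one]

/-- In terms of `b₂` and `b₃` the Calabi-Yau condition reads `d b₃ / dt = -2 b₂`. -/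
theorem thetaSeries_b₃
    (h : wronskianZ (Y.y 0) (Y.y 3) = wronskianZ (Y.y 1) (Y.y 2)) :
    thetaSeries Y.b₃ = -2 * Y.b₂ * (1 + thetaSeries Y.a₁) := by
  simp only [y_eq_mul_quot, wronskianZ_mul_mul] at h
  have h' := mul_left_cancel₀ (pow_ne_zero 2 (Y.y_zero ▸ Y.y_zero_ne_zero)) h
  rw [quot_zero, quot_one, quot_two, quot_three] at h'
  have hC : ∀ a : ℂ, theta (Polynomial.C (PowerSeries.C a)) = 0 := fun a => by
    rw [theta_C, thetaSeries_C, map_zero]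
  have e3 : theta (Y.t ^ 3) = 3 * Y.t ^ 2 * theta Y.t := by
    have := theta_pow_succ 2 Y.t
    rw [show 2 + 1 = 3 from rfl] at this
    rw [this]; push_cast; ring
  simp only [wronskianZ, smul_eq_C_C_mul, map_add, theta_mul, theta_one, hC, theta_sq, e3] at h'
  rw [C_C_half_eq] at h'
  rw [← Polynomial.C_inj, ← theta_C]
  have e4 : Polynomial.C (-2 * Y.b₂ * (1 + thetaSeries Y.a₁)) =
      -2 * Polynomial.C Y.b₂ * theta Y.t := by
    rw [theta_t, map_mul, map_mul, map_neg, map_ofNat]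
  rw [e4]
  linear_combination h'

theorem constantCoeff_one_add_thetaSeries_a₁ :
    PowerSeries.constantCoeff (1 + thetaSeries Y.a₁) = 1 := by
  simp [thetaSeries_apply]

theorem one_add_thetaSeries_a₁_mul_inv :
    (1 + thetaSeries Y.a₁)⁻¹ * (1 + thetaSeries Y.a₁) = 1 :=
  PowerSeries.inv_mul_cancel _ (by
    rw [constantCoeff_one_add_thetaSeries_a₁]; exact one_ne_zero)

theorem hasSubst_a₁ : PowerSeries.HasSubst Y.a₁ :=
  PowerSeries.HasSubst.of_constantCoeff_zero' Y.constantCoeff_a₁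

theorem q_eq : Y.q = PowerSeries.X * (PowerSeries.exp ℂ).subst Y.a₁ := rfl

theorem constantCoeff_q : PowerSeries.constantCoeff Y.q = 0 := by simp [q]

theorem hasSubst_q : PowerSeries.HasSubst Y.q :=
  PowerSeries.HasSubst.of_constantCoeff_zero' Y.constantCoeff_q

theorem isUnit_coeff_one_q : IsUnit (PowerSeries.coeff 1 Y.q) := by
  have h : PowerSeries.coeff 1 Y.q = 1 := by
    rw [q_eq, PowerSeries.coeff_succ_X_mul, PowerSeries.coeff_zero_eq_constantCoeff_apply]
    have e : PowerSeries.exp ℂ = (PowerSeries.exp ℂ - 1) + 1 := by ring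
    have h1 : PowerSeries.constantCoeff
        ((PowerSeries.exp ℂ - 1 : ℂ⟦X⟧).subst Y.a₁ : ℂ⟦X⟧) = 0 :=
      PowerSeries.constantCoeff_subst_eq_zero Y.constantCoeff_a₁ _ (by simp)
    rw [e, PowerSeries.subst_add Y.hasSubst_a₁, map_add, h1, zero_add,
      ← PowerSeries.coe_substAlgHom Y.hasSubst_a₁, map_one, map_one]
  rw [h]; exact isUnit_one

theorem thetaSeries_q : thetaSeries Y.q = Y.q * (1 + thetaSeries Y.a₁) := by
  have hX : thetaSeries PowerSeries.X = PowerSeries.X := by simp [thetaSeries_apply]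
  rw [q_eq, Derivation.leibniz, thetaSeries_subst _ Y.hasSubst_a₁, PowerSeries.derivative_exp, hX]
  simp only [smul_eq_mul]
  ring

/-- `d/dt` on power series in `z`. -/
def ddtSeries (f : ℂ⟦X⟧) : ℂ⟦X⟧ := (1 + thetaSeries Y.a₁)⁻¹ * thetaSeries f

/-- Because q = exp t, one has θq = q θt, and so d/dt becomes q d/dq on series in q. -/
theorem ddtSeries_subst_q (f : ℂ⟦X⟧) :
    Y.ddtSeries (f.subst Y.q) = (thetaSeries f).subst Y.q := by
  rw [ddtSeries, thetaSeries_subst _ Y.hasSubst_q, thetaSeries_q, thetaSeries_apply f,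
    PowerSeries.subst_mul Y.hasSubst_q, PowerSeries.subst_X Y.hasSubst_q]
  linear_combination (Y.q * (PowerSeries.derivative ℂ f).subst Y.q) *
    Y.one_add_thetaSeries_a₁_mul_inv

/-- The inverse series of `q`. -/
def qInv : ℂ⟦X⟧ := Y.q.substInvOfIsUnit Y.isUnit_coeff_one_q

/-- The power series `T` with `T(q) = b₃ / 2`. -/
def instantonSeries : ℂ⟦X⟧ := (PowerSeries.C (1 / 2) * Y.b₃).subst Y.qInv

theorem hasSubst_qInv : PowerSeries.HasSubst Y.qInv :=
  PowerSeries.HasSubst.substInvOfIsUnit _ _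

theorem instantonSeries_subst_q :
    (Y.instantonSeries.subst Y.q : ℂ⟦X⟧) = PowerSeries.C (1 / 2) * Y.b₃ := by
  rw [instantonSeries, PowerSeries.subst_comp_subst_apply Y.hasSubst_qInv Y.hasSubst_q, qInv,
    PowerSeries.subst_substInvOfIsUnit_left _ Y.constantCoeff_q, PowerSeries.X_subst]

theorem constantCoeff_instantonSeries : PowerSeries.constantCoeff Y.instantonSeries = 0 :=
  PowerSeries.constantCoeff_subst_eq_zero (PowerSeries.constantCoeff_substInvOfIsUnit _ _) _
    (by simp [constantCoeff_b₃])

theorem isPotentialSeries_instantonSeries : Y.IsPotentialSeries Y.instantonSeries :=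
  ⟨Y.constantCoeff_instantonSeries, by rw [instantonSeries_subst_q, potential_eq]⟩

theorem ddt_eq (f : LogSeries) :
    Y.ddt f = Polynomial.C (1 + thetaSeries Y.a₁)⁻¹ * theta f := rfl

theorem ddt_add (f g : LogSeries) : Y.ddt (f + g) = Y.ddt f + Y.ddt g := by
  rw [ddt_eq, ddt_eq, ddt_eq, map_add, mul_add]

theorem ddt_C (f : ℂ⟦X⟧) : Y.ddt (Polynomial.C f) = Polynomial.C (Y.ddtSeries f) := by
  rw [ddt_eq, theta_C, ← Polynomial.C_mul, ddtSeries]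

theorem ddt_t : Y.ddt Y.t = 1 := by
  rw [ddt_eq, theta_t, ← Polynomial.C_mul, one_add_thetaSeries_a₁_mul_inv, Polynomial.C_1]

theorem ddt_half_t_sq : Y.ddt ((1 / 2 : ℂ) • Y.t ^ 2) = Y.t := by
  have h := Y.ddt_t
  rw [ddt_eq] at h ⊢
  rw [theta_smul, smul_eq_C_C_mul, theta_sq]
  linear_combination (2 * Polynomial.C (PowerSeries.C (1 / 2 : ℂ)) * Y.t) * h + Y.t * C_C_half

theorem ddtSeries_neg (f : ℂ⟦X⟧) : Y.ddtSeries (-f) = -Y.ddtSeries f := by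
  rw [ddtSeries, ddtSeries, map_neg, mul_neg]

theorem ddtSeries_half_b₃ (h : wronskianZ (Y.y 0) (Y.y 3) = wronskianZ (Y.y 1) (Y.y 2)) :
    Y.ddtSeries (PowerSeries.C (1 / 2) * Y.b₃) = -Y.b₂ := by
  have hh : PowerSeries.C (1 / 2 : ℂ) * 2 = 1 := by
    rw [← map_ofNat PowerSeries.C 2, ← map_mul]; norm_num
  rw [ddtSeries, Derivation.leibniz, thetaSeries_C, thetaSeries_b₃ Y h, smul_eq_mul, smul_eq_mul]
  linear_combination (-PowerSeries.C (1 / 2 : ℂ) * 2 * Y.b₂) * Y.one_add_thetaSeries_a₁_mul_inv -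
    Y.b₂ * hh

/-- One derivative takes T(q) = b₃/2 to -b₂ by the Calabi-Yau condition. Two more give -d²b₂/dt²,
while d²/dt² of t²/2 + b₂ is 1 + d²b₂/dt². -/
theorem isYukawaCoupling_instantonSeries
    (h : wronskianZ (Y.y 0) (Y.y 3) = wronskianZ (Y.y 1) (Y.y 2)) :
    Y.IsYukawaCoupling (1 - thetaSeries (thetaSeries (thetaSeries Y.instantonSeries))) := by
  have hone : (1 : ℂ⟦X⟧).subst Y.q = (1 : ℂ⟦X⟧) := by
    rw [← PowerSeries.coe_substAlgHom Y.hasSubst_q, map_one]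
  rw [IsYukawaCoupling, quot_two, ddt_add, ddt_half_t_sq, ddt_C, ddt_add, ddt_t, ddt_C,
    PowerSeries.subst_sub Y.hasSubst_q, hone, ← ddtSeries_subst_q, ← ddtSeries_subst_q,
    ← ddtSeries_subst_q, instantonSeries_subst_q, ddtSeries_half_b₃ Y h, ddtSeries_neg,
    ddtSeries_neg, sub_neg_eq_add, Polynomial.C_add, Polynomial.C_1]

end FrobeniusBasis

/-! ### Functions which are sums of power series near the origin -/

/-- The function `F` is the sum of the power series `f` near `0`. -/
def IsSumOf (F : ℂ → ℂ) (f : ℂ⟦X⟧) : Prop :=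
  ∀ᶠ z in 𝓝 0, HasSum (fun n => PowerSeries.coeff n f * z ^ n) (F z)

theorem isSumOf_iff {F : ℂ → ℂ} {f : ℂ⟦X⟧} : IsSumOf F f ↔ HasFPowerSeriesAt F
    (FormalMultilinearSeries.ofScalars ℂ fun n => PowerSeries.coeff n f) 0 := by
  rw [hasFPowerSeriesAt_iff, IsSumOf]
  simp only [FormalMultilinearSeries.coeff_ofScalars, smul_eq_mul, zero_add, mul_comm]

namespace IsSumOf

variable {F G : ℂ → ℂ} {f g : ℂ⟦X⟧}

theorem analyticAt (h : IsSumOf F f) : AnalyticAt ℂ F 0 := (isSumOf_iff.1 h).analyticAt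

theorem congr (h : IsSumOf F f) (hFG : ∀ᶠ z in 𝓝 0, F z = G z) : IsSumOf G f := by
  filter_upwards [h, hFG] with z h1 h2
  rwa [← h2]

theorem eventually_eq (h : IsSumOf F f) (h' : IsSumOf G f) : ∀ᶠ z in 𝓝 0, F z = G z := by
  filter_upwards [h, h'] with z h1 h2 using h1.unique h2

theorem series_unique (h : IsSumOf F f) (h' : IsSumOf F g) : f = g := by
  have e := (isSumOf_iff.1 h).eq_formalMultilinearSeries (isSumOf_iff.1 h')
  ext n
  have := congrArg (fun p => FormalMultilinearSeries.coeff p n) e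
  simpa only [FormalMultilinearSeries.coeff_ofScalars] using this

theorem apply_zero (h : IsSumOf F f) : F 0 = PowerSeries.constantCoeff f := by
  have h0 := h.self_of_nhds
  refine h0.unique ?_
  have := hasSum_single (f := fun n => PowerSeries.coeff n f * (0 : ℂ) ^ n) 0
    fun n hn => by simp [hn]
  simpa using this

theorem add (h : IsSumOf F f) (h' : IsSumOf G g) : IsSumOf (fun z => F z + G z) (f + g) := by
  filter_upwards [h, h'] with z h1 h2
  simpa only [map_add, add_mul] using h1.add h2

theorem mul (h : IsSumOf F f) (h' : IsSumOf G g) : IsSumOf (fun z => F z * G z) (f * g) := by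
  filter_upwards [h, h'] with z h1 h2
  have s1 := h1.summable.norm
  have s2 := h2.summable.norm
  have e := tsum_mul_tsum_eq_tsum_sum_antidiagonal_of_summable_norm s1 s2
  have s := (summable_norm_sum_mul_antidiagonal_of_summable_norm s1 s2).of_norm
  rw [h1.tsum_eq, h2.tsum_eq] at e
  rw [e]
  refine s.hasSum.congr_fun fun n => ?_
  rw [PowerSeries.coeff_mul, Finset.sum_mul]
  refine Finset.sum_congr rfl fun k hk => ?_
  rw [← Finset.HasAntidiagonal.mem_antidiagonal.1 hk, pow_add]; ring

theorem const (a : ℂ) : IsSumOf (fun _ => a) (PowerSeries.C a) := by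
  filter_upwards with z
  have := hasSum_single (f := fun n => PowerSeries.coeff n (PowerSeries.C a) * z ^ n) 0
    fun n hn => by simp [PowerSeries.coeff_C, hn]
  simpa using this

theorem id : IsSumOf (fun z => z) PowerSeries.X := by
  filter_upwards with z
  have := hasSum_single (f := fun n => PowerSeries.coeff n (PowerSeries.X : ℂ⟦X⟧) * z ^ n) 1
    fun n hn => by simp [PowerSeries.coeff_X, hn]
  simpa using this

theorem exp : IsSumOf Complex.exp (PowerSeries.exp ℂ) := by
  filter_upwards with z
  rw [Complex.exp_eq_exp_ℂ]
  refine (NormedSpace.expSeries_div_hasSum_exp z).congr_fun fun n => ?_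
  rw [PowerSeries.coeff_exp]
  simp [div_eq_inv_mul]

theorem pow (h : IsSumOf F f) (n : ℕ) : IsSumOf (fun z => F z ^ n) (f ^ n) := by
  induction n with
  | zero => simpa using const 1
  | succ n ih => simpa only [pow_succ] using ih.mul h

theorem exists_of_analyticAt (h : AnalyticAt ℂ F 0) : ∃ f, IsSumOf F f := by
  obtain ⟨p, hp⟩ := h
  refine ⟨PowerSeries.mk p.coeff, ?_⟩
  rw [hasFPowerSeriesAt_iff] at hp
  filter_upwards [hp] with z hz
  simpa only [PowerSeries.coeff_mk, smul_eq_mul, zero_add, mul_comm] using hz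

theorem inv (h : IsSumOf F f) (hf : PowerSeries.constantCoeff f ≠ 0) :
    IsSumOf (fun z => (F z)⁻¹) f⁻¹ := by
  have hF0 : F 0 ≠ 0 := by rwa [h.apply_zero]
  obtain ⟨g, hg⟩ := exists_of_analyticAt (h.analyticAt.fun_inv hF0)
  have h1 : IsSumOf (fun _ => 1) (f * g) := by
    refine (h.mul hg).congr ?_
    filter_upwards [h.analyticAt.continuousAt.eventually_ne hF0] with z hz
    exact mul_inv_cancel₀ hz
  have h2 : f * g = 1 := by
    rw [h1.series_unique (const 1), map_one]
  rwa [← (PowerSeries.eq_inv_iff_mul_eq_one hf).2 (by rwa [mul_comm])]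

theorem exists_shift (h : IsSumOf F f) : ∃ (G : ℂ → ℂ) (g : ℂ⟦X⟧), IsSumOf G g ∧
    f = PowerSeries.C (PowerSeries.constantCoeff f) + PowerSeries.X * g ∧
    ∀ᶠ z in 𝓝 0, F z = PowerSeries.constantCoeff f + z * G z := by
  have hd : IsSumOf (dslope F 0) (PowerSeries.mk fun n => PowerSeries.coeff (n + 1) f) := by
    have := (isSumOf_iff.1 h).has_fpower_series_dslope_fslope
    rw [hasFPowerSeriesAt_iff] at this
    filter_upwards [this] with z hz
    simpa only [FormalMultilinearSeries.coeff_fslope, FormalMultilinearSeries.coeff_ofScalars,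
      PowerSeries.coeff_mk, smul_eq_mul, zero_add, mul_comm] using hz
  refine ⟨_, _, hd, ?_, Filter.Eventually.of_forall fun z => ?_⟩
  · rw [add_comm]; exact f.eq_X_mul_shift_add_const
  · have := sub_smul_dslope F 0 z
    rw [sub_zero, smul_eq_mul] at this
    rw [this, h.apply_zero]; ring

/-- Analytic composition is matched with formal substitution one order at a time: with f = f(0) +
Xg, agreement for g modulo X^N becomes agreement for f modulo X^{N+1}, the extra factor being q. At
N = 0 only analyticity of the composite is needed. -/
theorem comp_aux {Q : ℂ → ℂ} {q : ℂ⟦X⟧} (hQ : IsSumOf Q q)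
    (hq : PowerSeries.constantCoeff q = 0) (N : ℕ) {F : ℂ → ℂ} {f : ℂ⟦X⟧} (hF : IsSumOf F f) :
    ∃ g, IsSumOf (fun z => F (Q z)) g ∧ PowerSeries.X ^ N ∣ g - f.subst q := by
  have hQ0 : Q 0 = 0 := by rw [hQ.apply_zero, hq]
  have hs := PowerSeries.HasSubst.of_constantCoeff_zero' hq
  induction N generalizing F f with
  | zero =>
    have hF' : AnalyticAt ℂ F (Q 0) := by rw [hQ0]; exact hF.analyticAt
    obtain ⟨g, hg⟩ := exists_of_analyticAt (hF'.comp hQ.analyticAt)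
    exact ⟨g, hg, by simp⟩
  | succ N ih =>
    obtain ⟨G, g, hG, hfg, hev⟩ := hF.exists_shift
    obtain ⟨k, hk, hdvd⟩ := ih hG
    refine ⟨PowerSeries.C (PowerSeries.constantCoeff f) + q * k, ?_, ?_⟩
    · refine ((const _).add (hQ.mul hk)).congr ?_
      have hQt : Filter.Tendsto Q (𝓝 0) (𝓝 0) := by
        have := hQ.analyticAt.continuousAt.tendsto
        rwa [hQ0] at this
      filter_upwards [hQt.eventually hev] with z hz
      rw [hz]
    · have hC : ((PowerSeries.C (PowerSeries.constantCoeff f) : ℂ⟦X⟧).subst q : ℂ⟦X⟧) =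
          PowerSeries.C (PowerSeries.constantCoeff f) := PowerSeries.subst_C _
      have e : PowerSeries.C (PowerSeries.constantCoeff f) + q * k - f.subst q =
          q * (k - g.subst q) := by
        conv_lhs => rw [hfg]
        rw [PowerSeries.subst_add hs, PowerSeries.subst_mul hs, PowerSeries.subst_X hs, hC]
        simp
        ring
      rw [e, pow_succ']
      exact mul_dvd_mul (PowerSeries.X_dvd_iff.2 hq) hdvd

/-- The expansion of an analytic function is unique, so the series obtained for the various N
coincide. Their difference from the formal substitution is divisible by every power of X. -/
theorem comp {Q : ℂ → ℂ} {q : ℂ⟦X⟧} (hF : IsSumOf F f) (hQ : IsSumOf Q q)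
    (hq : PowerSeries.constantCoeff q = 0) : IsSumOf (fun z => F (Q z)) (f.subst q) := by
  obtain ⟨g, hg, -⟩ := comp_aux hQ hq 0 hF
  have : g - f.subst q = 0 := by
    ext n
    obtain ⟨g', hg', hdvd⟩ := comp_aux hQ hq (n + 1) hF
    rw [hg.series_unique hg']
    exact PowerSeries.X_pow_dvd_iff.1 hdvd n n.lt_succ_self
  rwa [← sub_eq_zero.1 this]

/-- The analytic local inverse has an expansion which is a formal right inverse of q; it must equal
the formal left inverse. This gives the formal inverse a positive radius of convergence. -/
theorem exists_substInvOfIsUnit {Q : ℂ → ℂ} {q : ℂ⟦X⟧} (hQ : IsSumOf Q q)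
    (hq : PowerSeries.constantCoeff q = 0) (hq1 : IsUnit (PowerSeries.coeff 1 q)) :
    ∃ L, IsSumOf L (q.substInvOfIsUnit hq1) := by
  have hQ0 : Q 0 = 0 := by rw [hQ.apply_zero, hq]
  have hd : deriv Q 0 ≠ 0 := by
    rw [(isSumOf_iff.1 hQ).deriv]
    simpa using hq1.ne_zero
  set L := hQ.analyticAt.hasStrictDerivAt.localInverse _ _ _ hd with hL
  have hLa : AnalyticAt ℂ L 0 := by
    have := hQ.analyticAt.analyticAt_localInverse hd
    rwa [hQ0] at this
  have hL0 : L 0 = 0 := by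
    have : L (Q 0) = 0 := HasStrictFDerivAt.localInverse_apply_image ..
    rwa [hQ0] at this
  have hr : ∀ᶠ z in 𝓝 0, Q (L z) = z := by
    have := HasStrictDerivAt.eventually_right_inverse hQ.analyticAt.hasStrictDerivAt hd
    rwa [hQ0] at this
  obtain ⟨g, hg⟩ := exists_of_analyticAt hLa
  have hg0 : PowerSeries.constantCoeff g = 0 := by rw [← hg.apply_zero, hL0]
  have hqg : q.subst g = (PowerSeries.X : ℂ⟦X⟧) :=
    ((hQ.comp hg hg0).congr hr).series_unique id
  have hsg := PowerSeries.HasSubst.of_constantCoeff_zero' hg0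
  have hsq := PowerSeries.HasSubst.of_constantCoeff_zero' hq
  have e : q.substInvOfIsUnit hq1 = g := by
    have h1 := congrArg (fun p : ℂ⟦X⟧ => (p.subst g : ℂ⟦X⟧))
      (PowerSeries.subst_substInvOfIsUnit_left q hq hq1)
    simp only [PowerSeries.subst_X hsg] at h1
    rw [PowerSeries.subst_comp_subst_apply hsq hsg, hqg, PowerSeries.X_subst] at h1
    exact h1
  exact ⟨L, e ▸ hg⟩

end IsSumOf

variable {R : ℝ≥0}

theorem hasFPowerSeriesOnBall_seriesAt {f : ℂ⟦X⟧} (hf : f ∈ discSubring R) (hR : 0 < R) :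
    HasFPowerSeriesOnBall (seriesAt f)
      (FormalMultilinearSeries.ofScalars ℂ fun n => PowerSeries.coeff n f) 0 R := by
  have hrad : (R : ℝ≥0∞) ≤
      (FormalMultilinearSeries.ofScalars ℂ fun n => PowerSeries.coeff n f).radius := by
    refine ENNReal.le_of_forall_nnreal_lt fun r hr => ?_
    obtain ⟨C, hC⟩ := exists_coeff_bound_of_mem hf (ENNReal.coe_lt_coe.1 hr)
    refine FormalMultilinearSeries.le_radius_of_bound _ C fun n => ?_
    rw [FormalMultilinearSeries.ofScalars_norm]
    exact hC n
  have h := (FormalMultilinearSeries.hasFPowerSeriesOnBall _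
    (lt_of_lt_of_le (ENNReal.coe_pos.2 hR) hrad)).mono (ENNReal.coe_pos.2 hR) hrad
  refine h.congr fun z _ => ?_
  refine (FormalMultilinearSeries.ofScalars_sum_eq _ z).trans ?_
  simp only [seriesAt, smul_eq_mul]

theorem isSumOf_seriesAt {f : ℂ⟦X⟧} (hf : f ∈ discSubring R) (hR : 0 < R) :
    IsSumOf (seriesAt f) f :=
  isSumOf_iff.2 (hasFPowerSeriesOnBall_seriesAt hf hR).hasFPowerSeriesAt

theorem analyticAt_seriesAt {f : ℂ⟦X⟧} (hf : f ∈ discSubring R) {z : ℂ} (hz : ‖z‖₊ < R) :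
    AnalyticAt ℂ (seriesAt f) z := by
  refine (hasFPowerSeriesOnBall_seriesAt hf (lt_of_le_of_lt (by simp) hz)).analyticAt_of_mem ?_
  have hz' : ‖z‖ < R := hz
  simpa [Metric.mem_eball] using hz'

/-! ### Analyticity of q and continuation of the instanton series -/

namespace FrobeniusBasis

variable {Y : FrobeniusBasis}

/-- The value of the series `b₃`, divided by two. -/
def halfB₃At (Y : FrobeniusBasis) (z : ℂ) : ℂ :=
  1 / 2 * (seriesAt Y.α₃ z * (seriesAt Y.f₀ z)⁻¹ -
    seriesAt Y.α₁ z * (seriesAt Y.f₀ z)⁻¹ * (seriesAt Y.α₂ z * (seriesAt Y.f₀ z)⁻¹) +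
    1 / 3 * (seriesAt Y.α₁ z * (seriesAt Y.f₀ z)⁻¹) ^ 3)

theorem isSumOf_qAt (h : Y.ConvergesOn R) (hR : 0 < R) : IsSumOf Y.qAt Y.q := by
  have h0 := (isSumOf_seriesAt h.f₀ hR).inv (by simp [Y.f₀_zero])
  exact IsSumOf.id.mul (IsSumOf.exp.comp ((isSumOf_seriesAt h.α₁ hR).mul h0) Y.constantCoeff_a₁)

theorem isSumOf_halfB₃At (h : Y.ConvergesOn R) (hR : 0 < R) :
    IsSumOf Y.halfB₃At (PowerSeries.C (1 / 2) * Y.b₃) := by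
  have h0 := (isSumOf_seriesAt h.f₀ hR).inv (by simp [Y.f₀_zero])
  have h1 := (isSumOf_seriesAt h.α₁ hR).mul h0
  have h2 := (isSumOf_seriesAt h.α₂ hR).mul h0
  have h3 := (isSumOf_seriesAt h.α₃ hR).mul h0
  have := (IsSumOf.const (1 / 2)).mul ((h3.add ((IsSumOf.const (-1)).mul (h1.mul h2))).add
    ((IsSumOf.const (1 / 3)).mul (h1.pow 3)))
  have e : Y.b₃ = Y.α₃ * Y.f₀⁻¹ +
      PowerSeries.C (-1) * (Y.α₁ * Y.f₀⁻¹ * (Y.α₂ * Y.f₀⁻¹)) +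
      PowerSeries.C (1 / 3) * (Y.α₁ * Y.f₀⁻¹) ^ 3 := by
    rw [b₃, a₁, map_neg, map_one]; ring
  rw [e]
  refine this.congr (Filter.Eventually.of_forall fun z => ?_)
  simp only [halfB₃At]
  ring

theorem exists_isSumOf_instantonSeries (h : Y.ConvergesOn R) (hR : 0 < R) :
    ∃ F, IsSumOf F Y.instantonSeries := by
  obtain ⟨L, hL⟩ := (isSumOf_qAt h hR).exists_substInvOfIsUnit Y.constantCoeff_q
    Y.isUnit_coeff_one_q
  exact ⟨_, (isSumOf_halfB₃At h hR).comp hL (PowerSeries.constantCoeff_substInvOfIsUnit _ _)⟩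

theorem radius_instantonSeries_pos (h : Y.ConvergesOn R) (hR : 0 < R) :
    0 < (FormalMultilinearSeries.ofScalars ℂ fun n =>
      PowerSeries.coeff n Y.instantonSeries).radius := by
  obtain ⟨F, hF⟩ := exists_isSumOf_instantonSeries h hR
  exact (isSumOf_iff.1 hF).radius_pos

theorem analyticAt_qAt (h : Y.ConvergesOn R) {z : ℂ} (hz : ‖z‖₊ < R)
    (h0 : seriesAt Y.f₀ z ≠ 0) : AnalyticAt ℂ Y.qAt z :=
  analyticAt_id.mul ((analyticAt_seriesAt h.α₁ hz).fun_div (analyticAt_seriesAt h.f₀ hz) h0).cexp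

theorem analyticAt_halfB₃At (h : Y.ConvergesOn R) {z : ℂ} (hz : ‖z‖₊ < R)
    (h0 : seriesAt Y.f₀ z ≠ 0) : AnalyticAt ℂ Y.halfB₃At z := by
  have hi := (analyticAt_seriesAt h.f₀ hz).fun_inv h0
  have h1 := (analyticAt_seriesAt h.α₁ hz).fun_mul hi
  have h2 := (analyticAt_seriesAt h.α₂ hz).fun_mul hi
  have h3 := (analyticAt_seriesAt h.α₃ hz).fun_mul hi
  exact analyticAt_const.fun_mul ((h3.fun_sub (h1.fun_mul h2)).fun_add
    (analyticAt_const.fun_mul (h1.fun_pow 3)))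

/-- Analytic continuation of `T(q(z)) = b₃(z) / 2` along the segment from `0` to `z`. -/
theorem eq_halfB₃At_of_analyticAt (h : Y.ConvergesOn R) {z : ℂ} (hz : ‖z‖₊ < R)
    (h0 : ∀ s ∈ Set.Icc (0 : ℝ) 1, seriesAt Y.f₀ (s * z) ≠ 0) {F : ℂ → ℂ}
    (hF : IsSumOf F Y.instantonSeries)
    (hFa : ∀ s ∈ Set.Icc (0 : ℝ) 1, AnalyticAt ℂ F (Y.qAt (s * z))) :
    F (Y.qAt z) = Y.halfB₃At z := by
  have hR : 0 < R := lt_of_le_of_lt (by simp) hz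
  -- The identity theorem is applied on the segment itself: it is connected, and both functions are
  -- analytic near each of its points, so no open domain has to be chosen.
  set U : Set ℂ := (fun s : ℝ => (s : ℂ) * z) '' Set.Icc 0 1 with hU
  have hnorm : ∀ s ∈ Set.Icc (0 : ℝ) 1, ‖(s : ℂ) * z‖₊ < R := fun s hs => by
    refine lt_of_le_of_lt ?_ hz
    rw [← NNReal.coe_le_coe, coe_nnnorm, coe_nnnorm, norm_mul, Complex.norm_real,
      Real.norm_of_nonneg hs.1]
    exact mul_le_of_le_one_left (norm_nonneg _) hs.2
  have h1 : AnalyticOnNhd ℂ (fun w => F (Y.qAt w)) U := by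
    rintro _ ⟨s, hs, rfl⟩
    exact (hFa s hs).comp (analyticAt_qAt h (hnorm s hs) (h0 s hs))
  have h2 : AnalyticOnNhd ℂ Y.halfB₃At U := by
    rintro _ ⟨s, hs, rfl⟩
    exact analyticAt_halfB₃At h (hnorm s hs) (h0 s hs)
  have hpre : IsPreconnected U :=
    isPreconnected_Icc.image _ (by fun_prop : Continuous fun s : ℝ => (s : ℂ) * z).continuousOn
  -- Near 0 the equality is the formal identity T(q) = b₃/2, turned into one of functions by
  -- `IsSumOf.comp`.
  have hev : (fun w => F (Y.qAt w)) =ᶠ[𝓝 0] Y.halfB₃At := by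
    have h3 := hF.comp (isSumOf_qAt h hR) Y.constantCoeff_q
    rw [instantonSeries_subst_q] at h3
    exact h3.eventually_eq (isSumOf_halfB₃At h hR)
  have h0U : (0 : ℂ) ∈ U := ⟨0, by simp, by simp⟩
  have hzU : z ∈ U := ⟨1, by simp, by simp⟩
  exact h1.eqOn_of_preconnected_of_eventuallyEq h2 hpre h0U hev hzU

end FrobeniusBasis

/-! ### The value of the potential -/

/-- Set ỹᵢ = yᵢ - tᵢy₀, which vanishes at the point, and let B(f, g) be the alternating form in the
hypotheses. On the ỹᵢ only c(f'g'' - f''g') survives. The Calabi-Yau condition gives ỹ₃' = t₁ỹ₂' -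
t₂ỹ₁', and the same for second derivatives, so B(ỹ₁, ỹ₃) = t₁B(ỹ₁, ỹ₂). Expanding both sides
bilinearly yields the conclusion. -/
theorem potential_relation {a b c m₀ m₂ m₃ t₁ t₂ t₃ y₀ y₀' y₀'' y₀''' y₁' y₁'' y₁''' y₂' y₂'' y₂'''
    y₃' y₃'' y₃''' : ℂ} (h0 : y₀ ≠ 0)
    (hc : y₀ * y₃' - y₀' * (t₃ * y₀) = t₁ * y₀ * y₂' - y₁' * (t₂ * y₀))
    (hc' : y₀ * y₃'' - y₀'' * (t₃ * y₀) = t₁ * y₀ * y₂'' - y₁'' * (t₂ * y₀))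
    (h01 : a * (y₀ * y₁' - y₀' * (t₁ * y₀)) + b * (y₀ * y₁'' - y₀'' * (t₁ * y₀)) +
      c * (y₀' * y₁'' + y₀ * y₁''' - y₀''' * (t₁ * y₀) - y₀'' * y₁') = m₀)
    (h02 : a * (y₀ * y₂' - y₀' * (t₂ * y₀)) + b * (y₀ * y₂'' - y₀'' * (t₂ * y₀)) +
      c * (y₀' * y₂'' + y₀ * y₂''' - y₀''' * (t₂ * y₀) - y₀'' * y₂') = 0)
    (h03 : a * (y₀ * y₃' - y₀' * (t₃ * y₀)) + b * (y₀ * y₃'' - y₀'' * (t₃ * y₀)) +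
      c * (y₀' * y₃'' + y₀ * y₃''' - y₀''' * (t₃ * y₀) - y₀'' * y₃') = m₂)
    (h12 : a * (t₁ * y₀ * y₂' - y₁' * (t₂ * y₀)) + b * (t₁ * y₀ * y₂'' - y₁'' * (t₂ * y₀)) +
      c * (y₁' * y₂'' + t₁ * y₀ * y₂''' - y₁''' * (t₂ * y₀) - y₁'' * y₂') = m₂)
    (h13 : a * (t₁ * y₀ * y₃' - y₁' * (t₃ * y₀)) + b * (t₁ * y₀ * y₃'' - y₁'' * (t₃ * y₀)) +
      c * (y₁' * y₃'' + t₁ * y₀ * y₃''' - y₁''' * (t₃ * y₀) - y₁'' * y₃') = 2 * m₃) :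
    m₀ * (t₁ * t₂ - t₃) + 2 * t₁ * m₂ - 2 * m₃ = 0 := by
  have g1 : t₁ * y₂' - y₃' + t₃ * y₀' - t₂ * y₁' = 0 :=
    mul_left_cancel₀ h0 (by linear_combination -hc)
  have g2 : t₁ * y₂'' - y₃'' + t₃ * y₀'' - t₂ * y₁'' = 0 :=
    mul_left_cancel₀ h0 (by linear_combination -hc')
  linear_combination -t₁ * h12 + t₁ ^ 2 * h02 - (t₁ * t₂ - t₃) * h01 + h13 - t₁ * h03 +
    c * ((y₁' - t₁ * y₀') * g2 - (y₁'' - t₁ * y₀'') * g1)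

variable {R : ℝ≥0}

theorem theta_wronskianZ (p q : LogSeries) :
    theta (wronskianZ p q) = p * theta (theta q) - theta (theta p) * q := by
  rw [wronskianZ, map_sub, theta_mul, theta_mul]; ring

theorem theta_theta_wronskianZ (p q : LogSeries) :
    theta (theta (wronskianZ p q)) = theta p * theta (theta q) + p * theta (theta (theta q)) -
      theta (theta (theta p)) * q - theta (theta p) * theta q := by
  rw [theta_wronskianZ, map_sub, theta_mul, theta_mul]; ring

theorem logSeriesAt_wronskianZ {z : ℂ} (hz : ‖z‖₊ < R) (l : ℂ)
    {p q : LogSeries} (hp : p ∈ logSubring R) (hq : q ∈ logSubring R) :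
    logSeriesAt (wronskianZ p q) z l =
    logSeriesAt p z l * logSeriesAt (theta q) z l -
      logSeriesAt (theta p) z l * logSeriesAt q z l := by
  have hp1 := theta_mem_logSubring hp
  have hq1 := theta_mem_logSubring hq
  rw [wronskianZ, logSeriesAt_sub hz l (mul_mem hp hq1) (mul_mem hp1 hq),
    logSeriesAt_mul hz l hp hq1, logSeriesAt_mul hz l hp1 hq]

theorem logSeriesAt_theta_wronskianZ {z : ℂ} (hz : ‖z‖₊ < R) (l : ℂ)
    {p q : LogSeries} (hp : p ∈ logSubring R) (hq : q ∈ logSubring R) :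
    logSeriesAt (theta (wronskianZ p q)) z l =
    logSeriesAt p z l * logSeriesAt (theta (theta q)) z l -
      logSeriesAt (theta (theta p)) z l * logSeriesAt q z l := by
  have hp2 := theta_mem_logSubring (theta_mem_logSubring hp)
  have hq2 := theta_mem_logSubring (theta_mem_logSubring hq)
  rw [theta_wronskianZ, logSeriesAt_sub hz l (mul_mem hp hq2) (mul_mem hp2 hq),
    logSeriesAt_mul hz l hp hq2, logSeriesAt_mul hz l hp2 hq]

theorem logSeriesAt_theta_theta_wronskianZ {z : ℂ} (hz : ‖z‖₊ < R) (l : ℂ)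
    {p q : LogSeries} (hp : p ∈ logSubring R) (hq : q ∈ logSubring R) :
    logSeriesAt (theta (theta (wronskianZ p q))) z l =
    logSeriesAt (theta p) z l * logSeriesAt (theta (theta q)) z l +
      logSeriesAt p z l * logSeriesAt (theta (theta (theta q))) z l -
      logSeriesAt (theta (theta (theta p))) z l * logSeriesAt q z l -
      logSeriesAt (theta (theta p)) z l * logSeriesAt (theta q) z l := by
  have hp1 := theta_mem_logSubring hp
  have hq1 := theta_mem_logSubring hq
  have hp2 := theta_mem_logSubring hp1
  have hq2 := theta_mem_logSubring hq1
  have hp3 := theta_mem_logSubring hp2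
  have hq3 := theta_mem_logSubring hq2
  rw [theta_theta_wronskianZ,
    logSeriesAt_sub hz l (sub_mem (add_mem (mul_mem hp1 hq2) (mul_mem hp hq3)) (mul_mem hp3 hq))
      (mul_mem hp2 hq1),
    logSeriesAt_sub hz l (add_mem (mul_mem hp1 hq2) (mul_mem hp hq3)) (mul_mem hp3 hq),
    logSeriesAt_add hz l (mul_mem hp1 hq2) (mul_mem hp hq3), logSeriesAt_mul hz l hp1 hq2,
    logSeriesAt_mul hz l hp hq3, logSeriesAt_mul hz l hp3 hq, logSeriesAt_mul hz l hp2 hq1]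

theorem logSeriesAt_quadraticTheta {z : ℂ} (hz : ‖z‖₊ < R) (l : ℂ)
    {p : LogSeries} (hp : p ∈ logSubring R) (a b c : ℂ) :
    logSeriesAt (quadraticTheta a b c p) z l =
    a * logSeriesAt p z l + b * logSeriesAt (theta p) z l +
      c * logSeriesAt (theta (theta p)) z l := by
  have hp1 := theta_mem_logSubring hp
  have hp2 := theta_mem_logSubring hp1
  rw [quadraticTheta, logSeriesAt_add hz l (add_mem (smul_mem_logSubring hp a)
      (smul_mem_logSubring hp1 b)) (smul_mem_logSubring hp2 c),
    logSeriesAt_add hz l (smul_mem_logSubring hp a) (smul_mem_logSubring hp1 b),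
    logSeriesAt_smul hz l a hp, logSeriesAt_smul hz l b hp1, logSeriesAt_smul hz l c hp2]

theorem logSeriesAt_quadraticTheta_wronskianZ {z : ℂ} (hz : ‖z‖₊ < R) (l : ℂ)
    {p q : LogSeries} (hp : p ∈ logSubring R) (hq : q ∈ logSubring R) (a b c : ℂ) :
    logSeriesAt (quadraticTheta a b c (wronskianZ p q)) z l =
      a * (logSeriesAt p z l * logSeriesAt (theta q) z l -
        logSeriesAt (theta p) z l * logSeriesAt q z l) +
      b * (logSeriesAt p z l * logSeriesAt (theta (theta q)) z l -
        logSeriesAt (theta (theta p)) z l * logSeriesAt q z l) +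
      c * (logSeriesAt (theta p) z l * logSeriesAt (theta (theta q)) z l +
        logSeriesAt p z l * logSeriesAt (theta (theta (theta q))) z l -
        logSeriesAt (theta (theta (theta p))) z l * logSeriesAt q z l -
        logSeriesAt (theta (theta p)) z l * logSeriesAt (theta q) z l) := by
  rw [logSeriesAt_quadraticTheta hz l (wronskianZ_mem_logSubring hp hq),
    logSeriesAt_wronskianZ hz l hp hq, logSeriesAt_theta_wronskianZ hz l hp hq,
    logSeriesAt_theta_theta_wronskianZ hz l hp hq]

theorem quadraticTheta_smul (a b c s : ℂ) (p : LogSeries) :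
    quadraticTheta a b c (s • p) = s • quadraticTheta a b c p := by
  simp only [quadraticTheta, theta_smul, smul_add, smul_comm s]

namespace FrobeniusBasis

variable {Y : FrobeniusBasis}

theorem logSeriesAt_y_zero (z l : ℂ) : logSeriesAt (Y.y 0) z l = seriesAt Y.f₀ z := by
  rw [y_zero, logSeriesAt_C]

theorem logSeriesAt_y_one (h : Y.ConvergesOn R) {z : ℂ} (hz : ‖z‖₊ < R) (l : ℂ) :
    logSeriesAt (Y.y 1) z l = seriesAt Y.f₀ z * l + seriesAt Y.α₁ z := by
  have h0 := C_mem_logSubring.2 h.f₀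
  have h1 := C_mem_logSubring.2 h.α₁
  have hX := X_mem_logSubring (R := R)
  rw [y_one, logSeriesAt_add hz l (mul_mem h0 hX) h1, logSeriesAt_mul hz l h0 hX]
  simp only [logSeriesAt_C, logSeriesAt_X]

theorem logSeriesAt_y_two (h : Y.ConvergesOn R) {z : ℂ} (hz : ‖z‖₊ < R) (l : ℂ) :
    logSeriesAt (Y.y 2) z l = 1 / 2 * (seriesAt Y.f₀ z * l ^ 2) + seriesAt Y.α₁ z * l +
      seriesAt Y.α₂ z := by
  have h0 := C_mem_logSubring.2 h.f₀
  have h1 := C_mem_logSubring.2 h.α₁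
  have h2 := C_mem_logSubring.2 h.α₂
  have hX := X_mem_logSubring (R := R)
  have hX2 := pow_mem hX 2
  have e0 := smul_mem_logSubring (mul_mem h0 hX2) (1 / 2)
  have e1 := mul_mem h1 hX
  rw [y_two, logSeriesAt_add hz l (add_mem e0 e1) h2, logSeriesAt_add hz l e0 e1,
    logSeriesAt_smul hz l _ (mul_mem h0 hX2), logSeriesAt_mul hz l h0 hX2,
    logSeriesAt_mul hz l h1 hX, logSeriesAt_pow hz l hX]
  simp only [logSeriesAt_C, logSeriesAt_X]

theorem logSeriesAt_y_three (h : Y.ConvergesOn R) {z : ℂ} (hz : ‖z‖₊ < R) (l : ℂ) :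
    logSeriesAt (Y.y 3) z l = 1 / 6 * (seriesAt Y.f₀ z * l ^ 3) +
      1 / 2 * (seriesAt Y.α₁ z * l ^ 2) + seriesAt Y.α₂ z * l + seriesAt Y.α₃ z := by
  have h0 := C_mem_logSubring.2 h.f₀
  have h1 := C_mem_logSubring.2 h.α₁
  have h2 := C_mem_logSubring.2 h.α₂
  have h3 := C_mem_logSubring.2 h.α₃
  have hX := X_mem_logSubring (R := R)
  have hX2 := pow_mem hX 2
  have hX3 := pow_mem hX 3
  have e0 := smul_mem_logSubring (mul_mem h0 hX3) (1 / 6)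
  have e1 := smul_mem_logSubring (mul_mem h1 hX2) (1 / 2)
  have e2 := mul_mem h2 hX
  rw [y_three, logSeriesAt_add hz l (add_mem (add_mem e0 e1) e2) h3,
    logSeriesAt_add hz l (add_mem e0 e1) e2, logSeriesAt_add hz l e0 e1,
    logSeriesAt_smul hz l _ (mul_mem h0 hX3), logSeriesAt_smul hz l _ (mul_mem h1 hX2),
    logSeriesAt_mul hz l h0 hX3, logSeriesAt_mul hz l h1 hX2, logSeriesAt_mul hz l h2 hX,
    logSeriesAt_pow hz l hX, logSeriesAt_pow hz l hX]
  simp only [logSeriesAt_C, logSeriesAt_X]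

/-- The numerical form of Φ = t³/6 - b₃/2: once t is formed, no logarithm remains in the second
term. -/
theorem potentialAt_eq (h : Y.ConvergesOn R) {z : ℂ} (hz : ‖z‖₊ < R) (l : ℂ)
    (h0 : seriesAt Y.f₀ z ≠ 0) : Y.potentialAt z l = 1 / 6 * Y.tAt z l ^ 3 - Y.halfB₃At z := by
  rw [potentialAt, tAt, halfB₃At, logSeriesAt_y_zero, logSeriesAt_y_one h hz,
    logSeriesAt_y_two h hz, logSeriesAt_y_three h hz]
  field_simp
  ring

theorem mul_exp_tAt (h : Y.ConvergesOn R) {z u l : ℂ} (hz : ‖z‖₊ < R)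
    (h0 : seriesAt Y.f₀ z ≠ 0) (hzl : z = u * Complex.exp l) :
    u * Complex.exp (Y.tAt z l) = Y.qAt z := by
  have e : Y.tAt z l = l + seriesAt Y.α₁ z / seriesAt Y.f₀ z := by
    rw [tAt, logSeriesAt_y_zero, logSeriesAt_y_one h hz]
    field_simp
  rw [e, Complex.exp_add, ← mul_assoc, ← hzl, qAt]

end FrobeniusBasis

theorem IsPullback.potentialAt_eq_of_hasRamanujanExpansion {r : HypergeometricCase}
    (hr : r.IsAdmissible) {d : Fin 4 → ℂ⟦X⟧} {Y : FrobeniusBasis} (h : IsPullback r d Y)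
    (hA : (fun x : ℝ => (r.A x : ℂ) - (1 + r.e / 2 * (Real.pi : ℂ) ^ 2 * x ^ 2
      - r.h * riemannZeta 3 * x ^ 3)) =O[𝓝 0] fun x : ℝ => x ^ 4)
    {z u l a b c k j : ℂ} (hz : r.ρ * ‖z‖ < 1) (hzl : z = u * Complex.exp l) (hu : u ≠ 0)
    (hR : HasRamanujanExpansion r u l a b c k j) (h0 : seriesAt Y.f₀ z ≠ 0) :
    Y.potentialAt z l - (Real.pi : ℂ) ^ 2 / 2 * (k + r.e) * Y.tAt z l
      - r.h * riemannZeta 3 = 0 := by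
  have hzr := HypergeometricCase.nnnorm_lt_radius hr hz
  have hY := (h.convergesOn hr).y_mem
  obtain ⟨e0, e1, e2, e3⟩ :=
    r.quadraticTheta_eq_of_hasRamanujanExpansion hr hA hz hzl hu hR
  have hf3 : frob r.hypCoeff 3 = (1 / 2 : ℂ) • wronskianZ (Y.y 1) (Y.y 3) := by
    rw [h.wronskianZ_one_three, smul_smul]; norm_num
  have hw13 := wronskianZ_mem_logSubring (hY 1) (hY 3)
  rw [hf3, quadraticTheta_smul, logSeriesAt_smul hzr l] at e3
  swap
  · exact add_mem (add_mem (smul_mem_logSubring hw13 a)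
      (smul_mem_logSubring (theta_mem_logSubring hw13) b))
      (smul_mem_logSubring (theta_mem_logSubring (theta_mem_logSubring hw13)) c)
  -- The value at w₂ serves twice, once for W₁₂ and, through the Calabi-Yau condition, once for W₀₃.
  have e2' := e2
  rw [← h.wronskianZ_one_two, ← h.calabiYau, logSeriesAt_quadraticTheta_wronskianZ hzr l
    (hY 0) (hY 3)] at e2'
  rw [← h.wronskianZ_zero_one, logSeriesAt_quadraticTheta_wronskianZ hzr l (hY 0) (hY 1)] at e0
  rw [← h.wronskianZ_zero_two, logSeriesAt_quadraticTheta_wronskianZ hzr l (hY 0) (hY 2)] at e1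
  rw [← h.wronskianZ_one_two, logSeriesAt_quadraticTheta_wronskianZ hzr l (hY 1) (hY 2)] at e2
  rw [logSeriesAt_quadraticTheta_wronskianZ hzr l (hY 1) (hY 3)] at e3
  have hc := congrArg (fun p => logSeriesAt p z l) h.calabiYau
  have hc' := congrArg (fun p => logSeriesAt (theta p) z l) h.calabiYau
  simp only [logSeriesAt_wronskianZ hzr l (hY _) (hY _)] at hc
  simp only [logSeriesAt_theta_wronskianZ hzr l (hY _) (hY _)] at hc'
  have hy0 : logSeriesAt (Y.y 0) z l ≠ 0 := by rwa [FrobeniusBasis.logSeriesAt_y_zero]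
  have ht : ∀ i, ∃ t, logSeriesAt (Y.y i) z l = t * logSeriesAt (Y.y 0) z l :=
    fun i => ⟨_, (div_mul_cancel₀ _ hy0).symm⟩
  obtain ⟨t₁, ht₁⟩ := ht 1
  obtain ⟨t₂, ht₂⟩ := ht 2
  obtain ⟨t₃, ht₃⟩ := ht 3
  simp only [ht₁, ht₂, ht₃] at e0 e1 e2 e2' e3 hc hc'
  have key := potential_relation (m₃ := r.h * riemannZeta 3 * (1 / (Real.pi : ℂ) ^ 2))
    hy0 hc hc' e0 e1 e2' e2 (by linear_combination 2 * e3)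
  have hpi : (Real.pi : ℂ) ≠ 0 := by exact_mod_cast Real.pi_ne_zero
  have hP : Y.potentialAt z l = 1 / 2 * (t₁ * t₂ - t₃) := by
    rw [FrobeniusBasis.potentialAt, ht₁, ht₂, ht₃]; field_simp
  have hT : Y.tAt z l = t₁ := by rw [FrobeniusBasis.tAt, ht₁, mul_div_cancel_right₀ _ hy0]
  have hpi2 : (Real.pi : ℂ) ^ 2 * (1 / (Real.pi : ℂ) ^ 2) = 1 := by field_simp
  rw [hP, hT]
  linear_combination (Real.pi : ℂ) ^ 2 / 2 * key - (1 / 2 * (t₁ * t₂ - t₃) -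
    t₁ * r.e / 2 * (Real.pi : ℂ) ^ 2 - r.h * riemannZeta 3) * hpi2

end

theorem mainTheorem1 (r : HypergeometricCase) (hr : r ∈ hypergeometricTable) :
    -- `e` and `h` are the invariants of the expansion of `A_x`
    ((fun x : ℝ => (r.A x : ℂ) -
        (1 + r.e / 2 * (Real.pi : ℂ) ^ 2 * x ^ 2 - r.h * riemannZeta 3 * x ^ 3))
      =O[𝓝 0] fun x : ℝ => x ^ 4) ∧
    -- the pullback exists
    (∃ (d : Fin 4 → ℂ⟦X⟧) (Y : FrobeniusBasis), IsPullback r d Y) ∧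
    ∀ (d : Fin 4 → ℂ⟦X⟧) (Y : FrobeniusBasis), IsPullback r d Y →
      -- the Frobenius series converge on the disc of convergence of `w₀`
      (∀ z : ℂ, r.ρ * ‖z‖ < 1 →
        ConvergesAt Y.f₀ z ∧ ConvergesAt Y.α₁ z ∧ ConvergesAt Y.α₂ z ∧ ConvergesAt Y.α₃ z) ∧
      ∃ T K : ℂ⟦X⟧,
        Y.IsPotentialSeries T ∧ Y.IsYukawaCoupling K ∧
        -- `(q d/dq)³ T = 1 - K`
        thetaSeries (thetaSeries (thetaSeries T)) = 1 - K ∧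
        -- `T` has a positive radius of convergence
        0 < (FormalMultilinearSeries.ofScalars ℂ fun n => PowerSeries.coeff n T).radius ∧
        ∀ z u l a b c k j : ℂ, r.ρ * ‖z‖ < 1 → (u = 1 ∨ u = -1) → z = u * Complex.exp l →
          HasRamanujanExpansion r u l a b c k j →
          -- the equation in terms of `Φ`, wherever `t = y₁ / y₀` is defined
          (seriesAt Y.f₀ z ≠ 0 →
            Y.potentialAt z l - (Real.pi : ℂ) ^ 2 / 2 * (k + r.e) * Y.tAt z l
              - r.h * riemannZeta 3 = 0) ∧
          -- the equation in terms of `T`, where `F` is the sum of `T` near `0`, continued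
          -- analytically along the image under `q` of the segment from `0` to `z`
          ((∀ s ∈ Set.Icc (0 : ℝ) 1, seriesAt Y.f₀ (s * z) ≠ 0) →
            ∀ F : ℂ → ℂ,
              HasFPowerSeriesAt F
                (FormalMultilinearSeries.ofScalars ℂ fun n => PowerSeries.coeff n T) 0 →
              (∀ s ∈ Set.Icc (0 : ℝ) 1, AnalyticAt ℂ F (Y.qAt (s * z))) →
              1 / 6 * Y.tAt z l ^ 3 - (Real.pi : ℂ) ^ 2 / 2 * (k + r.e) * Y.tAt z l
                - r.h * riemannZeta 3 - F (u * Complex.exp (Y.tAt z l)) = 0) := by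
  have hr' := HypergeometricCase.isAdmissible_of_mem hr
  have hA := HypergeometricCase.A_sub_isBigO hr
  refine ⟨hA, ⟨_, _, HypergeometricCase.exists_isPullback hr'⟩, fun d Y h => ?_⟩
  have hY := h.convergesOn hr'
  have hrad : ∀ {z : ℂ}, r.ρ * ‖z‖ < 1 → ‖z‖₊ < r.radius :=
    fun hz => HypergeometricCase.nnnorm_lt_radius hr' hz
  have hR : 0 < r.radius := by simpa using hrad (z := 0) (by simp)
  -- K is taken to be 1 - θ³T, so the relation between T and K is immediate; that this K is the
  -- Yukawa coupling is where the Calabi-Yau condition enters.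
  refine ⟨fun z hz => ⟨convergesAt_of_mem hY.f₀ (hrad hz), convergesAt_of_mem hY.α₁ (hrad hz),
    convergesAt_of_mem hY.α₂ (hrad hz), convergesAt_of_mem hY.α₃ (hrad hz)⟩, Y.instantonSeries,
    _, Y.isPotentialSeries_instantonSeries, Y.isYukawaCoupling_instantonSeries h.calabiYau,
    (sub_sub_cancel _ _).symm, FrobeniusBasis.radius_instantonSeries_pos hY hR, ?_⟩
  intro z u l a b c k j hz hu hzl hE
  have hu0 : u ≠ 0 := by rcases hu with rfl | rfl <;> norm_num
  refine ⟨h.potentialAt_eq_of_hasRamanujanExpansion hr' hA hz hzl hu0 hE, fun h0 F hF hFa => ?_⟩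
  have h0z : seriesAt Y.f₀ z ≠ 0 := by simpa using h0 1 (by simp)
  have hΦ := h.potentialAt_eq_of_hasRamanujanExpansion hr' hA hz hzl hu0 hE h0z
  rw [FrobeniusBasis.potentialAt_eq hY (hrad hz) l h0z] at hΦ
  rw [FrobeniusBasis.mul_exp_tAt hY (hrad hz) h0z hzl,
    FrobeniusBasis.eq_halfB₃At_of_analyticAt hY (hrad hz) h0 (isSumOf_iff.2 hF) hFa]
  linear_combination hΦ
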